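/- **Setting.** Put $f(\alpha,\beta)=(\alpha+\beta)\bmod 2$. For $p\in(0,1)$, a local update function is a random map $F:\{0,1\}^3\to\{0,1\}$ such that, for every $(a,b,c)$, $F(a,b,c)=f(a,c)$ with probability $p$ and $F(a,b,c)=1-f(a,c)$ with probability $1-p$ (the joint law of the eight values is otherwise arbitrary). Let $(F_{x,t})_{x\in\mathbb Z,\,t\in\mathbb N}$ be i.i.d. copies of $F$. For $\xi\in\{0,1\}^{\mathbb Z}$ let $X_0^\xi=\xi$ and $X^\xi_{t+1}(x)=F_{x,t}(X^\xi_t(x-1),X^\xi_t(x),X^\xi_t(x+1))$; for $\xi,\zeta\in\{0,1\}^{\mathbb Z}$ let $Y_t^{\xi,\zeta}(x)=(X_t^{\xi+\zeta}(x)-X_t^\xi(x))\bmod 2$. Write $\mathbb P_{\xi,\zeta}$ for probabilities concerning $(X_t,Y_t)=(X_t^\xi,Y_t^{\xi,\zeta})$, and $\mathbb P_\xi$ for those concerning $X_t=X^\xi_t$. Let $q[(a,b,c),(u,v,w)]=\mathbb P[F(a+u,b+v,c+w)=F(a,b,c)]$ (sums mod 2), $$\varepsilon=\max_{(a,b,c)}\max\bigl(q[(a,b,c),(0,0,1)],\,q[(a,b,c),(1,0,0)]\bigr),$$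 and let $(a^*,b^*,c^*)$ be any triple attaining this maximum. Assume $\varepsilon>0$. Set $K=10\lceil\varepsilon^{-3/2}\rceil$, $T=4K$, $\ell_0=3K/10$, $\ell_n=\lceil \ell_0\log(1/\varepsilon)^{-2n}\rceil$ for $n\ge1$, $\theta=e^{-\varepsilon^{-1/3}}$, and, for integer intervals, $I=[-K,K]$, $J_+=[6K/5,9K/5]$, $J_-=[-9K/5,-6K/5]$, $J=J_-\cup J_+$. For an integer interval $[g,h]$ with at least $10$ elements, a sequence $(s_x)_{x\in[g,h]}$ is *nice* if for each $i\in\{1,\dots,8\}$ at least a proportion $1/9$ of the sites $x\in[g,h-2]\cap(i+8\mathbb Z)$ satisfy $(s_x,s_{x+1},s_{x+2})=(a^*,b^*,c^*)$. For $\ell \ge 10$, a sequence on a finite set $A\subset\mathbb Z$ is *$\ell$-nice* if its restriction to every interval contained in $A$ with at least $\ell$ elements is nice. Let $$Q_\ell(\xi)=\mathbb P_\xi\bigl(X_t(J)\text{ is not }\ell\text{-nice for some }0\le t\le K-1\bigr).$$ Let $\mathcal G$ be the set of $0$-$1$ sequences which, on some interval with at least $\ell_1$ elements, coincide with the constant sequence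 $1$ or with a translate of the periodic sequence $\dots0101\dots$, or which, on some interval with at least $\ell_2$ elements, coincide with a translate of the periodic sequence $\dots01110111\dots$. A pair $(z,k)\in\mathbb Z\times\mathbb N$ is *good* if (i) $Y_{kT}$ is not identically $0$ on $zK+I$; (ii) $Y_{kT}(zK+J_-)\notin\mathcal G$ and $Y_{kT}(zK+J_+)\notin\mathcal G$; (iii) $Q_{\ell_3}\bigl((X_{kT}(zK+x))_{x\in\mathbb Z}\bigr)\le\theta$. (Whether $(0,0)$ is good depends only on $\xi,\zeta$ and the law of $F$.) **Proposition.** If $(0,0)$ is good, then $\mathbb P_{\xi,\zeta}((1,1)\text{ is good})\to1$ as $p\to1$, uniformly in $\xi,\zeta$ and $F$. That is: for every $\delta>0$ there is $p_0<1$ such that for every $p\in(p_0,1)$, every law of $F$ as above with $\varepsilon>0$, every choice of $(a^*,b^*,c^*)$, and all $\xi,\zeta\in\{0,1\}^{\mathbb Z}$ for which $(0,0)$ is good, $$\mathbb P_{\xi,\zeta}\bigl((1,1)\text{ is good}\bigr)\ge 1-\delta .$$ -/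

import Mathlib

open MeasureTheory ProbabilityTheory Filter Topology

noncomputable section

namespace FlipPreserve

/-- The state `{0,1}` of a cell, with addition modulo 2. -/
abbrev Cell : Type := ZMod 2

/-- Configurations, the elements of `{0,1}^ℤ`. -/
abbrev Config : Type := ℤ → Cell

/-- Maps `{0,1}³ → {0,1}`. -/
abbrev LocalRule : Type := Cell → Cell → Cell → Cell

section Dynamics

variable {Ω : Type*} [MeasurableSpace Ω]

/-- `(F x t)` is an i.i.d. family of local update functions: `F(a,b,c)` equals `a + c` (mod 2)
with probability `p`, and the other value with probability `1 - p`. The joint law of the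
eight values of `F` is otherwise arbitrary. -/
structure IsBasicCoupling (P : Measure Ω) (p : ℝ) (F : ℤ → ℕ → Ω → LocalRule) : Prop where
  measurable : ∀ x t, Measurable (F x t)
  indep : iIndepFun (fun i : ℤ × ℕ => F i.1 i.2) P
  identDistrib : ∀ x t, IdentDistrib (F x t) (F 0 0) P P
  law : ∀ x t a b c,
    P.real {ω | F x t ω a b c = a + c} = p ∧ P.real {ω | F x t ω a b c = 1 - (a + c)} = 1 - p

/-- `X_t^ξ`. -/
def X (F : ℤ → ℕ → Ω → LocalRule) (ξ : Config) : ℕ → Ω → Config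
  | 0, _ => ξ
  | t + 1, ω => fun x => F x t ω (X F ξ t ω (x - 1)) (X F ξ t ω x) (X F ξ t ω (x + 1))

/-- The flip/preserve process `Y_t^{ξ,ζ} = X_t^{ξ+ζ} - X_t^ξ` (mod 2). -/
def Y (F : ℤ → ℕ → Ω → LocalRule) (ξ ζ : Config) (t : ℕ) (ω : Ω) : Config :=
  fun x => X F (ξ + ζ) t ω x - X F ξ t ω x

/-- `q[(a,b,c),(u,v,w)] = P[F(a+u,b+v,c+w) = F(a,b,c)]`. -/
def q (P : Measure Ω) (F : ℤ → ℕ → Ω → LocalRule) (s d : Cell × Cell × Cell) : ℝ :=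
  P.real {ω | F 0 0 ω (s.1 + d.1) (s.2.1 + d.2.1) (s.2.2 + d.2.2) = F 0 0 ω s.1 s.2.1 s.2.2}

/-- `max (q[s,(0,0,1)], q[s,(1,0,0)])`. -/
def qMax (P : Measure Ω) (F : ℤ → ℕ → Ω → LocalRule) (s : Cell × Cell × Cell) : ℝ :=
  max (q P F s (0, 0, 1)) (q P F s (1, 0, 0))

/-- `ε`, the maximum over the eight triples `s` of `qMax s`. -/
def eps (P : Measure Ω) (F : ℤ → ℕ → Ω → LocalRule) : ℝ :=
  Finset.univ.sup' Finset.univ_nonempty (qMax P F)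

end Dynamics

section Parameters

/-- `K = 10 ⌈ε^{-3/2}⌉`. -/
def K (ε : ℝ) : ℕ := 10 * ⌈ε ^ (-(3 / 2) : ℝ)⌉₊

/-- `T = 4 K`. -/
def T (ε : ℝ) : ℕ := 4 * K ε

/-- `ℓ_0 = 3 K / 10`. -/
def ell0 (ε : ℝ) : ℝ := 3 * (K ε : ℝ) / 10

/-- `ℓ_n = ⌈ℓ_0 log(1/ε)^{-2n}⌉`. -/
def ell (ε : ℝ) (n : ℕ) : ℕ := ⌈ell0 ε * Real.log (1 / ε) ^ (-(2 * (n : ℤ)))⌉₊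

/-- `θ = exp(-ε^{-1/3})`. -/
def theta (ε : ℝ) : ℝ := Real.exp (-(ε ^ (-(1 / 3) : ℝ)))

/-- `I = ⟦-K, K⟧`. -/
def I (ε : ℝ) : Set ℤ := Set.Icc (-(K ε : ℤ)) (K ε)

/-- `J_+ = ⟦6K/5, 9K/5⟧` (the divisions are exact, since `10 ∣ K`). -/
def Jplus (ε : ℝ) : Set ℤ := Set.Icc (6 * (K ε : ℤ) / 5) (9 * (K ε : ℤ) / 5)

/-- `J_- = ⟦-9K/5, -6K/5⟧`. -/
def Jminus (ε : ℝ) : Set ℤ := Set.Icc (-(9 * (K ε : ℤ) / 5)) (-(6 * (K ε : ℤ) / 5))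

/-- `J = J_- ∪ J_+`. -/
def J (ε : ℝ) : Set ℤ := Jminus ε ∪ Jplus ε

end Parameters

section Patterns

/-- All the translates of the `m`-periodic sequence with period `a`. -/
def periodicOrbit (m : ℕ) (a : ZMod m → Cell) : Set Config :=
  {σ | ∃ l : ZMod m, ∀ x : ℤ, σ x = a ((x : ZMod m) + l)}

/-- The sequence constantly equal to 1, as a one-element set. -/
def orbit1 : Set Config := periodicOrbit 1 (![1] : Fin 1 → Cell)

/-- The two translates of the periodic sequence `…0101…`. -/
def orbit01 : Set Config := periodicOrbit 2 (![0, 1] : Fin 2 → Cell)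

/-- The four translates of the periodic sequence `…01110111…`. -/
def orbit0111 : Set Config := periodicOrbit 4 (![0, 1, 1, 1] : Fin 4 → Cell)

/-- `s` restricted to `A` coincides with an element of `S` on an interval of size at least `ℓ`
contained in `A`. -/
def Coincides (s : Config) (A : Set ℤ) (S : Set Config) (ℓ : ℕ) : Prop :=
  ∃ g h : ℤ, g ≤ h ∧ Set.Icc g h ⊆ A ∧ (ℓ : ℤ) ≤ h - g + 1 ∧
    ∃ σ ∈ S, ∀ x ∈ Set.Icc g h, s x = σ x

/-- The restriction of `s` to `A` belongs to the set `𝒢` of sequences with a long stretch of a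
dangerous periodic pattern. -/
def Dangerous (ε : ℝ) (s : Config) (A : Set ℤ) : Prop :=
  Coincides s A (orbit1 ∪ orbit01) (ell ε 1) ∨ Coincides s A orbit0111 (ell ε 2)

/-- `(s_x)` for `x ∈ ⟦g,h⟧` is nice: for every residue class `i + 8ℤ`, the proportion of the sites
`x ∈ ⟦g,h-2⟧ ∩ (i + 8ℤ)` with `(s_x, s_{x+1}, s_{x+2}) = abc` is at least `1/9`. -/
def IsNice (abc : Cell × Cell × Cell) (s : Config) (g h : ℤ) : Prop :=
  ∀ i ∈ Finset.Icc (1 : ℤ) 8,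
    (1 / 9 : ℝ) ≤
      (((Finset.Icc g (h - 2)).filter
        (fun x => x ≡ i [ZMOD 8] ∧ (s x, s (x + 1), s (x + 2)) = abc)).card : ℝ) /
      (((Finset.Icc g (h - 2)).filter (fun x => x ≡ i [ZMOD 8])).card : ℝ)

/-- `s` restricted to `A` is `ℓ`-nice: it is nice on each interval of size at least `ℓ` contained
in `A` (used for `ℓ ≥ 10`). -/
def IsEllNice (abc : Cell × Cell × Cell) (ℓ : ℕ) (s : Config) (A : Set ℤ) : Prop :=
  ∀ g h : ℤ, g ≤ h → Set.Icc g h ⊆ A → (ℓ : ℤ) ≤ h - g + 1 → IsNice abc s g h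

end Patterns

section Good

variable {Ω : Type*} [MeasurableSpace Ω]

/-- `Q_ℓ(ξ)`, the probability that `X_t^ξ(J)` fails to be `ℓ`-nice for some `0 ≤ t ≤ K - 1`. -/
def Q (P : Measure Ω) (F : ℤ → ℕ → Ω → LocalRule) (abc : Cell × Cell × Cell) (ℓ : ℕ)
    (ξ : Config) : ℝ :=
  P.real {ω | ∃ t < K (eps P F), ¬ IsEllNice abc ℓ (X F ξ t ω) (J (eps P F))}

/-- The configuration `x ↦ η (a + x)`. -/
def translate (a : ℤ) (η : Config) : Config := fun x => η (a + x)

/-- The block `(z,k)` is good. Reading `Y_{kT}` on `zK + A` amounts to reading its translate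
by `zK` on `A`. -/
structure IsGood (P : Measure Ω) (F : ℤ → ℕ → Ω → LocalRule) (abc : Cell × Cell × Cell)
    (ξ ζ : Config) (z : ℤ) (k : ℕ) (ω : Ω) : Prop where
  nonzero : ∃ x ∈ I (eps P F),
    translate (z * K (eps P F)) (Y F ξ ζ (k * T (eps P F)) ω) x ≠ 0
  not_dangerous_left : ¬ Dangerous (eps P F)
    (translate (z * K (eps P F)) (Y F ξ ζ (k * T (eps P F)) ω)) (Jminus (eps P F))
  not_dangerous_right : ¬ Dangerous (eps P F)
    (translate (z * K (eps P F)) (Y F ξ ζ (k * T (eps P F)) ω)) (Jplus (eps P F))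
  nice_environment : Q P F abc (ell (eps P F) 3)
    (translate (z * K (eps P F)) (X F ξ (k * T (eps P F)) ω)) ≤ theta (eps P F)

end Good

end FlipPreserve

end

/-! The block (1,1) can fail to be good because the environment X is not nice, because Y is
dangerous, or because Y vanishes on the shifted copy of I. Each cause has probability at most a
constant times ε^{1/24} once ε is small, and ε ≤ 2(1-p) (`IsBasicCoupling.eps_le`) makes ε small
uniformly as p → 1.

Environment. X is an additive automaton with noise, so characters are mapped to characters and the
expectation of a character is an explicit power of 2p-1 times a sign
(`IsBasicCoupling.integral_chi`). After about ε^{-9/8} steps, characters of well separated sites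
decay geometrically in the number of sites, whatever the initial state. A Chernoff bound then gives
every pattern of length three a frequency of at least 1/9 along each class modulo 8
(`NearUniform.measureReal_not_isEllNice_le`). The same decay for the restarted process and Markov's
inequality give condition (iii) (`IsBasicCoupling.measureReal_Q_gt_le`).

Danger. To produce a given word on a long interval, Y must either deviate from the additive rule in
each of about log(1/ε) blocks, or follow it on a whole block. In the second case the previous state
is an additive preimage of the word. Preimages of 1 and of 0111 contain d along a class modulo 8,
where d is the triple 001 or 100 attaining ε at (a*,b*,c*). Preimages of 01 contain d or are
themselves 0111. In a nice environment, many occurrences of d meet (a*,b*,c*), and each then yields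
1 only with probability 1-ε, so following the rule everywhere is unlikely
(`IsBasicCoupling.measureReal_word_le`). The hierarchy ℓ_3 ≪ ℓ_2 ≪ ℓ_1 lets each scale use the
previous one.

Non-vanishing. Suppose Y_T = 0 on K+I and go backwards in time. If Y is zero on J_+ at time t+1,
some block of J_+ was noiseless, so Y_t was 2-periodic there, hence zero, since it is not dangerous
(`eq_zero_of_periodic`). Around an empty block, the nearest occupied sites move inwards at speed
one, except with probability ε. So the empty interval grows by one on each side per step backwards
(`track`), unless a front fails. There are about ε^{-1/2} log(1/ε) failures, each costing
O(ε^{-3/4}) sites unless a loss occurs, which is far less than K. Hence Y_0 = 0 on I, contradicting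
condition (i).

Losses are controlled in `IsBasicCoupling.sum_loss_le`. Changing the outcome at a single site turns
a loss into the birth of an isolated 1, which is at least 1/(2ε) times more likely. An isolated 1
survives for d₀ steps with conditional probability at least 1/2, and while it survives it forbids
other births. So births are rare in time, and losses are rarer by a factor of order ε. -/

namespace FlipPreserve

set_option linter.unusedSectionVars false

/-! ### Averaging over the update functions of one time step. -/

section Independence

variable {Ω : Type*} [MeasurableSpace Ω]

/-- The σ-algebra generated by the local update functions with indices in `S`. -/
@[reducible] def gen (F : ℤ → ℕ → Ω → LocalRule) (S : Set (ℤ × ℕ)) : MeasurableSpace Ω :=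
  ⨆ i ∈ S, MeasurableSpace.comap (F i.1 i.2) inferInstance

/-- The σ-algebra generated by the local update functions before time `t`. -/
@[reducible] def past (F : ℤ → ℕ → Ω → LocalRule) (t : ℕ) : MeasurableSpace Ω := gen F {i | i.2 < t}

lemma gen_mono (F : ℤ → ℕ → Ω → LocalRule) {S S' : Set (ℤ × ℕ)} (h : S ⊆ S') :
    gen F S ≤ gen F S' := biSup_mono h

lemma past_mono (F : ℤ → ℕ → Ω → LocalRule) {t t' : ℕ} (h : t ≤ t') : past F t ≤ past F t' :=
  gen_mono F fun _ hi => lt_of_lt_of_le hi h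

lemma measurable_gen (F : ℤ → ℕ → Ω → LocalRule) {S : Set (ℤ × ℕ)} {x : ℤ} {t : ℕ}
    (h : (x, t) ∈ S) : Measurable[gen F S] (F x t) := by
  rw [measurable_iff_comap_le]
  exact le_biSup (fun i : ℤ × ℕ => MeasurableSpace.comap (F i.1 i.2) inferInstance) h

variable {P : Measure Ω} {p : ℝ} {F : ℤ → ℕ → Ω → LocalRule}

lemma IsBasicCoupling.gen_le (hF : IsBasicCoupling P p F) (S : Set (ℤ × ℕ)) :
    gen F S ≤ ‹MeasurableSpace Ω› :=
  iSup₂_le fun i _ => (measurable_iff_comap_le).1 (hF.measurable i.1 i.2)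

lemma IsBasicCoupling.indep_gen (hF : IsBasicCoupling P p F) {S : Set (ℤ × ℕ)} {x : ℤ} {t : ℕ}
    (h : (x, t) ∉ S) :
    Indep (gen F S) (MeasurableSpace.comap (F x t) inferInstance) P := by
  have h1 := indep_iSup_of_disjoint (S := S) (T := {(x, t)})
    (fun i : ℤ × ℕ => (measurable_iff_comap_le).1 (hF.measurable i.1 i.2))
    ((iIndepFun_iff_iIndep _ _ _).1 hF.indep) (Set.disjoint_singleton_right.2 h)
  simpa [gen] using h1

lemma integrable_of_bounded_measurable [IsFiniteMeasure P] {f : Ω → ℝ} (hf : Measurable f) (C : ℝ)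
    (hC : ∀ ω, |f ω| ≤ C) : Integrable f P :=
  Integrable.of_bound hf.aestronglyMeasurable C (ae_of_all _ hC)

/-- Averaging over the local update function at a site independent of everything else. -/
lemma IsBasicCoupling.integral_mul_site [IsProbabilityMeasure P] (hF : IsBasicCoupling P p F)
    {S : Set (ℤ × ℕ)} {x : ℤ} {t : ℕ} (hx : (x, t) ∉ S) {ι : Type*} [Fintype ι]
    [MeasurableSpace ι] [DiscreteMeasurableSpace ι] {N : Ω → ι} (hN : Measurable[gen F S] N)
    (g : ι → LocalRule → ℝ) {Z : Ω → ℝ} (hZ : Measurable[gen F S] Z) {C : ℝ}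
    (hC : ∀ ω, |Z ω| ≤ C) :
    ∫ ω, Z ω * g (N ω) (F x t ω) ∂P = ∫ ω, Z ω * (∫ ω', g (N ω) (F 0 0 ω') ∂P) ∂P := by
  classical
  have hle := hF.gen_le S
  have hind : ∀ i : ι, Measurable[gen F S] fun ω => Z ω * (if N ω = i then (1 : ℝ) else 0) := by
    intro i
    refine Measurable.mul hZ ?_
    exact (Measurable.of_discrete (f := fun j : ι => if j = i then (1 : ℝ) else 0)).comp hN
  have hgm : ∀ i : ι, ∀ y u, Measurable fun ω => g i (F y u ω) := fun i y u =>
    (Measurable.of_discrete (f := g i)).comp (hF.measurable y u)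
  obtain ⟨D, hD⟩ : ∃ D : ℝ, ∀ i φ, |g i φ| ≤ D := by
    refine ⟨∑ q : ι × LocalRule, |g q.1 q.2|, fun i φ => ?_⟩
    exact Finset.single_le_sum (f := fun q : ι × LocalRule => |g q.1 q.2|)
      (fun _ _ => abs_nonneg _) (Finset.mem_univ (i, φ))
  have hb : ∀ i ω, |Z ω * (if N ω = i then (1 : ℝ) else 0)| ≤ C := by
    intro i ω
    have := hC ω
    split_ifs
    · simpa using this
    · simpa using (abs_nonneg _).trans this
  -- Splitting according to the finitely many values of `N` leaves products of a `gen F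
  -- S`-measurable factor and a function of `F x t` alone, to which independence applies.
  have e1 : ∀ ω, Z ω * g (N ω) (F x t ω) =
      ∑ i : ι, (Z ω * (if N ω = i then (1 : ℝ) else 0)) * g i (F x t ω) := by
    intro ω; simp
  have e2 : ∀ ω, Z ω * (∫ ω', g (N ω) (F 0 0 ω') ∂P) =
      ∑ i : ι, (Z ω * (if N ω = i then (1 : ℝ) else 0)) * (∫ ω', g i (F 0 0 ω') ∂P) := by
    intro ω; simp
  simp_rw [e1, e2]
  rw [integral_finsetSum, integral_finsetSum]
  · refine Finset.sum_congr rfl fun i _ => ?_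
    have hI : IndepFun (fun ω => Z ω * (if N ω = i then (1 : ℝ) else 0))
        (fun ω => g i (F x t ω)) P := by
      rw [IndepFun_iff_Indep]
      refine indep_of_indep_of_le_left (indep_of_indep_of_le_right (hF.indep_gen hx) ?_) ?_
      · have : Measurable[MeasurableSpace.comap (F x t) inferInstance] fun ω => g i (F x t ω) :=
          (Measurable.of_discrete (f := g i)).comp (comap_measurable _)
        exact this.comap_le
      · exact (hind i).comap_le
    rw [hI.integral_fun_mul_eq_mul_integral ((hind i).mono hle le_rfl).aestronglyMeasurable
      (hgm i x t).aestronglyMeasurable, integral_mul_const]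
    congr 1
    exact ((hF.identDistrib x t).comp (Measurable.of_discrete (f := g i))).integral_eq
  · intro i _
    exact (integrable_of_bounded_measurable ((hind i).mono hle le_rfl) C (hb i)).mul_const _
  · intro i _
    refine integrable_of_bounded_measurable (((hind i).mono hle le_rfl).mul (hgm i x t)) (C * D) ?_
    intro ω
    rw [abs_mul]
    exact mul_le_mul (hb i ω) (hD _ _) (abs_nonneg _) ((abs_nonneg _).trans (hb i ω))

/-- Averaging over the local update functions at finitely many sites at time `t`. -/
lemma IsBasicCoupling.integral_mul_prod [IsProbabilityMeasure P] (hF : IsBasicCoupling P p F)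
    {t : ℕ} {ι : Type*} [Fintype ι] [MeasurableSpace ι] [DiscreteMeasurableSpace ι]
    {N : ℤ → Ω → ι} (hN : ∀ x, Measurable[past F t] (N x)) (g : ℤ → ι → LocalRule → ℝ)
    (S : Finset ℤ) : ∀ {Z : Ω → ℝ} {C : ℝ}, Measurable[past F t] Z → (∀ ω, |Z ω| ≤ C) →
    ∫ ω, Z ω * ∏ x ∈ S, g x (N x ω) (F x t ω) ∂P =
      ∫ ω, Z ω * ∏ x ∈ S, (∫ ω', g x (N x ω) (F 0 0 ω') ∂P) ∂P := by
  classical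
  obtain ⟨D, hD⟩ : ∃ D : ℤ → ℝ, ∀ x i φ, |g x i φ| ≤ D x := by
    refine ⟨fun x => ∑ q : ι × LocalRule, |g x q.1 q.2|, fun x i φ => ?_⟩
    exact Finset.single_le_sum (f := fun q : ι × LocalRule => |g x q.1 q.2|)
      (fun _ _ => abs_nonneg _) (Finset.mem_univ (i, φ))
  induction S using Finset.induction_on with
  | empty => intro Z C _ _; simp
  | insert x S hx ih =>
    intro Z C hZ hC
    -- When the site `x` is averaged out, the rest of the integrand depends on the past and on the
    -- other update functions of time `t`.
    set S' : Set (ℤ × ℕ) := {i | i.2 < t} ∪ {i | i.2 = t ∧ i.1 ∈ S} with hS'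
    have hpS : past F t ≤ gen F S' := gen_mono F Set.subset_union_left
    have hx' : (x, t) ∉ S' := by simp [hS', hx]
    have hZ' : Measurable[gen F S'] fun ω => Z ω * ∏ y ∈ S, g y (N y ω) (F y t ω) := by
      refine Measurable.mul (hZ.mono hpS le_rfl) ?_
      refine Finset.measurable_fun_prod S fun y hy => ?_
      have h1 : Measurable[gen F S'] fun ω => (N y ω, F y t ω) :=
        Measurable.prodMk ((hN y).mono hpS le_rfl) (measurable_gen F (by simp [hS', hy]))
      exact (Measurable.of_discrete (f := fun q : ι × LocalRule => g y q.1 q.2)).comp h1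
    have hC' : ∀ ω, |Z ω * ∏ y ∈ S, g y (N y ω) (F y t ω)| ≤ C * ∏ y ∈ S, D y := by
      intro ω
      rw [abs_mul, Finset.abs_prod]
      exact mul_le_mul (hC ω) (Finset.prod_le_prod (fun _ _ => abs_nonneg _) fun y _ => hD _ _ _)
        (Finset.prod_nonneg fun _ _ => abs_nonneg _) ((abs_nonneg _).trans (hC ω))
    have h1 := hF.integral_mul_site hx' ((hN x).mono hpS le_rfl) (g x) hZ' hC'
    have hm : Measurable[past F t] fun ω => Z ω * (∫ ω', g x (N x ω) (F 0 0 ω') ∂P) :=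
      Measurable.mul hZ ((Measurable.of_discrete
        (f := fun i : ι => ∫ ω', g x i (F 0 0 ω') ∂P)).comp (hN x))
    have h2 := ih (Z := fun ω => Z ω * (∫ ω', g x (N x ω) (F 0 0 ω') ∂P)) (C := C * D x) hm (by
      intro ω
      rw [abs_mul]
      refine mul_le_mul (hC ω) ?_ (abs_nonneg _) ((abs_nonneg _).trans (hC ω))
      refine (abs_integral_le_integral_abs).trans ?_
      calc ∫ ω', |g x (N x ω) (F 0 0 ω')| ∂P ≤ ∫ _, D x ∂P := by
            refine integral_mono_of_nonneg (ae_of_all _ fun _ => abs_nonneg _)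
              (integrable_const _) (ae_of_all _ fun _ => hD _ _ _)
        _ = D x := by simp)
    simp_rw [Finset.prod_insert hx]
    calc _ = ∫ ω, (Z ω * ∏ y ∈ S, g y (N y ω) (F y t ω)) * g x (N x ω) (F x t ω) ∂P := by
            congr 1; ext ω; ring
      _ = ∫ ω, (Z ω * (∫ ω', g x (N x ω) (F 0 0 ω') ∂P)) *
            ∏ y ∈ S, g y (N y ω) (F y t ω) ∂P := by
            rw [h1]; congr 1; ext ω; ring
      _ = _ := by rw [h2]; congr 1; ext ω; ring

end Independence

/-! ### One step of the flip/preserve process, conditionally on the past. -/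

section OneStep

variable {Ω : Type*} [MeasurableSpace Ω]

abbrev Triple : Type := Cell × Cell × Cell

/-- The states of `x - 1`, `x`, `x + 1`. -/
def nb (s : Config) (x : ℤ) : Triple := (s (x - 1), s x, s (x + 1))

/-- The difference made by the perturbation `n.2` of the input `n.1`. -/
def out (n : Triple × Triple) (φ : LocalRule) : Cell :=
  φ (n.1.1 + n.2.1) (n.1.2.1 + n.2.2.1) (n.1.2.2 + n.2.2.2) - φ n.1.1 n.1.2.1 n.1.2.2

/-- The law of `out`. -/
def outProb (P : Measure Ω) (F : ℤ → ℕ → Ω → LocalRule) (n : Triple × Triple) (v : Cell) : ℝ :=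
  P.real {ω | out n (F 0 0 ω) = v}

/-- The local states of the environment and of the flip/preserve process at `x`. -/
def localState (F : ℤ → ℕ → Ω → LocalRule) (ξ ζ : Config) (t : ℕ) (x : ℤ) (ω : Ω) :
    Triple × Triple := (nb (X F ξ t ω) x, nb (Y F ξ ζ t ω) x)

variable {P : Measure Ω} {p : ℝ} {F : ℤ → ℕ → Ω → LocalRule}

lemma X_succ (F : ℤ → ℕ → Ω → LocalRule) (ξ : Config) (t : ℕ) (ω : Ω) (x : ℤ) :
    X F ξ (t + 1) ω x =
      F x t ω (X F ξ t ω (x - 1)) (X F ξ t ω x) (X F ξ t ω (x + 1)) := rfl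

lemma Y_succ (F : ℤ → ℕ → Ω → LocalRule) (ξ ζ : Config) (t : ℕ) (ω : Ω) (x : ℤ) :
    Y F ξ ζ (t + 1) ω x = out (localState F ξ ζ t x ω) (F x t ω) := by
  simp [Y, X_succ, out, localState, nb]

lemma measurable_X (F : ℤ → ℕ → Ω → LocalRule) (ξ : Config) (t : ℕ) :
    ∀ x, Measurable[past F t] fun ω => X F ξ t ω x := by
  induction t with
  | zero => intro x; simp [X]
  | succ t ih =>
    intro x
    have hp : past F t ≤ past F (t + 1) := past_mono F t.le_succ
    have h1 : Measurable[past F (t + 1)] fun ω =>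
        (F x t ω, X F ξ t ω (x - 1), X F ξ t ω x, X F ξ t ω (x + 1)) :=
      Measurable.prodMk (measurable_gen F (by simp)) (Measurable.prodMk
        ((ih _).mono hp le_rfl) (Measurable.prodMk ((ih _).mono hp le_rfl)
          ((ih _).mono hp le_rfl)))
    exact (Measurable.of_discrete
      (f := fun z : LocalRule × Cell × Cell × Cell => z.1 z.2.1 z.2.2.1 z.2.2.2)).comp h1

lemma measurable_Y (F : ℤ → ℕ → Ω → LocalRule) (ξ ζ : Config) (t : ℕ) (x : ℤ) :
    Measurable[past F t] fun ω => Y F ξ ζ t ω x :=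
  (Measurable.of_discrete (f := fun z : Cell × Cell => z.1 - z.2)).comp
    (Measurable.prodMk (measurable_X F (ξ + ζ) t x) (measurable_X F ξ t x))

lemma measurable_localState (F : ℤ → ℕ → Ω → LocalRule) (ξ ζ : Config) (t : ℕ) (x : ℤ) :
    Measurable[past F t] (localState F ξ ζ t x) :=
  Measurable.prodMk
    (Measurable.prodMk (measurable_X F ξ t _) (Measurable.prodMk (measurable_X F ξ t _)
      (measurable_X F ξ t _)))
    (Measurable.prodMk (measurable_Y F ξ ζ t _) (Measurable.prodMk (measurable_Y F ξ ζ t _)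
      (measurable_Y F ξ ζ t _)))

/-- `Y_t` agrees with `τ` on `S`. -/
def Agrees (F : ℤ → ℕ → Ω → LocalRule) (ξ ζ : Config) (t : ℕ) (S : Finset ℤ) (τ : Config) :
    Set Ω := {ω | ∀ x ∈ S, Y F ξ ζ t ω x = τ x}

lemma measurableSet_agrees (F : ℤ → ℕ → Ω → LocalRule) (ξ ζ : Config) (t : ℕ) (S : Finset ℤ)
    (τ : Config) : MeasurableSet[past F t] (Agrees F ξ ζ t S τ) := by
  have : Agrees F ξ ζ t S τ = ⋂ x ∈ S, {ω | Y F ξ ζ t ω x = τ x} := by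
    ext ω; simp [Agrees]
  rw [this]
  exact MeasurableSet.biInter S.countable_toSet fun x _ =>
    measurable_Y F ξ ζ t x (measurableSet_singleton (τ x))

variable [IsProbabilityMeasure P] (hF : IsBasicCoupling P p F) (ξ ζ : Config)

include hF

/-- Given the past, distinct sites are updated independently, so conditional probabilities of
outcomes factorize. All estimates on Y rest on this formula. -/
lemma IsBasicCoupling.measureReal_inter_agrees {t : ℕ} {H : Set Ω} (hH : MeasurableSet[past F t] H)
    (S : Finset ℤ) (τ : Config) :
    P.real (H ∩ Agrees F ξ ζ (t + 1) S τ) =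
      ∫ ω, H.indicator 1 ω * ∏ x ∈ S, outProb P F (localState F ξ ζ t x ω) (τ x) ∂P := by
  classical
  have hH' : MeasurableSet H := hF.gen_le _ _ hH
  have hA : MeasurableSet (Agrees F ξ ζ (t + 1) S τ) :=
    hF.gen_le _ _ (measurableSet_agrees F ξ ζ (t + 1) S τ)
  have h := hF.integral_mul_prod (measurable_localState F ξ ζ t)
    (fun x n φ => if out n φ = τ x then (1 : ℝ) else 0) S
    (Z := H.indicator 1) (C := 1) (Measurable.indicator (m := past F t) measurable_const hH) (by
      intro ω; by_cases hω : ω ∈ H <;> simp [hω])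
  have e : ∀ n x, ∫ ω', (if out n (F 0 0 ω') = τ x then (1 : ℝ) else 0) ∂P
      = outProb P F n (τ x) := by
    intro n x
    have hm : MeasurableSet {ω | out n (F 0 0 ω) = τ x} :=
      (Measurable.of_discrete (f := out n)).comp (hF.measurable 0 0)
        (measurableSet_singleton (τ x))
    rw [outProb, ← integral_indicator_one hm]
    congr 1
    ext ω'
    simp [Set.indicator]
  simp_rw [e] at h
  rw [← h, ← integral_indicator_one (hH'.inter hA)]
  congr 1
  ext ω
  rw [Finset.prod_ite_zero]
  by_cases h1 : ω ∈ H
  · simp [h1, Set.indicator, Agrees, Y_succ]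
  · simp [h1]

lemma IsBasicCoupling.outProb_nonneg (n : Triple × Triple) (v : Cell) : 0 ≤ outProb P F n v :=
  measureReal_nonneg

lemma IsBasicCoupling.outProb_le_one (n : Triple × Triple) (v : Cell) : outProb P F n v ≤ 1 :=
  measureReal_le_one

lemma IsBasicCoupling.outProb_add (n : Triple × Triple) :
    outProb P F n 0 + outProb P F n 1 = 1 := by
  have hm : MeasurableSet {ω | out n (F 0 0 ω) = 0} :=
    (Measurable.of_discrete (f := out n)).comp (hF.measurable 0 0)
      (measurableSet_singleton (0 : Cell))
  have : {ω | out n (F 0 0 ω) = 1} = {ω | out n (F 0 0 ω) = 0}ᶜ := by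
    ext ω
    have : ∀ c : Cell, c = 1 ↔ ¬ c = 0 := by decide
    exact this _
  rw [outProb, outProb, this, measureReal_compl hm]
  simp

/-- Comparison of two possible outcomes of one step of the flip/preserve process. -/
lemma IsBasicCoupling.step_le {t : ℕ} {H : Set Ω} (hH : MeasurableSet[past F t] H) {c : ℝ}
    {S S' : Finset ℤ} {τ τ' : Config}
    (h : ∀ ω ∈ H, ∏ x ∈ S, outProb P F (localState F ξ ζ t x ω) (τ x) ≤
      c * ∏ x ∈ S', outProb P F (localState F ξ ζ t x ω) (τ' x)) :
    P.real (H ∩ Agrees F ξ ζ (t + 1) S τ) ≤ c * P.real (H ∩ Agrees F ξ ζ (t + 1) S' τ') := by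
  rw [hF.measureReal_inter_agrees ξ ζ hH, hF.measureReal_inter_agrees ξ ζ hH,
    ← integral_const_mul]
  have hm : ∀ (S : Finset ℤ) (τ : Config), Integrable (fun ω =>
      H.indicator 1 ω * ∏ x ∈ S, outProb P F (localState F ξ ζ t x ω) (τ x)) P := by
    intro S τ
    refine integrable_of_bounded_measurable (Measurable.mul
      (measurable_one.indicator (hF.gen_le _ _ hH)) (Finset.measurable_fun_prod S fun x _ => ?_))
      1 ?_
    · exact (Measurable.of_discrete (f := fun n => outProb P F n (τ x))).comp
        ((measurable_localState F ξ ζ t x).mono (hF.gen_le _) le_rfl)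
    · intro ω
      rw [abs_mul, Finset.abs_prod]
      refine mul_le_one₀ (by by_cases hω : ω ∈ H <;> simp [hω])
        (Finset.prod_nonneg fun _ _ => abs_nonneg _) (Finset.prod_le_one (fun _ _ => abs_nonneg _)
          fun x _ => ?_)
      rw [abs_of_nonneg (hF.outProb_nonneg _ _)]
      exact hF.outProb_le_one _ _
  refine integral_mono (hm S τ) ((hm S' τ').const_mul c) fun ω => ?_
  by_cases hω : ω ∈ H
  · simpa [hω] using h ω hω
  · simp [hω]

/-- The smallness of the conditional probability is itself an event of the past, and the comparison
is with the sure event (`S' = ∅`). This turns pointwise bounds on products into probability bounds.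
-/
lemma IsBasicCoupling.step_le_of_prod_le {t : ℕ} {c : ℝ} (hc : 0 ≤ c) (S : Finset ℤ) (τ : Config) :
    P.real {ω | ∏ x ∈ S, outProb P F (localState F ξ ζ t x ω) (τ x) ≤ c ∧
      ∀ x ∈ S, Y F ξ ζ (t + 1) ω x = τ x} ≤ c := by
  set H : Set Ω := {ω | ∏ x ∈ S, outProb P F (localState F ξ ζ t x ω) (τ x) ≤ c} with hHd
  have hH : MeasurableSet[past F t] H := by
    have : Measurable[past F t] fun ω =>
        ∏ x ∈ S, outProb P F (localState F ξ ζ t x ω) (τ x) :=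
      Finset.measurable_fun_prod S fun x _ =>
        (Measurable.of_discrete (f := fun n => outProb P F n (τ x))).comp
          (measurable_localState F ξ ζ t x)
    exact this measurableSet_Iic
  have h := hF.step_le ξ ζ hH (S := S) (S' := ∅) (τ := τ) (τ' := τ) (c := c)
    (fun ω hω => by simpa using (show _ ≤ c from hω))
  refine le_trans (le_of_eq rfl) (h.trans ?_)
  exact mul_le_of_le_one_right hc measureReal_le_one

lemma IsBasicCoupling.step_site_le {t : ℕ} {H : Set Ω} (hH : MeasurableSet[past F t] H) {c : ℝ}
    {x : ℤ} {v : Cell} (h : ∀ ω ∈ H, outProb P F (localState F ξ ζ t x ω) v ≤ c) :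
    P.real (H ∩ {ω | Y F ξ ζ (t + 1) ω x = v}) ≤ c * P.real H := by
  have := hF.step_le ξ ζ hH (S := {x}) (S' := ∅) (τ := fun _ => v) (τ' := fun _ => v) (c := c)
    (fun ω hω => by simpa using h ω hω)
  simpa [Agrees] using this

omit hF in
lemma q_le_eps (s : Triple) (d : Triple) (hd : d = (0, 0, 1) ∨ d = (1, 0, 0)) :
    q P F s d ≤ eps P F := by
  have h1 : qMax P F s ≤ eps P F := Finset.le_sup' (qMax P F) (Finset.mem_univ s)
  rcases hd with rfl | rfl
  · exact (le_max_left _ _).trans h1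
  · exact (le_max_right _ _).trans h1

omit hF in
lemma outProb_zero_eq_q (s d : Triple) : outProb P F (s, d) 0 = q P F s d := by
  simp [outProb, q, out, sub_eq_zero]

-- A front sees the perturbation 001 or 100, so this is the probability that it stops.
omit hF in
lemma outProb_zero_le_eps {n : Triple × Triple} (hd : n.2 = (0, 0, 1) ∨ n.2 = (1, 0, 0)) :
    outProb P F n 0 ≤ eps P F := by
  obtain ⟨s, d⟩ := n
  rw [outProb_zero_eq_q]
  exact q_le_eps s d hd

lemma IsBasicCoupling.law_compl (a b c : Cell) :
    P.real {ω | F 0 0 ω a b c ≠ a + c} = 1 - p := by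
  have hm : MeasurableSet {ω | F 0 0 ω a b c = a + c} :=
    (Measurable.of_discrete (f := fun φ : LocalRule => φ a b c)).comp (hF.measurable 0 0)
      (measurableSet_singleton (a + c))
  have : {ω | F 0 0 ω a b c ≠ a + c} = {ω | F 0 0 ω a b c = a + c}ᶜ := rfl
  rw [this, measureReal_compl hm, (hF.law 0 0 a b c).1]
  simp

/-- The flip/preserve process deviates from the additive rule with probability at most
`2 (1 - p)`. -/
lemma IsBasicCoupling.outProb_le_of_ne {n : Triple × Triple} {v : Cell}
    (h : v ≠ n.2.1 + n.2.2.2) : outProb P F n v ≤ 2 * (1 - p) := by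
  obtain ⟨⟨a, b, c⟩, ⟨u, w, x⟩⟩ := n
  have : {ω | out ((a, b, c), (u, w, x)) (F 0 0 ω) = v} ⊆
      {ω | F 0 0 ω (a + u) (b + w) (c + x) ≠ (a + u) + (c + x)} ∪
        {ω | F 0 0 ω a b c ≠ a + c} := by
    intro ω hω
    by_contra hcon
    simp only [Set.mem_union, Set.mem_ofPred_eq, not_or, not_not] at hcon
    simp only [Set.mem_ofPred_eq, out] at hω
    rw [hcon.1, hcon.2] at hω
    apply h
    rw [← hω]; simp; ring
  calc outProb P F ((a, b, c), (u, w, x)) v ≤ _ := measureReal_mono this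
    _ ≤ _ := measureReal_union_le _ _
    _ = 2 * (1 - p) := by rw [hF.law_compl, hF.law_compl]; ring

/-- The additive outcome of 001 and 100 is 1, so an output 0 is a deviation from the additive rule.
This is used both to make ε small and to bound the mixing rate 2p-1 by 1-ε. -/
lemma IsBasicCoupling.eps_le : eps P F ≤ 2 * (1 - p) := by
  refine Finset.sup'_le _ _ fun s _ => max_le ?_ ?_
  · rw [← outProb_zero_eq_q]; exact hF.outProb_le_of_ne (by simp)
  · rw [← outProb_zero_eq_q]; exact hF.outProb_le_of_ne (by simp)

/-- The perturbation realizing the maximum in the definition of `eps`. -/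
lemma IsBasicCoupling.exists_direction {abc : Triple} (h : qMax P F abc = eps P F) :
    ∃ d : Triple, (d = (0, 0, 1) ∨ d = (1, 0, 0)) ∧ outProb P F (abc, d) 1 = 1 - eps P F := by
  have : ∃ d : Triple, (d = (0, 0, 1) ∨ d = (1, 0, 0)) ∧ q P F abc d = eps P F := by
    rcases max_choice (q P F abc (0, 0, 1)) (q P F abc (1, 0, 0)) with h1 | h1
    · exact ⟨_, Or.inl rfl, by rw [← h, ← h1]; rfl⟩
    · exact ⟨_, Or.inr rfl, by rw [← h, ← h1]; rfl⟩
  obtain ⟨d, hd, hq⟩ := this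
  refine ⟨d, hd, ?_⟩
  have := hF.outProb_add (abc, d)
  rw [outProb_zero_eq_q, hq] at this
  linarith

omit hF in
lemma Y_succ_eq_zero {t : ℕ} {ω : Ω} {x : ℤ} (h0 : Y F ξ ζ t ω (x - 1) = 0)
    (h1 : Y F ξ ζ t ω x = 0) (h2 : Y F ξ ζ t ω (x + 1) = 0) : Y F ξ ζ (t + 1) ω x = 0 := by
  simp [Y_succ, out, localState, nb, h0, h1, h2]

end OneStep

/-! ### Exact computation of the expectations of characters of the environment. -/

section Characters

/-- The character of `{0,1}`. -/
def sgn (c : Cell) : ℝ := if c = 0 then 1 else -1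

/-- The character of `{0,1}^ℤ` associated with a finite set of sites. -/
def chi (A : Finset ℤ) (s : Config) : ℝ := ∏ x ∈ A, sgn (s x)

lemma sgn_mul_self (c : Cell) : sgn c * sgn c = 1 := by
  unfold sgn; split_ifs <;> norm_num

lemma abs_sgn (c : Cell) : |sgn c| = 1 := by
  unfold sgn; split_ifs <;> norm_num

lemma sgn_add (a b : Cell) : sgn (a + b) = sgn a * sgn b := by
  have h : ∀ a b : Cell, (a + b = 0 ↔ (a = 0 ↔ b = 0)) := by decide
  unfold sgn
  by_cases ha : a = 0 <;> by_cases hb : b = 0 <;> simp [h, ha, hb]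

lemma abs_chi (A : Finset ℤ) (s : Config) : |chi A s| = 1 := by
  simp [chi, Finset.abs_prod, abs_sgn]

lemma prod_mul_prod_eq_prod_symmDiff {f : ℤ → ℝ} (hf : ∀ x, f x * f x = 1) (A B : Finset ℤ) :
    (∏ x ∈ A, f x) * ∏ x ∈ B, f x = ∏ x ∈ symmDiff A B, f x := by
  rw [← Finset.prod_inter_mul_prod_sdiff A B f, ← Finset.prod_inter_mul_prod_sdiff B A f,
    Finset.inter_comm B A, symmDiff, Finset.sup_eq_union,
    Finset.prod_union disjoint_sdiff_sdiff]
  have : (∏ x ∈ A ∩ B, f x) * ∏ x ∈ A ∩ B, f x = 1 := by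
    rw [← Finset.prod_mul_distrib]; simp [hf]
  linear_combination (∏ x ∈ A \ B, f x) * (∏ x ∈ B \ A, f x) * this

/-- The sites seen by a character after one step backwards. -/
def stepSet (A : Finset ℤ) : Finset ℤ := symmDiff (A.image (· - 1)) (A.image (· + 1))

/-- The number of update functions seen by a character during `t` steps backwards. -/
def weight : ℕ → Finset ℤ → ℕ
  | 0, _ => 0
  | t + 1, A => A.card + weight t (stepSet A)

/-- Sites reached from both sides cancel because signs square to 1, which is why `stepSet` is a
symmetric difference. -/
lemma chi_stepSet (A : Finset ℤ) (s : Config) :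
    ∏ x ∈ A, (sgn (s (x - 1)) * sgn (s (x + 1))) = chi (stepSet A) s := by
  rw [chi, stepSet, ← prod_mul_prod_eq_prod_symmDiff (fun x => sgn_mul_self (s x)),
    Finset.prod_mul_distrib, Finset.prod_image (fun _ _ _ _ h => by simpa using h),
    Finset.prod_image (fun _ _ _ _ h => by simpa using h)]

/-- Each site of `U ⊆ A` is the only site of `A` among the `w + 1` sites ending there. -/
def Isolated (A U : Finset ℤ) (w : ℤ) : Prop :=
  U ⊆ A ∧ ∀ u ∈ U, ∀ y ∈ A, u - w ≤ y → u ≤ y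

lemma Isolated.mono {A U : Finset ℤ} {w w' : ℤ} (h : Isolated A U w) (hw : w' ≤ w) :
    Isolated A U w' :=
  ⟨h.1, fun u hu y hy hle => h.2 u hu y hy (by linarith)⟩

/-- The copy `u - 1` could only be cancelled by a site `u - 2` of `A`, which isolation excludes. A
site on the left moves right while `u` moves left, so the window loses 2. -/
lemma Isolated.step {A U : Finset ℤ} {w : ℤ} (h : Isolated A U w) (hw : 2 ≤ w) :
    Isolated (stepSet A) (U.image (· - 1)) (w - 2) := by
  constructor
  · intro v hv
    obtain ⟨u, hu, rfl⟩ := Finset.mem_image.1 hv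
    rw [stepSet, Finset.mem_symmDiff]
    left
    refine ⟨Finset.mem_image_of_mem _ (h.1 hu), fun hc => ?_⟩
    obtain ⟨y, hy, hyu⟩ := Finset.mem_image.1 hc
    have := h.2 u hu y hy (by linarith)
    linarith
  · intro v hv y hy hle
    obtain ⟨u, hu, rfl⟩ := Finset.mem_image.1 hv
    rw [stepSet, Finset.mem_symmDiff] at hy
    rcases hy with ⟨hy, -⟩ | ⟨hy, -⟩
    · obtain ⟨z, hz, rfl⟩ := Finset.mem_image.1 hy
      have := h.2 u hu z hz (by linarith)
      linarith
    · obtain ⟨z, hz, rfl⟩ := Finset.mem_image.1 hy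
      have := h.2 u hu z hz (by linarith)
      linarith

lemma Isolated.iterate {A U : Finset ℤ} {w : ℤ} (h : Isolated A U w) (t : ℕ)
    (hw : 2 * (t : ℤ) ≤ w) :
    ∃ V : Finset ℤ, V.card = U.card ∧ Isolated (stepSet^[t] A) V (w - 2 * t) := by
  induction t generalizing A U w with
  | zero => exact ⟨U, rfl, by simpa using h⟩
  | succ t ih =>
    obtain ⟨V, hV, hV'⟩ := ih (h.step (by push_cast at hw; linarith))
      (by push_cast at hw; linarith)
    refine ⟨V, hV.trans (Finset.card_image_of_injective _ fun _ _ h => by simpa using h), ?_⟩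
    rw [Function.iterate_succ_apply]
    exact hV'.mono (by push_cast; linarith)

/-- A window of size `2 * s` keeps all the isolated sites alive during `s` steps, and each of them
sees a new update function at each step. -/
lemma Isolated.le_weight {A U : Finset ℤ} {s t : ℕ} (h : Isolated A U (2 * s)) (hst : s ≤ t) :
    s * U.card ≤ weight t A := by
  induction s generalizing A U t with
  | zero => simp
  | succ s ih =>
    obtain ⟨t, rfl⟩ : ∃ t', t = t' + 1 := ⟨t - 1, by omega⟩
    have h1 := h.step (by push_cast; linarith)
    have h2 := ih (h1.mono (by push_cast; linarith)) (t := t) (by omega)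
    rw [Finset.card_image_of_injective _ fun _ _ h => by simpa using h] at h2
    have h3 := Finset.card_le_card h.1
    rw [weight]
    linarith [Nat.succ_mul s U.card]

lemma Isolated.shift {A U : Finset ℤ} {w : ℤ} (h : Isolated A U w) (a : ℤ) :
    Isolated (A.image (a + ·)) (U.image (a + ·)) w := by
  refine ⟨Finset.image_subset_image h.1, fun v hv z hz hle => ?_⟩
  obtain ⟨u, hu, rfl⟩ := Finset.mem_image.1 hv
  obtain ⟨y, hy, rfl⟩ := Finset.mem_image.1 hz
  have := h.2 u hu y hy (by linarith)
  linarith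

lemma chi_translate (A : Finset ℤ) (a : ℤ) (s : Config) :
    chi A (translate a s) = chi (A.image (a + ·)) s := by
  rw [chi, chi, Finset.prod_image (fun _ _ _ _ h => by simpa using h)]
  rfl

lemma measurable_chi {Ω : Type*} [MeasurableSpace Ω] {Z : Ω → Config}
    (hZ : ∀ x, Measurable fun ω => Z ω x) (A : Finset ℤ) : Measurable fun ω => chi A (Z ω) :=
  Finset.measurable_fun_prod A fun x _ => (Measurable.of_discrete (f := sgn)).comp (hZ x)

variable {Ω : Type*} [MeasurableSpace Ω] {P : Measure Ω} {p : ℝ} {F : ℤ → ℕ → Ω → LocalRule}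
  [IsProbabilityMeasure P]

lemma IsBasicCoupling.integral_sgn (hF : IsBasicCoupling P p F) (a b c : Cell) :
    ∫ ω, sgn (F 0 0 ω a b c) ∂P = (2 * p - 1) * (sgn a * sgn c) := by
  have hm : MeasurableSet {ω | F 0 0 ω a b c ≠ a + c} :=
    (Measurable.of_discrete (f := fun φ : LocalRule => φ a b c)).comp (hF.measurable 0 0)
      (measurableSet_singleton (a + c)).compl
  have e : ∀ ω, sgn (F 0 0 ω a b c) =
      (sgn a * sgn c) - 2 * (sgn a * sgn c) * {ω | F 0 0 ω a b c ≠ a + c}.indicator 1 ω := by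
    intro ω
    rw [← sgn_add]
    by_cases h : F 0 0 ω a b c = a + c
    · simp [h]
    · have h2 : ∀ u v : Cell, u ≠ v → u = v + 1 := by decide
      have h3 : sgn (a + c + 1) = - sgn (a + c) := by
        rw [sgn_add (a + c) 1]; simp [sgn]
      simp only [Set.indicator, Set.mem_ofPred_eq, h2 _ _ h, h3]
      simp; ring
  simp_rw [e]
  have hi : Integrable ({ω | F 0 0 ω a b c ≠ a + c}.indicator (1 : Ω → ℝ)) P :=
    (integrable_const (1 : ℝ)).indicator hm
  rw [integral_sub (integrable_const _) (hi.const_mul _), integral_const, integral_const_mul,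
    integral_indicator_one hm, hF.law_compl]
  simp; ring

lemma IsBasicCoupling.integral_chi_succ (hF : IsBasicCoupling P p F) (η : Config) (t : ℕ)
    (A : Finset ℤ) : ∫ ω, chi A (X F η (t + 1) ω) ∂P =
      (2 * p - 1) ^ A.card * ∫ ω, chi (stepSet A) (X F η t ω) ∂P := by
  have hN : ∀ x, Measurable[past F t] fun ω => nb (X F η t ω) x := fun x =>
    Measurable.prodMk (measurable_X F η t _) (Measurable.prodMk (measurable_X F η t _)
      (measurable_X F η t _))
  have h := hF.integral_mul_prod hN (fun _ n φ => sgn (φ n.1 n.2.1 n.2.2)) A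
    (Z := fun _ => 1) (C := 1) measurable_const (by simp)
  simp_rw [hF.integral_sgn, Finset.prod_mul_distrib, Finset.prod_const, one_mul] at h
  rw [← integral_const_mul]
  simp_rw [← chi_stepSet, Finset.prod_mul_distrib]
  exact h

/-- Each update function is read at a single triple, so it contributes a factor p-(1-p) whatever the
joint law of its eight values. -/
lemma IsBasicCoupling.integral_chi (hF : IsBasicCoupling P p F) (η : Config) (t : ℕ)
    (A : Finset ℤ) : ∫ ω, chi A (X F η t ω) ∂P =
      (2 * p - 1) ^ weight t A * chi (stepSet^[t] A) η := by
  induction t generalizing A with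
  | zero => simp [X, weight]
  | succ t ih =>
    rw [hF.integral_chi_succ, ih, weight, Function.iterate_succ_apply, pow_add, mul_assoc]

lemma IsBasicCoupling.abs_integral_chi_le (hF : IsBasicCoupling P p F) (hp : 1 / 2 ≤ p)
    (hp1 : p ≤ 1) (η : Config) {s t : ℕ} (hst : s ≤ t) {A U : Finset ℤ}
    (h : Isolated A U (2 * s)) :
    |∫ ω, chi A (X F η t ω) ∂P| ≤ ((2 * p - 1) ^ s) ^ U.card := by
  rw [hF.integral_chi, abs_mul, abs_chi, mul_one, abs_of_nonneg (pow_nonneg (by linarith) _),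
    ← pow_mul]
  exact pow_le_pow_of_le_one (by linarith) (by linarith) (h.le_weight hst)

/-- The bound on characters for the process restarted at time `T` from the configuration seen
from the site `a`. -/
lemma IsBasicCoupling.abs_integral_chi_restart_le (hF : IsBasicCoupling P p F) (hp : 1 / 2 ≤ p)
    (hp1 : p ≤ 1) (ξ : Config) (a : ℤ) {s t T : ℕ} (hs : s ≤ T) {A U : Finset ℤ}
    (h : Isolated A U (4 * s)) :
    |∫ ω, (∫ ω', chi A (X F (translate a (X F ξ T ω)) t ω') ∂P) ∂P| ≤
      ((2 * p - 1) ^ s) ^ U.card := by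
  have h0 : 0 ≤ 2 * p - 1 := by linarith
  have h1 : 2 * p - 1 ≤ 1 := by linarith
  simp_rw [hF.integral_chi _ t A, chi_translate]
  rw [integral_const_mul, hF.integral_chi, abs_mul, abs_mul, abs_chi, mul_one,
    abs_of_nonneg (pow_nonneg h0 _), abs_of_nonneg (pow_nonneg h0 _), ← pow_add, ← pow_mul]
  refine pow_le_pow_of_le_one h0 h1 ?_
  -- If `s ≤ t`, the steps after the restart suffice. Otherwise the window remaining after them is
  -- `4s - 2t ≥ 2s`, and the `s` steps are found before time `T`.
  rcases le_total s t with hst | hst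
  · exact ((h.mono (by linarith)).le_weight hst).trans (Nat.le_add_right _ _)
  · obtain ⟨V, hV, hV'⟩ := h.iterate t (by linarith [Int.ofNat_le.2 hst])
    have h3 := ((hV'.mono (w' := 2 * s) (by linarith [Int.ofNat_le.2 hst])).shift a).le_weight hs
    rw [Finset.card_image_of_injective _ (add_right_injective a), hV] at h3
    exact h3.trans (Nat.le_add_left _ _)

end Characters

/-! ### From the decay of characters to niceness: a Chernoff bound. -/

section Niceness

variable {Ω : Type*} [MeasurableSpace Ω]

/-- A random configuration whose characters decay geometrically in the number of separated sites. -/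
def NearUniform (μ : Measure Ω) (Z : Ω → Config) (w : ℤ) (β : ℝ) : Prop :=
  ∀ A U : Finset ℤ, Isolated A U w → |∫ ω, chi A (Z ω) ∂μ| ≤ β ^ U.card

/-- This replaces the exponential moment by a product of factors 1+y, which is multilinear in the
characters and can be integrated term by term. -/
lemma exp_le_one_add {y : ℝ} (h0 : -(1 / 5) ≤ y) (h1 : y ≤ 1 / 5) :
    Real.exp (y - 2 * y ^ 2) ≤ 1 + y := by
  have hb : |y - 2 * y ^ 2| ≤ 1 := by rw [abs_le]; constructor <;> nlinarith
  have h := (abs_le.1 (Real.abs_exp_sub_one_sub_id_le hb)).2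
  have h2 : (y - 2 * y ^ 2) ^ 2 ≤ 2 * y ^ 2 := by
    have : (1 - 2 * y) ^ 2 ≤ 2 := by nlinarith
    nlinarith [sq_nonneg y]
  linarith

variable {μ : Measure Ω} [IsProbabilityMeasure μ] {Z : Ω → Config}

lemma chi_image_add (S : Finset ℤ) (x : ℤ) (s : Config) :
    chi (S.image (x + ·)) s = ∏ j ∈ S, sgn (s (x + j)) := by
  rw [chi, Finset.prod_image fun _ _ _ _ h => by simpa using h]

/-- The translates `x + S` are disjoint, so the product is a single character. The leftmost site of
each translate is isolated in it. -/
lemma NearUniform.abs_integral_prod_le {w : ℤ} (hw : 0 ≤ w)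
    {β : ℝ} (h : NearUniform μ Z w β) {D : Finset ℤ}
    (hD : ∀ x ∈ D, ∀ y ∈ D, x < y → x + w + 3 ≤ y) {S : Finset ℤ} (hS : S ⊆ Finset.Icc 0 2)
    (hS0 : S.Nonempty) :
    |∫ ω, ∏ x ∈ D, chi (S.image (x + ·)) (Z ω) ∂μ| ≤ β ^ D.card := by
  have hS' : ∀ j ∈ S, 0 ≤ j ∧ j ≤ 2 := fun j hj => Finset.mem_Icc.1 (hS hj)
  have hdisj : (D : Set ℤ).PairwiseDisjoint fun x => S.image (x + ·) := by
    intro x hx y hy hxy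
    rw [Function.onFun, Finset.disjoint_left]
    intro z hz hz'
    obtain ⟨i, hi, rfl⟩ := Finset.mem_image.1 hz
    obtain ⟨j, hj, hij⟩ := Finset.mem_image.1 hz'
    have := hS' i hi
    have := hS' j hj
    rcases lt_or_gt_of_ne hxy with hlt | hlt
    · have := hD x hx y hy hlt; linarith
    · have := hD y hy x hx hlt; linarith
  have e : ∀ ω, ∏ x ∈ D, chi (S.image (x + ·)) (Z ω) =
      chi (D.biUnion fun x => S.image (x + ·)) (Z ω) := by
    intro ω
    rw [chi, Finset.prod_biUnion hdisj]
    rfl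
  simp_rw [e]
  set j₀ := S.min' hS0 with hj₀
  have hiso : Isolated (D.biUnion fun x => S.image (x + ·)) (D.image (· + j₀)) w := by
    constructor
    · intro u hu
      obtain ⟨x, hx, rfl⟩ := Finset.mem_image.1 hu
      exact Finset.mem_biUnion.2 ⟨x, hx, Finset.mem_image_of_mem _ (S.min'_mem hS0)⟩
    · intro u hu y hy hle
      obtain ⟨x, hx, rfl⟩ := Finset.mem_image.1 hu
      obtain ⟨z, hz, hy⟩ := Finset.mem_biUnion.1 hy
      obtain ⟨j, hj, rfl⟩ := Finset.mem_image.1 hy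
      have h1 := hS' j hj
      have h2 := hS' j₀ (S.min'_mem hS0)
      have h3 := S.min'_le j hj
      rcases lt_trichotomy x z with hlt | rfl | hlt
      · have := hD x hx z hz hlt; linarith
      · linarith
      · have := hD z hz x hx hlt; linarith
  have := h _ _ hiso
  rwa [Finset.card_image_of_injective _ (add_left_injective j₀)] at this

/-- A Chernoff bound for the average of a character over separated sites. -/
lemma NearUniform.measureReal_sum_le (hZ : ∀ x, Measurable fun ω => Z ω x) {w : ℤ} (hw : 0 ≤ w)
    {β : ℝ} (hβ0 : 0 ≤ β) (hβ : β ≤ 1 / 252) (h : NearUniform μ Z w β) {D : Finset ℤ}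
    (hD : ∀ x ∈ D, ∀ y ∈ D, x < y → x + w + 3 ≤ y) {S : Finset ℤ} (hS : S ⊆ Finset.Icc 0 2)
    (hS0 : S.Nonempty) {c : ℝ} (hc : |c| = 1) :
    μ.real {ω | ∑ x ∈ D, c * chi (S.image (x + ·)) (Z ω) ≤ -(D.card / 63 : ℝ)} ≤
      Real.exp (-(D.card / 63504 : ℝ)) := by
  set e : ℤ → Ω → ℝ := fun x ω => c * chi (S.image (x + ·)) (Z ω) with he
  have hem : ∀ x, Measurable (e x) := fun x => (measurable_chi hZ _).const_mul c
  have he1 : ∀ x ω, |e x ω| = 1 := fun x ω => by rw [he]; simp [abs_mul, hc, abs_chi]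
  -- With λ = 1/252 and β ≤ 1/252, the exponent per site λβ - λ/63 + 2λ² is at most -λ/252 =
  -- -1/63504.
  obtain ⟨lam, hlam⟩ : ∃ l : ℝ, l = 1 / 252 := ⟨_, rfl⟩
  set G : Ω → ℝ := fun ω => ∏ x ∈ D, (1 + -lam * e x ω) with hG
  have hGm : Measurable G := Finset.measurable_fun_prod D fun x _ =>
    ((hem x).const_mul (-lam)).const_add 1
  have hfac : ∀ x ω, 0 ≤ 1 + -lam * e x ω ∧ 1 + -lam * e x ω ≤ 2 := by
    intro x ω
    have := abs_le.1 (he1 x ω).le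
    rw [hlam]
    constructor <;> linarith
  have hGi : Integrable G μ := by
    refine integrable_of_bounded_measurable hGm (∏ x ∈ D, 2) fun ω => ?_
    rw [hG, Finset.abs_prod]
    refine Finset.prod_le_prod (fun _ _ => abs_nonneg _) fun x _ => ?_
    rw [abs_of_nonneg (hfac x ω).1]; exact (hfac x ω).2
  have hint : ∫ ω, G ω ∂μ ≤ Real.exp (D.card * (lam * β)) := by
    have e1 : ∀ ω, G ω = ∑ B ∈ D.powerset, (-lam * c) ^ B.card *
        ∏ x ∈ B, chi (S.image (x + ·)) (Z ω) := by
      intro ω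
      simp only [hG, he]
      rw [Finset.prod_one_add]
      refine Finset.sum_congr rfl fun B _ => ?_
      rw [← Finset.prod_const, ← Finset.prod_mul_distrib]
      exact Finset.prod_congr rfl fun x _ => by ring
    simp_rw [e1]
    rw [integral_finsetSum]
    · calc _ ≤ ∑ B ∈ D.powerset, (lam * β) ^ B.card := by
            refine Finset.sum_le_sum fun B hB => ?_
            rw [integral_const_mul]
            refine (le_abs_self _).trans ?_
            have hlc : |-lam * c| = lam := by
              rw [abs_mul, hc, abs_neg, abs_of_pos (by norm_num [hlam]), mul_one]
            rw [abs_mul, abs_pow, hlc, mul_pow]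
            refine mul_le_mul_of_nonneg_left (h.abs_integral_prod_le hw ?_ hS hS0)
              (by positivity)
            intro x hx y hy
            exact hD x (Finset.mem_powerset.1 hB hx) y (Finset.mem_powerset.1 hB hy)
        _ = (1 + lam * β) ^ D.card := by
            rw [← Finset.prod_const, Finset.prod_one_add]; simp
        _ ≤ Real.exp (lam * β) ^ D.card := by
            refine pow_le_pow_left₀ (by positivity) ?_ _
            linarith [Real.add_one_le_exp (lam * β)]
        _ = _ := by rw [← Real.exp_nat_mul]
    · intro B _
      refine (integrable_of_bounded_measurable (Finset.measurable_fun_prod B fun x _ =>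
        measurable_chi hZ _) 1 fun ω => ?_).const_mul _
      simp [Finset.abs_prod, abs_chi]
  have hlow : ∀ ω, ∑ x ∈ D, e x ω ≤ -(D.card / 63 : ℝ) →
      Real.exp (D.card * (lam / 63 - 2 * lam ^ 2)) ≤ G ω := by
    intro ω hω
    calc Real.exp (D.card * (lam / 63 - 2 * lam ^ 2))
        ≤ Real.exp (∑ x ∈ D, (-lam * e x ω - 2 * (-lam * e x ω) ^ 2)) := by
          apply Real.exp_le_exp.2
          have : ∀ x ∈ D, -lam * e x ω - 2 * (-lam * e x ω) ^ 2 =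
              -lam * e x ω - 2 * lam ^ 2 := by
            intro x _
            have : (e x ω) ^ 2 = 1 := by rw [← sq_abs, he1]; norm_num
            linear_combination -2 * lam ^ 2 * this
          rw [Finset.sum_congr rfl this, Finset.sum_sub_distrib, ← Finset.mul_sum]
          simp only [Finset.sum_const, nsmul_eq_mul]
          have hl : (0 : ℝ) < lam := by norm_num [hlam]
          nlinarith
      _ = ∏ x ∈ D, Real.exp (-lam * e x ω - 2 * (-lam * e x ω) ^ 2) := Real.exp_sum _ _
      _ ≤ G ω := by
          refine Finset.prod_le_prod (fun _ _ => (Real.exp_pos _).le) fun x _ => ?_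
          have := abs_le.1 (he1 x ω).le
          exact exp_le_one_add (by norm_num [hlam]; linarith) (by norm_num [hlam]; linarith)
  have hmarkov := mul_meas_ge_le_integral_of_nonneg (μ := μ) (f := G)
    (ae_of_all _ fun ω => Finset.prod_nonneg fun x _ => (hfac x ω).1) hGi
    (Real.exp (D.card * (lam / 63 - 2 * lam ^ 2)))
  have hsub : μ.real {ω | ∑ x ∈ D, e x ω ≤ -(D.card / 63 : ℝ)} ≤
      μ.real {ω | Real.exp (D.card * (lam / 63 - 2 * lam ^ 2)) ≤ G ω} :=
    measureReal_mono fun ω hω => hlow ω hω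
  refine hsub.trans ?_
  have h4 : Real.exp (D.card * (lam / 63 - 2 * lam ^ 2)) *
      μ.real {ω | Real.exp (D.card * (lam / 63 - 2 * lam ^ 2)) ≤ G ω} ≤
      Real.exp (D.card * (lam * β)) := hmarkov.trans hint
  rw [← le_div_iff₀' (Real.exp_pos _), ← Real.exp_sub] at h4
  refine h4.trans (Real.exp_le_exp.2 ?_)
  have hc0 : (0 : ℝ) ≤ D.card := Nat.cast_nonneg _
  have : lam * β ≤ lam / 252 := by rw [hlam]; linarith
  rw [hlam] at this ⊢
  nlinarith

/-- If a pattern occurs at less than one ninth of the sites of `D`, then some character has an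
unexpectedly small average. -/
lemma exists_sum_le_of_card_lt (τ : ℤ → Cell) (s : Config) (D : Finset ℤ)
    (h : (9 : ℝ) * (D.filter fun x => ∀ j ∈ Finset.Icc (0 : ℤ) 2, s (x + j) = τ j).card < D.card) :
    ∃ S ∈ (Finset.Icc (0 : ℤ) 2).powerset.erase ∅,
      ∑ x ∈ D, (∏ j ∈ S, sgn (τ j)) * chi (S.image (x + ·)) s ≤ -(D.card / 63 : ℝ) := by
  by_contra hcon
  push Not at hcon
  -- Fourier expansion of the indicator of a pattern of length three.
  have key : ∀ x, (8 : ℝ) * (if ∀ j ∈ Finset.Icc (0 : ℤ) 2, s (x + j) = τ j then 1 else 0) =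
      ∑ S ∈ (Finset.Icc (0 : ℤ) 2).powerset,
        (∏ j ∈ S, sgn (τ j)) * chi (S.image (x + ·)) s := by
    intro x
    have h1 : ∀ j, 1 + sgn (τ j) * sgn (s (x + j)) = 2 * if s (x + j) = τ j then 1 else 0 := by
      intro j
      have : ∀ a b : Cell, b ≠ a → a = b + 1 := by decide
      by_cases hj : s (x + j) = τ j
      · rw [hj, sgn_mul_self]; norm_num
      · rw [this _ _ hj, sgn_add, if_neg (by simp), mul_right_comm, sgn_mul_self]
        simp [sgn]
    simp_rw [chi_image_add, ← Finset.prod_mul_distrib]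
    rw [← Finset.prod_one_add]
    simp_rw [h1, Finset.prod_mul_distrib, Finset.prod_ite_zero]
    have h3 : (Finset.Icc (0 : ℤ) 2).card = 3 := by decide
    rw [Finset.prod_const, h3, Finset.prod_const_one]
    norm_num
  -- The empty character contributes `D.card`. A frequency below 1/9 forces the seven others to sum
  -- to less than -1/9 of it, hence the threshold 1/63.
  have hsum : (8 : ℝ) * (D.filter fun x => ∀ j ∈ Finset.Icc (0 : ℤ) 2, s (x + j) = τ j).card =
      D.card + ∑ S ∈ (Finset.Icc (0 : ℤ) 2).powerset.erase ∅,
        ∑ x ∈ D, (∏ j ∈ S, sgn (τ j)) * chi (S.image (x + ·)) s := by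
    rw [Finset.card_filter]
    push_cast
    rw [Finset.mul_sum, Finset.sum_congr rfl fun x _ => key x, Finset.sum_comm,
      ← Finset.add_sum_erase _ _ (Finset.empty_mem_powerset _)]
    simp [chi]
  have hcard : ((Finset.Icc (0 : ℤ) 2).powerset.erase ∅).card = 7 := by decide
  have hlt := Finset.sum_le_sum fun S hS => (hcon S hS).le
  rw [Finset.sum_const, hcard] at hlt
  simp only [nsmul_eq_mul] at hlt
  push_cast at hlt
  linarith

lemma le_card_residue {g h : ℤ} {q M : ℕ} (hq : 0 < q) (hM : (M * q : ℤ) ≤ h - g + 1) {r : ℤ} :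
    M ≤ ((Finset.Icc g h).filter fun x => x % q = r % q).card := by
  have hq' : (0 : ℤ) < q := by exact_mod_cast hq
  have hinj : Set.InjOn (fun k : ℕ => g + (r - g) % q + k * q) (Finset.range M : Set ℕ) := by
    intro a _ b _ hab
    have : (a : ℤ) * q = b * q := by simpa using hab
    exact_mod_cast mul_right_cancel₀ hq'.ne' this
  rw [← Finset.card_range M, ← Finset.card_image_of_injOn hinj]
  refine Finset.card_le_card fun x hx => ?_
  obtain ⟨k, hk, rfl⟩ := Finset.mem_image.1 hx
  have hk' : (k : ℤ) + 1 ≤ M := by exact_mod_cast Finset.mem_range.1 hk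
  have h1 := Int.emod_nonneg (r - g) hq'.ne'
  have h2 := Int.emod_lt_of_pos (r - g) hq'
  have h3 : ((k : ℤ) + 1) * q ≤ M * q := mul_le_mul_of_nonneg_right hk' hq'.le
  have h4 : (0 : ℤ) ≤ k * q := by positivity
  rw [Finset.mem_filter, Finset.mem_Icc]
  refine ⟨⟨by linarith, by linarith⟩, ?_⟩
  rw [Int.add_mul_emod_self_right]
  have h5 := (Int.mod_modEq (r - g) q).add_left g
  rwa [add_sub_cancel] at h5

/-- If every class modulo `q` contains the pattern often enough, then the sequence is nice. -/
lemma isNice_of_forall_residue {abc : Triple} {s : Config} {g h : ℤ} {q : ℕ} (hq : 0 < q)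
    (hq8 : 8 ∣ q) (hlen : (q : ℤ) ≤ h - 2 - g + 1)
    (H : ∀ r ∈ Finset.Ico (0 : ℤ) q, ((Finset.Icc g (h - 2)).filter fun x => x % q = r).card ≤
      9 * (((Finset.Icc g (h - 2)).filter fun x => x % q = r).filter
        fun x => (s x, s (x + 1), s (x + 2)) = abc).card) :
    IsNice abc s g h := by
  intro i _
  have hq' : (0 : ℤ) < q := by exact_mod_cast hq
  have hq8' : (8 : ℤ) ∣ q := by exact_mod_cast hq8
  set V := (Finset.Icc g (h - 2)).filter fun x => x ≡ i [ZMOD 8] with hV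
  set W := (Finset.Icc g (h - 2)).filter
    fun x => x ≡ i [ZMOD 8] ∧ (s x, s (x + 1), s (x + 2)) = abc with hW
  have hmaps : ∀ x : ℤ, x % q ∈ Finset.Ico (0 : ℤ) q := fun x =>
    Finset.mem_Ico.2 ⟨Int.emod_nonneg _ hq'.ne', Int.emod_lt_of_pos _ hq'⟩
  have hVW : V.card ≤ 9 * W.card := by
    rw [Finset.card_eq_sum_card_fiberwise (f := fun x => x % (q : ℤ)) (s := V)
      (fun x _ => hmaps x), Finset.card_eq_sum_card_fiberwise (f := fun x => x % (q : ℤ)) (s := W)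
      (fun x _ => hmaps x), Finset.mul_sum]
    refine Finset.sum_le_sum fun r hr => ?_
    by_cases hri : r ≡ i [ZMOD 8]
    · have hx : ∀ x : ℤ, x % q = r → x ≡ i [ZMOD 8] := by
        intro x hx
        exact (((Int.mod_modEq x q).of_dvd hq8').symm.trans (by rw [hx])).trans hri
      refine le_trans (Finset.card_le_card fun x hx' => ?_) ((H r hr).trans
        (Nat.mul_le_mul_left 9 (Finset.card_le_card fun x hx' => ?_)))
      · simp only [hV, Finset.mem_filter] at hx' ⊢
        exact ⟨hx'.1.1, hx'.2⟩
      · simp only [hW, Finset.mem_filter] at hx' ⊢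
        exact ⟨⟨hx'.1.1, hx x hx'.1.2, hx'.2⟩, hx'.1.2⟩
    · have : V.filter (fun x => x % (q : ℤ) = r) = ∅ := by
        refine Finset.filter_eq_empty_iff.2 fun x hx hxr => hri ?_
        rw [← hxr]
        exact ((Int.mod_modEq x q).of_dvd hq8').trans (Finset.mem_filter.1 hx).2
      simp [this]
  have hVpos : 0 < V.card := by
    have h1 := le_card_residue (g := g) (h := h - 2) (q := q) (M := 1) hq
      (by push_cast; linarith) (r := i)
    refine lt_of_lt_of_le (lt_of_lt_of_le one_pos h1) (Finset.card_le_card fun x hx => ?_)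
    simp only [hV, Finset.mem_filter] at hx ⊢
    exact ⟨hx.1, Int.ModEq.of_dvd hq8' hx.2⟩
  rw [le_div_iff₀ (by exact_mod_cast hVpos)]
  have : (V.card : ℝ) ≤ 9 * W.card := by exact_mod_cast hVW
  linarith

/-- A nearly uniform configuration is nice at large scales, with high probability. -/
lemma NearUniform.measureReal_not_isEllNice_le (hZ : ∀ x, Measurable fun ω => Z ω x) {w : ℤ}
    (hw : 0 ≤ w) {β : ℝ} (hβ0 : 0 ≤ β) (hβ : β ≤ 1 / 252) (h : NearUniform μ Z w β)
    (abc : Triple) {ℓ q M : ℕ} (hq8 : 8 ∣ q) (hqw : w + 3 ≤ q) (hM0 : 1 ≤ M)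
    (hM : M * q + 2 ≤ ℓ) (A₁ A₂ : ℤ) :
    μ.real {ω | ¬ IsEllNice abc ℓ (Z ω) (Set.Icc A₁ A₂)} ≤
      ((A₂ - A₁ + 1).toNat : ℝ) ^ 2 * q * 7 * Real.exp (-(M / 63504 : ℝ)) := by
  have hq' : (0 : ℤ) < q := by linarith
  have hq : 0 < q := by exact_mod_cast hq'
  set τ : ℤ → Cell := fun j => if j = 0 then abc.1 else if j = 1 then abc.2.1 else abc.2.2 with hτ
  have hpat : ∀ (s : Config) (x : ℤ), (s x, s (x + 1), s (x + 2)) = abc ↔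
      ∀ j ∈ Finset.Icc (0 : ℤ) 2, s (x + j) = τ j := by
    intro s x
    constructor
    · rintro rfl j hj
      obtain ⟨h0, h2⟩ := Finset.mem_Icc.1 hj
      interval_cases j <;> simp [hτ]
    · intro H
      have h0 := H 0 (by decide)
      have h1 := H 1 (by decide)
      have h2 := H 2 (by decide)
      simp only [hτ, add_zero] at h0 h1 h2
      rw [h0, h1, h2]; rfl
  -- Sites of one class modulo `q` are at least `w + 3` apart, as the Chernoff bound requires. Since
  -- `8 ∣ q`, these classes refine the classes modulo 8 of the definition of niceness.
  set D : ℤ × ℤ × ℤ × Finset ℤ → Finset ℤ :=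
    fun i => (Finset.Icc i.1 (i.2.1 - 2)).filter fun x => x % (q : ℤ) = i.2.2.1 with hD
  set c : ℤ × ℤ × ℤ × Finset ℤ → ℝ := fun i => ∏ j ∈ i.2.2.2, sgn (τ j) with hc
  set E : ℤ × ℤ × ℤ × Finset ℤ → Set Ω := fun i => {ω | M ≤ (D i).card ∧
    ∑ x ∈ D i, c i * chi (i.2.2.2.image (x + ·)) (Z ω) ≤ -((D i).card / 63 : ℝ)} with hE
  set idx : Finset (ℤ × ℤ × ℤ × Finset ℤ) := Finset.Icc A₁ A₂ ×ˢ Finset.Icc A₁ A₂ ×ˢ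
    Finset.Ico (0 : ℤ) q ×ˢ ((Finset.Icc (0 : ℤ) 2).powerset.erase ∅) with hidx
  have hsub : {ω | ¬ IsEllNice abc ℓ (Z ω) (Set.Icc A₁ A₂)} ⊆ ⋃ i ∈ idx, E i := by
    intro ω hω
    simp only [Set.mem_ofPred_eq, IsEllNice] at hω
    push Not at hω
    obtain ⟨g, k, hgk, hA, hℓ, hnice⟩ := hω
    have hℓ' : ((M * q + 2 : ℕ) : ℤ) ≤ ℓ := by exact_mod_cast hM
    push_cast at hℓ'
    have hM0' : (1 : ℤ) * q ≤ M * q := mul_le_mul_of_nonneg_right (by exact_mod_cast hM0) hq'.le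
    have hex : ∃ r ∈ Finset.Ico (0 : ℤ) q,
        9 * (((Finset.Icc g (k - 2)).filter fun x => x % q = r).filter
        fun x => (Z ω x, Z ω (x + 1), Z ω (x + 2)) = abc).card <
        ((Finset.Icc g (k - 2)).filter fun x => x % q = r).card := by
      by_contra hcon
      push Not at hcon
      exact hnice (isNice_of_forall_residue hq hq8 (by linarith) hcon)
    obtain ⟨r, hr, hlt⟩ := hex
    simp_rw [hpat] at hlt
    obtain ⟨S, hS, hsum⟩ := exists_sum_le_of_card_lt τ (Z ω) _ (by exact_mod_cast hlt)
    have hgA := Set.mem_Icc.1 (hA (Set.left_mem_Icc.2 hgk))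
    have hkA := Set.mem_Icc.1 (hA (Set.right_mem_Icc.2 hgk))
    refine Set.mem_biUnion (x := (g, k, r, S)) ?_ ⟨?_, hsum⟩
    · simp only [hidx, Finset.coe_product, Set.mem_prod, Finset.mem_coe]
      exact ⟨Finset.mem_Icc.2 hgA, Finset.mem_Icc.2 hkA, hr, hS⟩
    · have h1 := le_card_residue (g := g) (h := k - 2) (q := q) (M := M) hq
        (by linarith) (r := r)
      rwa [Int.emod_eq_of_lt (Finset.mem_Ico.1 hr).1 (Finset.mem_Ico.1 hr).2] at h1
  have hEi : ∀ i ∈ idx, μ.real (E i) ≤ Real.exp (-(M / 63504 : ℝ)) := by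
    intro i hi
    obtain ⟨g, k, r, S⟩ := i
    simp only [hidx, Finset.mem_product, Finset.mem_erase, Finset.mem_powerset] at hi
    by_cases hMD : M ≤ (D (g, k, r, S)).card
    · have hcabs : |c (g, k, r, S)| = 1 := by simp [hc, Finset.abs_prod, abs_sgn]
      have hsp : ∀ x ∈ D (g, k, r, S), ∀ y ∈ D (g, k, r, S), x < y → x + w + 3 ≤ y := by
        intro x hx y hy hxy
        have h1 : x % q = y % q := by
          rw [(Finset.mem_filter.1 hx).2, (Finset.mem_filter.1 hy).2]
        have h2 : (q : ℤ) ∣ y - x := Int.ModEq.dvd h1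
        have := Int.le_of_dvd (by linarith) h2
        linarith
      refine le_trans (measureReal_mono fun ω hω => hω.2)
        ((h.measureReal_sum_le hZ hw hβ0 hβ hsp hi.2.2.2.2
          (Finset.nonempty_iff_ne_empty.2 hi.2.2.2.1) hcabs).trans (Real.exp_le_exp.2 ?_))
      have : (M : ℝ) ≤ (D (g, k, r, S)).card := by exact_mod_cast hMD
      linarith
    · have : E (g, k, r, S) = ∅ := by
        ext ω; simp only [hE, Set.mem_ofPred_eq, Set.mem_empty_iff_false, iff_false]
        exact fun hω => hMD hω.1
      rw [this]; simp [(Real.exp_pos _).le]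
  have hcard : (idx.card : ℝ) = ((A₂ - A₁ + 1).toNat : ℝ) ^ 2 * q * 7 := by
    have h7 : ((Finset.Icc (0 : ℤ) 2).powerset.erase ∅).card = 7 := by decide
    rw [hidx, Finset.card_product, Finset.card_product, Finset.card_product, h7, Int.card_Icc,
      Int.card_Ico, show A₂ + 1 - A₁ = A₂ - A₁ + 1 by ring]
    push_cast
    simp
    ring
  calc _ ≤ μ.real (⋃ i ∈ idx, E i) := measureReal_mono hsub (measure_ne_top _ _)
    _ ≤ ∑ i ∈ idx, μ.real (E i) := measureReal_biUnion_finset_le _ _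
    _ ≤ ∑ _ ∈ idx, Real.exp (-(M / 63504 : ℝ)) := Finset.sum_le_sum hEi
    _ = _ := by rw [Finset.sum_const, nsmul_eq_mul, hcard]

end Niceness

/-! ### Niceness of the environment, and of the environment restarted at time T. -/

section Environment

variable {Ω : Type*} [MeasurableSpace Ω] {P : Measure Ω} {p : ℝ} {F : ℤ → ℕ → Ω → LocalRule}
  [IsProbabilityMeasure P]

/-- The bound on the probability of not being nice on an interval with `N` sites. -/
noncomputable def niceErr (N : ℝ) (q M : ℕ) : ℝ := N ^ 2 * q * 7 * Real.exp (-(M / 63504 : ℝ))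

lemma IsBasicCoupling.measurable_X' (hF : IsBasicCoupling P p F) (ξ : Config) (t : ℕ) (x : ℤ) :
    Measurable fun ω => X F ξ t ω x :=
  (measurable_X F ξ t x).mono (hF.gen_le _) le_rfl

lemma IsBasicCoupling.nearUniform_X (hF : IsBasicCoupling P p F) (hp : 1 / 2 ≤ p)
    (hp1 : p ≤ 1) (ξ : Config) {s t : ℕ} (hst : s ≤ t) :
    NearUniform P (X F ξ t) (4 * s) ((2 * p - 1) ^ s) := fun _ _ h =>
  hF.abs_integral_chi_le hp hp1 ξ hst (h.mono (by linarith))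

lemma IsBasicCoupling.measurable_restart (hF : IsBasicCoupling P p F) (ξ : Config) (a : ℤ)
    (T t : ℕ) : ∀ x : ℤ, Measurable fun z : Ω × Ω =>
      X F (translate a (X F ξ T z.1)) t z.2 x := by
  induction t with
  | zero => intro x; exact (hF.measurable_X' ξ T (a + x)).comp measurable_fst
  | succ t ih =>
    intro x
    have h1 : Measurable fun z : Ω × Ω => (F x t z.2, X F (translate a (X F ξ T z.1)) t z.2 (x - 1),
        X F (translate a (X F ξ T z.1)) t z.2 x, X F (translate a (X F ξ T z.1)) t z.2 (x + 1)) :=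
      Measurable.prodMk ((hF.measurable x t).comp measurable_snd)
        (Measurable.prodMk (ih _) (Measurable.prodMk (ih _) (ih _)))
    exact (Measurable.of_discrete
      (f := fun z : LocalRule × Cell × Cell × Cell => z.1 z.2.1 z.2.2.1 z.2.2.2)).comp h1

/-- `Q` evaluated at the random configuration of time `T` is a section probability on `Ω × Ω`, the
second coordinate driving the restarted process. Near uniformity is therefore needed for the product
measure. -/
lemma IsBasicCoupling.nearUniform_restart (hF : IsBasicCoupling P p F) (hp : 1 / 2 ≤ p)
    (hp1 : p ≤ 1) (ξ : Config) (a : ℤ) (t : ℕ) {s T : ℕ} (hs : s ≤ T) :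
    NearUniform (P.prod P) (fun z => X F (translate a (X F ξ T z.1)) t z.2) (4 * s)
      ((2 * p - 1) ^ s) := by
  intro A U h
  rw [integral_prod]
  · exact hF.abs_integral_chi_restart_le hp hp1 ξ a hs h
  · exact integrable_of_bounded_measurable (measurable_chi (hF.measurable_restart ξ a T t) A) 1
      fun z => (abs_chi _ _).le

lemma niceErr_mono {N N' : ℝ} (h0 : 0 ≤ N) (h : N ≤ N') (q M : ℕ) :
    niceErr N q M ≤ niceErr N' q M := by
  unfold niceErr; gcongr

lemma niceErr_nonneg (N : ℝ) (q M : ℕ) : 0 ≤ niceErr N q M := by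
  unfold niceErr; positivity

/-- After time `s`, the environment is nice whatever its initial state. -/
lemma IsBasicCoupling.measureReal_X_not_nice_le (hF : IsBasicCoupling P p F) (hp : 1 / 2 ≤ p)
    (hp1 : p ≤ 1) (ξ : Config) {s t : ℕ} (hst : s ≤ t) (hβ : (2 * p - 1) ^ s ≤ 1 / 252)
    (abc : Triple) {ℓ q M : ℕ} (hq8 : 8 ∣ q) (hqw : 4 * s + 3 ≤ q) (hM0 : 1 ≤ M)
    (hM : M * q + 2 ≤ ℓ) (A₁ A₂ : ℤ) {N : ℝ} (hN : ((A₂ - A₁ + 1).toNat : ℝ) ≤ N) :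
    P.real {ω | ¬ IsEllNice abc ℓ (X F ξ t ω) (Set.Icc A₁ A₂)} ≤ niceErr N q M :=
  ((hF.nearUniform_X hp hp1 ξ hst).measureReal_not_isEllNice_le (hF.measurable_X' ξ t)
    (by positivity) (pow_nonneg (by linarith) _) hβ abc hq8 (by exact_mod_cast hqw) hM0 hM
    A₁ A₂).trans (niceErr_mono (Nat.cast_nonneg _) hN q M)

/-- The gap forces an interval contained in the union to lie in one of the two parts. -/
lemma IsEllNice.union {abc : Triple} {ℓ : ℕ} {s : Config} {a b c d : ℤ} (hbc : b + 1 < c)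
    (h1 : IsEllNice abc ℓ s (Set.Icc a b)) (h2 : IsEllNice abc ℓ s (Set.Icc c d)) :
    IsEllNice abc ℓ s (Set.Icc a b ∪ Set.Icc c d) := by
  intro g h hgh hsub hlen
  by_cases hb : h ≤ b
  · refine h1 g h hgh (fun x hx => ?_) hlen
    rcases hsub hx with hx' | hx'
    · exact hx'
    · have := hx.2; have := hx'.1; exact absurd hbc (by linarith)
  by_cases hc : c ≤ g
  · refine h2 g h hgh (fun x hx => ?_) hlen
    rcases hsub hx with hx' | hx'
    · have := hx.1; have := hx'.2; exact absurd hbc (by linarith)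
    · exact hx'
  push Not at hb hc
  exfalso
  rcases hsub (Set.left_mem_Icc.2 hgh) with hg | hg
  · rcases hsub (show b + 1 ∈ Set.Icc g h from ⟨by linarith [hg.2], by linarith⟩) with h' | h'
    · linarith [h'.2]
    · linarith [h'.1]
  · linarith [hg.1]

/-- A Markov inequality for the sections of a subset of a product space. -/
lemma measureReal_section_gt_le {B : Set (Ω × Ω)} {θ c : ℝ} (hθ : 0 < θ)
    (hB : (P.prod P).real B ≤ c) :
    P.real {ω | θ < P.real {ω' | (ω, ω') ∈ B}} ≤ c / θ := by
  -- Passing to a measurable hull makes the argument valid for any `B`.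
  set B' := toMeasurable (P.prod P) B with hB'
  have hm : MeasurableSet B' := measurableSet_toMeasurable _ _
  have h1 : ENNReal.ofReal θ * P {ω | ENNReal.ofReal θ ≤ P (Prod.mk ω ⁻¹' B')} ≤
      (P.prod P) B := by
    rw [← measure_toMeasurable B, ← hB', Measure.prod_apply hm]
    exact mul_meas_ge_le_lintegral (measurable_measure_prodMk_left hm) _
  have h2 : {ω | θ < P.real {ω' | (ω, ω') ∈ B}} ⊆
      {ω | ENNReal.ofReal θ ≤ P (Prod.mk ω ⁻¹' B')} := by
    intro ω hω
    simp only [Set.mem_ofPred_eq] at hω ⊢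
    have h3 : P {ω' | (ω, ω') ∈ B} ≤ P (Prod.mk ω ⁻¹' B') :=
      measure_mono fun ω' hω' => subset_toMeasurable _ _ hω'
    refine le_trans ?_ h3
    rw [ENNReal.ofReal_le_iff_le_toReal (measure_ne_top _ _)]
    exact hω.le
  rw [le_div_iff₀' hθ]
  refine le_trans ?_ hB
  have h4 := ENNReal.toReal_mono (measure_ne_top _ _) h1
  rw [ENNReal.toReal_mul, ENNReal.toReal_ofReal hθ.le] at h4
  exact (mul_le_mul_of_nonneg_left (measureReal_mono h2) hθ.le).trans h4

/-- With high probability, the configuration at time `T` leads to a nice environment. -/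
lemma IsBasicCoupling.measureReal_Q_gt_le (hF : IsBasicCoupling P p F) (hp : 1 / 2 ≤ p)
    (hp1 : p ≤ 1) (ξ : Config) (a : ℤ) {s T : ℕ} (hs : s ≤ T) (hβ : (2 * p - 1) ^ s ≤ 1 / 252)
    (abc : Triple) {ℓ q M : ℕ} (hq8 : 8 ∣ q) (hqw : 4 * s + 3 ≤ q) (hM0 : 1 ≤ M)
    (hM : M * q + 2 ≤ ℓ) (hK : 0 < K (eps P F)) {θ : ℝ} (hθ : 0 < θ) :
    P.real {ω | ¬ Q P F abc ℓ (translate a (X F ξ T ω)) ≤ θ} ≤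
      K (eps P F) * (2 * niceErr (K (eps P F)) q M) / θ := by
  obtain ⟨k, hk0, hk⟩ : ∃ k : ℕ, 1 ≤ k ∧ K (eps P F) = 10 * k :=
    ⟨⌈(eps P F) ^ (-(3 / 2) : ℝ)⌉₊, by unfold K at hK; omega, rfl⟩
  set B : Set (Ω × Ω) := {z | ∃ t < K (eps P F),
    ¬ IsEllNice abc ℓ (X F (translate a (X F ξ T z.1)) t z.2) (J (eps P F))} with hBdef
  have hmain := measureReal_section_gt_le (P := P) (B := B)
    (c := K (eps P F) * (2 * niceErr (K (eps P F)) q M)) hθ ?_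
  · refine le_trans (le_of_eq ?_) hmain
    congr 1
    ext ω
    simp only [Set.mem_ofPred_eq, not_le]
    rfl
  · have hsub : B ⊆ ⋃ t ∈ Finset.range (K (eps P F)),
        ({z | ¬ IsEllNice abc ℓ (X F (translate a (X F ξ T z.1)) t z.2) (Jminus (eps P F))} ∪
          {z | ¬ IsEllNice abc ℓ (X F (translate a (X F ξ T z.1)) t z.2) (Jplus (eps P F))}) := by
      rintro z ⟨t, ht, hz⟩
      refine Set.mem_biUnion (Finset.mem_coe.2 (Finset.mem_range.2 ht)) ?_
      by_contra hcon
      simp only [Set.mem_union, Set.mem_ofPred_eq, not_or, not_not] at hcon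
      refine hz (IsEllNice.union ?_ hcon.1 hcon.2)
      rw [hk]; push_cast; omega
    have hb : ∀ (t : ℕ) (A₁ A₂ : ℤ), ((A₂ - A₁ + 1).toNat : ℝ) ≤ K (eps P F) →
        (P.prod P).real {z | ¬ IsEllNice abc ℓ (X F (translate a (X F ξ T z.1)) t z.2)
          (Set.Icc A₁ A₂)} ≤ niceErr (K (eps P F)) q M := fun t A₁ A₂ hA =>
      ((hF.nearUniform_restart hp hp1 ξ a t hs).measureReal_not_isEllNice_le
        (hF.measurable_restart ξ a T t) (by positivity) (pow_nonneg (by linarith) _) hβ abc hq8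
        (by exact_mod_cast hqw) hM0 hM A₁ A₂).trans (niceErr_mono (Nat.cast_nonneg _) hA q M)
    calc (P.prod P).real B ≤ _ := measureReal_mono hsub (measure_ne_top _ _)
      _ ≤ ∑ t ∈ Finset.range (K (eps P F)), _ := measureReal_biUnion_finset_le _ _
      _ ≤ ∑ t ∈ Finset.range (K (eps P F)), 2 * niceErr (K (eps P F)) q M := by
          refine Finset.sum_le_sum fun t _ => (measureReal_union_le _ _).trans ?_
          rw [two_mul]
          refine add_le_add (hb t _ _ ?_) (hb t _ _ ?_)
          · rw [hk]; push_cast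
            exact_mod_cast (by omega :
              (-(6 * (10 * (k : ℤ)) / 5) - -(9 * (10 * (k : ℤ)) / 5) + 1).toNat ≤ 10 * k)
          · rw [hk]; push_cast
            exact_mod_cast (by omega :
              ((9 * (10 * (k : ℤ)) / 5) - (6 * (10 * (k : ℤ)) / 5) + 1).toNat ≤ 10 * k)
      _ = _ := by rw [Finset.sum_const, Finset.card_range, nsmul_eq_mul]

end Environment

/-! ### Additive preimages of the dangerous periodic words. -/

section Words

/-- The sequence with given first two terms whose image under the additive rule is `σ`. -/
def preimage (σ : ℕ → Cell) (α β : Cell) : ℕ → Cell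
  | 0 => α
  | 1 => β
  | n + 2 => preimage σ α β n + σ n

lemma eq_preimage {σ z : ℕ → Cell} {b : ℕ} (h : ∀ n < b, σ n = z n + z (n + 2)) (n : ℕ)
    (hn : n ≤ b + 1) : z n = preimage σ (z 0) (z 1) n := by
  induction n using Nat.strong_induction_on with
  | _ n ih =>
    match n, hn, ih with
    | 0, _, _ => rfl
    | 1, _, _ => rfl
    | n + 2, hn, ih =>
      rw [preimage, ← ih n (by omega) (by omega), h n (by omega), ← add_assoc,
        CharTwo.add_self_eq_zero, zero_add]

/-- A shift by 4 adds σ_n + σ_{n+2}. As σ is 4-periodic, a second shift adds the same quantity,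
which cancels modulo 2. This is why niceness is required along classes modulo 8. -/
lemma preimage_add_eight {σ : ℕ → Cell} (hσ : ∀ n, σ (n + 4) = σ n) (α β : Cell) (n : ℕ) :
    preimage σ α β (n + 8) = preimage σ α β n := by
  have h4 : ∀ n, preimage σ α β (n + 4) = preimage σ α β n + σ n + σ (n + 2) := fun n => rfl
  rw [show n + 8 = n + 4 + 4 from rfl, h4, h4, hσ, show n + 4 + 2 = n + 2 + 4 by omega, hσ]
  have : ∀ a b c : Cell, a + b + c + b + c = a := by decide
  exact this _ _ _

lemma preimage_mod_eight {σ : ℕ → Cell} (hσ : ∀ n, σ (n + 4) = σ n) (α β : Cell) (n : ℕ) :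
    preimage σ α β n = preimage σ α β (n % 8) := by
  conv_lhs => rw [← Nat.mod_add_div n 8]
  induction n / 8 with
  | zero => rfl
  | succ k ih => rw [← ih, Nat.mul_succ, ← add_assoc, preimage_add_eight hσ]

def word1 : ZMod 4 → Cell := (![1, 1, 1, 1] : Fin 4 → Cell)

def word01 : ZMod 4 → Cell := (![0, 1, 0, 1] : Fin 4 → Cell)

def word0111 : ZMod 4 → Cell := (![0, 1, 1, 1] : Fin 4 → Cell)

/-- Every additive preimage of the word `W` contains the triple `d`. -/
def Forcing (W : ZMod 4 → Cell) (d : Triple) : Prop :=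
  ∀ (c : ZMod 4) (α β : Cell), ∃ i : Fin 8,
    (preimage (fun n => W (c + n)) α β i, preimage (fun n => W (c + n)) α β (i + 1),
      preimage (fun n => W (c + n)) α β (i + 2)) = d

/-- The preimages of the constant word 1 are the translates of …0011…. -/
lemma forcing_word1 {d : Triple} (hd : d = (0, 0, 1) ∨ d = (1, 0, 0)) : Forcing word1 d := by
  rcases hd with rfl | rfl <;> unfold Forcing <;> decide

lemma forcing_word0111 {d : Triple} (hd : d = (0, 0, 1) ∨ d = (1, 0, 0)) :
    Forcing word0111 d := by
  rcases hd with rfl | rfl <;> unfold Forcing <;> decide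

/-- In a preimage of 01, one parity class is constant and the other alternates. The constant 0 gives
…0001…, which contains both 001 and 100; the constant 1 gives 0111, which contains neither. This is
why 0111 has to be excluded at a smaller scale. -/
lemma word01_dichotomy {d : Triple} (hd : d = (0, 0, 1) ∨ d = (1, 0, 0)) :
    ∀ (c : ZMod 4) (α β : Cell), (∃ i : Fin 8,
    (preimage (fun n => word01 (c + n)) α β i, preimage (fun n => word01 (c + n)) α β (i + 1),
      preimage (fun n => word01 (c + n)) α β (i + 2)) = d) ∨
    ∃ l : ZMod 4, ∀ i : Fin 8,
      preimage (fun n => word01 (c + n)) α β i = word0111 ((i : ℕ) + l) := by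
  rcases hd with rfl | rfl <;> decide

lemma mem_orbit1 {σ : Config} (h : σ ∈ orbit1) (x : ℤ) : σ x = word1 ((x : ZMod 4) + 0) := by
  obtain ⟨l, hl⟩ := h
  rw [hl x]
  have h1 : ∀ c : ZMod 1, (![1] : Fin 1 → Cell) c = 1 := fun c => by
    rw [Subsingleton.elim c 0]; rfl
  have h2 : ∀ c : ZMod 4, word1 c = 1 := by decide
  rw [h2]; exact h1 _

lemma mem_orbit01 {σ : Config} (h : σ ∈ orbit01) :
    ∃ l : ZMod 4, ∀ x : ℤ, σ x = word01 ((x : ZMod 4) + l) := by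
  obtain ⟨l, hl⟩ := h
  have h1 : ∀ l : ZMod 2, ∃ l' : ZMod 4, ∀ c : ZMod 4,
      (![0, 1] : Fin 2 → Cell) (ZMod.castHom (show 2 ∣ 4 by norm_num) (ZMod 2) c + l) =
        word01 (c + l') := by decide
  obtain ⟨l', hl'⟩ := h1 l
  refine ⟨l', fun x => ?_⟩
  rw [hl x, ← hl' (x : ZMod 4), map_intCast]

lemma mem_orbit0111 {σ : Config} :
    σ ∈ orbit0111 ↔ ∃ l : ZMod 4, ∀ x : ℤ, σ x = word0111 ((x : ZMod 4) + l) := Iff.rfl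

/-- `y` is an additive preimage of the word `W`, from `u - 1` on. -/
lemma eq_preimage_word {W : ZMod 4 → Cell} {l : ZMod 4} {y : Config} {u : ℤ} {b : ℕ}
    (h : ∀ x ∈ Set.Icc u (u + b - 1), W ((x : ZMod 4) + l) = y (x - 1) + y (x + 1)) {n : ℕ}
    (hn : n ≤ b + 1) :
    y (u - 1 + n) = preimage (fun n => W ((u : ZMod 4) + l + n)) (y (u - 1)) (y u) n := by
  have := eq_preimage (σ := fun n => W ((u : ZMod 4) + l + n)) (z := fun n => y (u - 1 + n))
    (b := b) (fun n hn => ?_) n hn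
  · simpa using this
  · have h1 := h (u + n) ⟨by linarith, by have : (n : ℤ) + 1 ≤ b := by exact_mod_cast hn
                                          linarith⟩
    rw [show u + n - 1 = u - 1 + n by ring, show u + n + 1 = u - 1 + (n + 2 : ℕ) by push_cast; ring]
      at h1
    rw [← h1]
    push_cast
    congr 1; ring

lemma word_periodic (W : ZMod 4 → Cell) (c : ZMod 4) (n : ℕ) :
    W (c + ((n + 4 : ℕ) : ZMod 4)) = W (c + n) := by
  congr 2
  push_cast
  rw [show (4 : ZMod 4) = 0 from rfl, add_zero]

/-- The triple `d` occurs in `y` at all the sites of a class modulo 8. -/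
def Recurs (d : Triple) (y : Config) (u : ℤ) (b : ℕ) : Prop :=
  ∃ i : ℕ, ∀ n : ℕ, n % 8 = i % 8 → n + 2 ≤ b + 1 →
    (y (u - 1 + n), y (u - 1 + n + 1), y (u - 1 + n + 2)) = d

lemma recurs_of_exists {W : ZMod 4 → Cell} {l : ZMod 4} {y : Config} {u : ℤ} {b : ℕ} {d : Triple}
    (h : ∀ x ∈ Set.Icc u (u + b - 1), W ((x : ZMod 4) + l) = y (x - 1) + y (x + 1))
    (hi : ∃ i : Fin 8,
    (preimage (fun n => W ((u : ZMod 4) + l + n)) (y (u - 1)) (y u) i,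
      preimage (fun n => W ((u : ZMod 4) + l + n)) (y (u - 1)) (y u) (i + 1),
      preimage (fun n => W ((u : ZMod 4) + l + n)) (y (u - 1)) (y u) (i + 2)) = d) :
    Recurs d y u b := by
  obtain ⟨i, hi⟩ := hi
  refine ⟨i, fun n hn hnb => ?_⟩
  have hper := word_periodic W ((u : ZMod 4) + l)
  rw [show u - 1 + (n : ℤ) + 1 = u - 1 + (n + 1 : ℕ) by push_cast; ring,
    show u - 1 + (n : ℤ) + 2 = u - 1 + (n + 2 : ℕ) by push_cast; ring,
    eq_preimage_word h (by omega), eq_preimage_word h (by omega), eq_preimage_word h hnb,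
    preimage_mod_eight hper _ _ n, preimage_mod_eight hper _ _ (n + 1),
    preimage_mod_eight hper _ _ (n + 2), hn, Nat.add_mod n 1, Nat.add_mod n 2, hn,
    ← Nat.add_mod, ← Nat.add_mod, ← preimage_mod_eight hper, ← preimage_mod_eight hper,
    ← preimage_mod_eight hper]
  exact hi

lemma Forcing.recurs {W : ZMod 4 → Cell} {l : ZMod 4} {y : Config} {u : ℤ} {b : ℕ} {d : Triple}
    (hW : Forcing W d)
    (h : ∀ x ∈ Set.Icc u (u + b - 1), W ((x : ZMod 4) + l) = y (x - 1) + y (x + 1)) :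
    Recurs d y u b := recurs_of_exists h (hW _ _ _)

lemma word01_recurs {l : ZMod 4} {y : Config} {u : ℤ} {b ℓ : ℕ} {d : Triple} {A : Set ℤ}
    (hd : d = (0, 0, 1) ∨ d = (1, 0, 0)) (hb : 1 ≤ b) (hℓ : ℓ ≤ b)
    (hA : Set.Icc u (u + b - 1) ⊆ A) (hy : ¬ Coincides y A orbit0111 ℓ)
    (h : ∀ x ∈ Set.Icc u (u + b - 1), word01 ((x : ZMod 4) + l) = y (x - 1) + y (x + 1)) :
    Recurs d y u b := by
  rcases word01_dichotomy hd ((u : ZMod 4) + l) (y (u - 1)) (y u) with h1 | ⟨l', hl'⟩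
  · exact recurs_of_exists h h1
  · exfalso
    apply hy
    have hb' : (1 : ℤ) ≤ b := by exact_mod_cast hb
    have hℓ' : (ℓ : ℤ) ≤ b := by exact_mod_cast hℓ
    refine ⟨u, u + b - 1, by linarith, hA, by linarith,
      fun x => word0111 ((x : ZMod 4) + (l' - (u - 1 : ℤ))), ⟨_, fun x => rfl⟩, fun x hx => ?_⟩
    obtain ⟨n, hn⟩ := Int.eq_ofNat_of_zero_le (show 0 ≤ x - (u - 1) by linarith [hx.1])
    have hx' : x = u - 1 + n := by linarith
    have hnb : n ≤ b + 1 := by have := hx.2; omega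
    subst hx'
    rw [eq_preimage_word h hnb, preimage_mod_eight (word_periodic word01 _),
      hl' ⟨n % 8, Nat.mod_lt _ (by norm_num)⟩]
    have h8 : ((n % 8 : ℕ) : ZMod 4) = n := by
      rw [ZMod.natCast_eq_natCast_iff']; omega
    simp only [h8]
    congr 1; push_cast; ring

/-- A 2-periodic sequence which is not dangerous vanishes. -/
lemma eq_zero_of_periodic {y : Config} {u : ℤ} {b ℓ : ℕ} {A : Set ℤ} (hb : 1 ≤ b) (hℓ : ℓ ≤ b)
    (hA : Set.Icc u (u + b - 1) ⊆ A) (hy : ¬ Coincides y A (orbit1 ∪ orbit01) ℓ)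
    (h : ∀ x ∈ Set.Icc u (u + b - 1), 0 = y (x - 1) + y (x + 1)) :
    ∀ x ∈ Set.Icc u (u + b - 1), y x = 0 := by
  have hpre : ∀ n ≤ b + 1, y (u - 1 + n) = if n % 2 = 0 then y (u - 1) else y u := by
    intro n hn
    rw [eq_preimage_word (W := fun _ => 0) (l := 0) h hn]
    have : ∀ n, preimage (fun _ => 0) (y (u - 1)) (y u) n =
        if n % 2 = 0 then y (u - 1) else y u := by
      intro n
      induction n using Nat.twoStepInduction with
      | zero => rfl
      | one => rfl
      | more n ih _ => rw [preimage, ih, add_zero]; simp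
    exact this n
  by_contra hcon
  push Not at hcon
  apply hy
  have hb' : (1 : ℤ) ≤ b := by exact_mod_cast hb
  have hℓ' : (ℓ : ℤ) ≤ b := by exact_mod_cast hℓ
  have h2 : ∀ c : Cell, c = 0 ∨ c = 1 := by decide
  have key : ∃ σ ∈ orbit1 ∪ orbit01, ∀ n : ℕ,
      σ (u - 1 + n) = if n % 2 = 0 then y (u - 1) else y u := by
    have hodd : ∀ n : ℕ, (((u - 1 + n : ℤ)) : ZMod 2) + (-(u - 1 : ℤ)) =
        if n % 2 = 0 then 0 else 1 := by
      intro n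
      have : (((u - 1 + n : ℤ)) : ZMod 2) + (-(u - 1 : ℤ)) = ((n % 2 : ℕ) : ZMod 2) := by
        push_cast; simp; ring
      rw [this]
      rcases Nat.mod_two_eq_zero_or_one n with h | h <;> simp [h]
    rcases h2 (y (u - 1)) with hα | hα <;> rcases h2 (y u) with hβ | hβ
    · exfalso
      obtain ⟨x, hx, hne⟩ := hcon
      obtain ⟨n, hn⟩ := Int.eq_ofNat_of_zero_le (show 0 ≤ x - (u - 1) by linarith [hx.1])
      have hx' : x = u - 1 + n := by linarith
      apply hne
      rw [hx', hpre n (by have := hx.2; omega), hα, hβ, ite_self]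
    · refine ⟨fun x => (![0, 1] : Fin 2 → Cell) ((x : ZMod 2) + (-(u - 1 : ℤ) : ZMod 2)),
        Or.inr ⟨_, fun _ => rfl⟩, fun n => ?_⟩
      simp only []
      rw [hodd n, hα, hβ]
      split_ifs <;> rfl
    · refine ⟨fun x => (![0, 1] : Fin 2 → Cell) ((x : ZMod 2) + (-(u - 1 : ℤ) + 1 : ZMod 2)),
        Or.inr ⟨_, fun _ => rfl⟩, fun n => ?_⟩
      simp only []
      rw [← add_assoc, hodd n, hα, hβ]
      split_ifs <;> rfl
    · refine ⟨fun _ => 1, Or.inl ⟨0, fun x => ?_⟩, fun n => by rw [hα, hβ, ite_self]⟩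
      have h1 : ∀ c : ZMod 1, 1 = (![1] : Fin 1 → Cell) c := fun c => by
        rw [Subsingleton.elim c 0]; rfl
      exact h1 _
  obtain ⟨σ, hσ, hσn⟩ := key
  refine ⟨u, u + b - 1, by linarith, hA, by linarith, σ, hσ, fun x hx => ?_⟩
  obtain ⟨n, hn⟩ := Int.eq_ofNat_of_zero_le (show 0 ≤ x - (u - 1) by linarith [hx.1])
  have hx' : x = u - 1 + n := by linarith
  rw [hx', hσn, hpre n (by have := hx.2; omega)]

end Words

/-! ### Dangerous words are unlikely to appear in a nice environment. -/

section Danger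

lemma prod_le_pow_card {S T : Finset ℤ} (hT : T ⊆ S) {f : ℤ → ℝ} {c : ℝ}
    (h0 : ∀ x ∈ S, 0 ≤ f x) (h1 : ∀ x ∈ S, f x ≤ 1) (hc : ∀ x ∈ T, f x ≤ c) :
    ∏ x ∈ S, f x ≤ c ^ T.card := by
  rw [← Finset.prod_sdiff hT]
  calc _ ≤ 1 * ∏ x ∈ T, f x := by
        refine mul_le_mul_of_nonneg_right ?_ (Finset.prod_nonneg fun x hx => h0 x (hT hx))
        exact Finset.prod_le_one (fun x hx => h0 x (Finset.mem_sdiff.1 hx).1)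
          fun x hx => h1 x (Finset.mem_sdiff.1 hx).1
    _ ≤ c ^ T.card := by
        rw [one_mul, ← Finset.prod_const]
        exact Finset.prod_le_prod (fun x hx => h0 x (hT hx)) hc

variable {Ω : Type*} [MeasurableSpace Ω] {P : Measure Ω} {p : ℝ} {F : ℤ → ℕ → Ω → LocalRule}
  [IsProbabilityMeasure P]

/-- The bound on the probability that one step of the flip/preserve process produces a given
sequence without any long noiseless stretch. -/
noncomputable def stepErr (p ε : ℝ) (m M : ℕ) : ℝ :=
  (2 * (1 - p)) ^ m + Real.exp (-(ε * (M / 9)))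

lemma stepErr_nonneg (hp : p ≤ 1) (ε : ℝ) (m M : ℕ) : 0 ≤ stepErr p ε m M :=
  add_nonneg (pow_nonneg (by linarith) _) (Real.exp_pos _).le

/-- If each block contains a deviation from the additive rule, then the outcome is unlikely. -/
lemma IsBasicCoupling.prod_outProb_le_of_mismatch (hF : IsBasicCoupling P p F) {ξ ζ : Config}
    {t : ℕ} {ω : Ω} {τ : Config} {g : ℤ} {b m ℓ : ℕ} (hmb : m * b ≤ ℓ)
    (h : ∀ i < m, ∃ x ∈ Set.Icc (g + i * b) (g + i * b + b - 1),
      τ x ≠ Y F ξ ζ t ω (x - 1) + Y F ξ ζ t ω (x + 1)) :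
    ∏ x ∈ Finset.Icc g (g + ℓ - 1), outProb P F (localState F ξ ζ t x ω) (τ x) ≤
      (2 * (1 - p)) ^ m := by
  choose! f hf hne using h
  have hinj : Set.InjOn f (Finset.range m : Set ℕ) := by
    intro i hi j hj hij
    have hi' := hf i (by simpa using hi)
    have hj' := hf j (by simpa using hj)
    rw [hij] at hi'
    rcases lt_trichotomy i j with hlt | heq | hlt
    · exfalso
      have : ((i : ℤ) + 1) * b ≤ j * b :=
        mul_le_mul_of_nonneg_right (by exact_mod_cast hlt) (by positivity)
      linarith [hi'.2, hj'.1]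
    · exact heq
    · exfalso
      have : ((j : ℤ) + 1) * b ≤ i * b :=
        mul_le_mul_of_nonneg_right (by exact_mod_cast hlt) (by positivity)
      linarith [hi'.1, hj'.2]
  have hcard : ((Finset.range m).image f).card = m := by
    rw [Finset.card_image_of_injOn hinj, Finset.card_range]
  rw [← hcard]
  have hmb' : (m * b : ℤ) ≤ ℓ := by exact_mod_cast hmb
  refine prod_le_pow_card (fun x hx => ?_) (fun _ _ => hF.outProb_nonneg _ _)
    (fun _ _ => hF.outProb_le_one _ _) (fun x hx => ?_)
  · obtain ⟨i, hi, rfl⟩ := Finset.mem_image.1 hx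
    have hi' := Finset.mem_range.1 hi
    have h1 := hf i hi'
    have h2 : ((i : ℤ) + 1) * b ≤ m * b :=
      mul_le_mul_of_nonneg_right (by exact_mod_cast hi') (by positivity)
    have h3 : (0 : ℤ) ≤ i * b := by positivity
    exact Finset.mem_Icc.2 ⟨by linarith [h1.1], by linarith [h1.2]⟩
  · obtain ⟨i, hi, rfl⟩ := Finset.mem_image.1 hx
    exact hF.outProb_le_of_ne (hne i (Finset.mem_range.1 hi))

/-- A long stretch on which the process must follow the additive rule, although the triple `d`
occurs at all the sites of a class modulo 8, is unlikely in a nice environment. -/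
lemma IsBasicCoupling.prod_outProb_le_of_recurs (hF : IsBasicCoupling P p F) {ξ ζ : Config}
    {t : ℕ} {ω : Ω} {τ : Config} {abc d : Triple} (hd : d = (0, 0, 1) ∨ d = (1, 0, 0))
    (hρ : outProb P F (abc, d) 1 = 1 - eps P F) {S : Finset ℤ} {u : ℤ} {b M : ℕ}
    (hM0 : 1 ≤ M) (hM : M * 8 + 2 ≤ b) (hS : Finset.Icc u (u + b - 1) ⊆ S)
    (hτ : ∀ x ∈ Set.Icc u (u + b - 1), τ x = Y F ξ ζ t ω (x - 1) + Y F ξ ζ t ω (x + 1))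
    (hnice : IsNice abc (X F ξ t ω) u (u + b - 1)) (hrec : Recurs d (Y F ξ ζ t ω) u b) :
    ∏ x ∈ S, outProb P F (localState F ξ ζ t x ω) (τ x) ≤ Real.exp (-(eps P F * (M / 9))) := by
  obtain ⟨i, hi⟩ := hrec
  have hM' : (M * 8 + 2 : ℤ) ≤ b := by exact_mod_cast hM
  have hM0' : (1 : ℤ) ≤ M := by exact_mod_cast hM0
  -- The representative in {1,…,8} of the class along which `d` recurs.
  set r : ℤ := (u - 1 + i - 1) % 8 + 1 with hr
  have hr1 : r ∈ Finset.Icc (1 : ℤ) 8 := Finset.mem_Icc.2 (by omega)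
  have hri : r ≡ u - 1 + i [ZMOD 8] := by
    rw [hr]; unfold Int.ModEq; omega
  have hn := hnice r hr1
  set W := (Finset.Icc u (u + b - 1 - 2)).filter fun x => x ≡ r [ZMOD 8] ∧
    (X F ξ t ω x, X F ξ t ω (x + 1), X F ξ t ω (x + 2)) = abc with hW
  have hV : M ≤ ((Finset.Icc u (u + b - 1 - 2)).filter fun x => x ≡ r [ZMOD 8]).card :=
    le_card_residue (g := u) (h := u + b - 1 - 2) (q := 8) (M := M) (r := r) (by norm_num)
      (by push_cast; linarith)
  have hVpos : (0 : ℝ) <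
      ((Finset.Icc u (u + b - 1 - 2)).filter fun x => x ≡ r [ZMOD 8]).card := by
    exact_mod_cast lt_of_lt_of_le hM0 hV
  rw [le_div_iff₀ hVpos] at hn
  have hWM : (M : ℝ) / 9 ≤ W.card := by
    have : (M : ℝ) ≤ ((Finset.Icc u (u + b - 1 - 2)).filter fun x => x ≡ r [ZMOD 8]).card := by
      exact_mod_cast hV
    linarith
  have hWmem : ∀ x ∈ W, x + 1 ∈ Finset.Icc u (u + b - 1) ∧
      outProb P F (localState F ξ ζ t (x + 1) ω) (τ (x + 1)) = 1 - eps P F := by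
    intro x hx
    obtain ⟨hx1, hx2, hx3⟩ := Finset.mem_filter.1 hx
    have hx1' := Finset.mem_Icc.1 hx1
    refine ⟨Finset.mem_Icc.2 ⟨by linarith, by linarith⟩, ?_⟩
    obtain ⟨n, hn⟩ := Int.eq_ofNat_of_zero_le (show 0 ≤ x - (u - 1) by linarith)
    have hxn : x = u - 1 + n := by linarith
    have hmod : n % 8 = i % 8 := by
      have : (u - 1 + n : ℤ) ≡ u - 1 + i [ZMOD 8] := by rw [← hxn]; exact hx2.trans hri
      have := Int.ModEq.add_left_cancel' _ this
      unfold Int.ModEq at this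
      omega
    have hd' := hi n hmod (by omega)
    rw [← hxn] at hd'
    have hloc : localState F ξ ζ t (x + 1) ω = (abc, d) := by
      simp only [localState, nb, add_sub_cancel_right, show x + 1 + 1 = x + 2 by ring, hx3, hd']
    have hτx := hτ (x + 1) ⟨by linarith, by linarith⟩
    rw [add_sub_cancel_right, show x + 1 + 1 = x + 2 by ring] at hτx
    -- The outer entries of 001 and of 100 sum to 1, so the additive outcome required here is the
    -- one of probability 1-ε.
    have h1 : τ (x + 1) = 1 := by
      rw [hτx]
      rw [Prod.ext_iff, Prod.ext_iff] at hd'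
      obtain ⟨e1, -, e3⟩ := hd'
      simp only at e1 e3
      rw [e1, e3]
      rcases hd with rfl | rfl <;> decide
    rw [hloc, h1, hρ]
  have hcard : (W.image (· + 1)).card = W.card :=
    Finset.card_image_of_injective _ (add_left_injective 1)
  have hε0 : 0 ≤ 1 - eps P F := by rw [← hρ]; exact hF.outProb_nonneg _ _
  calc _ ≤ (1 - eps P F) ^ (W.image (· + 1)).card := by
        refine prod_le_pow_card (fun y hy => ?_) (fun _ _ => hF.outProb_nonneg _ _)
          (fun _ _ => hF.outProb_le_one _ _) (fun y hy => ?_)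
        · obtain ⟨x, hx, rfl⟩ := Finset.mem_image.1 hy
          exact hS (hWmem x hx).1
        · obtain ⟨x, hx, rfl⟩ := Finset.mem_image.1 hy
          exact (hWmem x hx).2.le
    _ ≤ Real.exp (-eps P F) ^ W.card := by
        rw [hcard]
        refine pow_le_pow_left₀ hε0 ?_ _
        linarith [Real.add_one_le_exp (-eps P F)]
    _ = Real.exp (W.card * -eps P F) := by rw [Real.exp_nat_mul]
    _ ≤ _ := by
        apply Real.exp_le_exp.2
        have hε : 0 ≤ eps P F := by
          have := hF.outProb_le_one (abc, d) 1
          linarith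
        nlinarith

/-- In a nice environment, a given word is unlikely to appear, as long as its preimages contain
the triple `d`. -/
lemma IsBasicCoupling.measureReal_word_le (hF : IsBasicCoupling P p F) (hp : p ≤ 1)
    (ξ ζ : Config) (t : ℕ)
    {abc d : Triple} (hd : d = (0, 0, 1) ∨ d = (1, 0, 0))
    (hρ : outProb P F (abc, d) 1 = 1 - eps P F) {ℓ₃ b m M ℓ : ℕ} {A : Set ℤ} {good : Config → Prop}
    {W : ZMod 4 → Cell} {l : ZMod 4} {g : ℤ} (hM0 : 1 ≤ M) (hM : M * 8 + 2 ≤ b)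
    (hmb : m * b ≤ ℓ) (hℓ₃ : ℓ₃ ≤ b) (hgA : Set.Icc g (g + ℓ - 1) ⊆ A)
    (hgood : ∀ (y : Config) (u : ℤ), good y → Set.Icc u (u + b - 1) ⊆ A →
      (∀ x ∈ Set.Icc u (u + b - 1), W ((x : ZMod 4) + l) = y (x - 1) + y (x + 1)) →
      Recurs d y u b) :
    P.real {ω | IsEllNice abc ℓ₃ (X F ξ t ω) A ∧ good (Y F ξ ζ t ω) ∧
      ∀ x ∈ Set.Icc g (g + ℓ - 1), Y F ξ ζ (t + 1) ω x = W ((x : ZMod 4) + l)} ≤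
      stepErr p (eps P F) m M := by
  have hp2 : 0 ≤ (2 * (1 - p)) ^ m := pow_nonneg (by linarith) _
  refine le_trans (measureReal_mono ?_) (hF.step_le_of_prod_le ξ ζ (t := t)
    (stepErr_nonneg hp (eps P F) m M) (Finset.Icc g (g + ℓ - 1))
    (fun x => W ((x : ZMod 4) + l)))
  rintro ω ⟨hnice, hg, hY⟩
  refine ⟨?_, fun x hx => hY x (by simpa using hx)⟩
  -- Either every block contains a deviation, which costs (2(1-p))^m, or some block is noiseless and
  -- the triple `d` recurs in the previous state there.
  by_cases hmis : ∀ i < m, ∃ x ∈ Set.Icc (g + i * b) (g + i * b + b - 1),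
      W ((x : ZMod 4) + l) ≠ Y F ξ ζ t ω (x - 1) + Y F ξ ζ t ω (x + 1)
  · refine (hF.prod_outProb_le_of_mismatch (τ := fun x => W ((x : ZMod 4) + l)) hmb hmis).trans ?_
    exact le_add_of_nonneg_right (Real.exp_pos _).le
  · push Not at hmis
    obtain ⟨i, him, hmatch⟩ := hmis
    have hb1 : (1 : ℤ) ≤ b := by have : 1 ≤ b := by omega
                                 exact_mod_cast this
    have h2 : ((i : ℤ) + 1) * b ≤ m * b :=
      mul_le_mul_of_nonneg_right (by exact_mod_cast him) (by positivity)
    have h3 : (0 : ℤ) ≤ i * b := by positivity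
    have hmb' : (m * b : ℤ) ≤ ℓ := by exact_mod_cast hmb
    have hℓ₃' : (ℓ₃ : ℤ) ≤ b := by exact_mod_cast hℓ₃
    have hsub : Set.Icc (g + i * b) (g + i * b + b - 1) ⊆ Set.Icc g (g + ℓ - 1) :=
      Set.Icc_subset_Icc (by linarith) (by linarith)
    refine (hF.prod_outProb_le_of_recurs (τ := fun x => W ((x : ZMod 4) + l)) hd hρ
      (u := g + i * b) (b := b) hM0 hM
      (fun x hx => ?_) hmatch ?_ (hgood _ _ hg (hsub.trans hgA) hmatch)).trans
      (le_add_of_nonneg_left hp2)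
    · exact Finset.mem_Icc.2 (hsub (Finset.mem_Icc.1 hx))
    · exact hnice _ _ (by linarith) (hsub.trans hgA) (by linarith)

/-- A coincidence with a word yields a coincidence on an interval of the exact length. -/
lemma exists_of_coincides {y : Config} {A₁ A₂ : ℤ} {S : Set Config} {ℓ : ℕ}
    {W : ZMod 4 → Cell}
    (hS : ∀ σ ∈ S, ∃ l : ZMod 4, ∀ x : ℤ, σ x = W ((x : ZMod 4) + l))
    (h : Coincides y (Set.Icc A₁ A₂) S ℓ) :
    ∃ g ∈ Finset.Icc A₁ A₂, ∃ l : ZMod 4, Set.Icc g (g + ℓ - 1) ⊆ Set.Icc A₁ A₂ ∧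
      ∀ x ∈ Set.Icc g (g + ℓ - 1), y x = W ((x : ZMod 4) + l) := by
  obtain ⟨g, k, hgk, hsub, hlen, σ, hσ, hy⟩ := h
  obtain ⟨l, hl⟩ := hS σ hσ
  have hss : Set.Icc g (g + ℓ - 1) ⊆ Set.Icc g k := Set.Icc_subset_Icc le_rfl (by linarith)
  exact ⟨g, Finset.mem_Icc.2 (hsub (Set.left_mem_Icc.2 hgk)), l, hss.trans hsub,
    fun x hx => by rw [hy x (hss hx), hl]⟩

/-- Union bound over the starting point and the four translates. The predicate `good` carries what
is known of the previous state, so as to discard the preimages that avoid `d`. -/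
lemma IsBasicCoupling.measureReal_coincides_le (hF : IsBasicCoupling P p F) (hp : p ≤ 1)
    (ξ ζ : Config) (t : ℕ)
    {abc d : Triple} (hd : d = (0, 0, 1) ∨ d = (1, 0, 0))
    (hρ : outProb P F (abc, d) 1 = 1 - eps P F) {ℓ₃ b m M ℓ : ℕ} {A₁ A₂ : ℤ}
    {good : Config → Prop} {S : Set Config}
    {W : ZMod 4 → Cell} (hM0 : 1 ≤ M) (hM : M * 8 + 2 ≤ b)
    (hmb : m * b ≤ ℓ) (hℓ₃ : ℓ₃ ≤ b)
    (hS : ∀ σ ∈ S, ∃ l : ZMod 4, ∀ x : ℤ, σ x = W ((x : ZMod 4) + l))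
    (hgood : ∀ (y : Config) (u : ℤ) (l : ZMod 4), good y → Set.Icc u (u + b - 1) ⊆ Set.Icc A₁ A₂ →
      (∀ x ∈ Set.Icc u (u + b - 1), W ((x : ZMod 4) + l) = y (x - 1) + y (x + 1)) →
      Recurs d y u b) :
    P.real {ω | IsEllNice abc ℓ₃ (X F ξ t ω) (Set.Icc A₁ A₂) ∧ good (Y F ξ ζ t ω) ∧
      Coincides (Y F ξ ζ (t + 1) ω) (Set.Icc A₁ A₂) S ℓ} ≤
      (A₂ - A₁ + 1).toNat * 4 * stepErr p (eps P F) m M := by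
  set E : ℤ × ZMod 4 → Set Ω := fun i =>
    {ω | Set.Icc i.1 (i.1 + ℓ - 1) ⊆ Set.Icc A₁ A₂ ∧
      IsEllNice abc ℓ₃ (X F ξ t ω) (Set.Icc A₁ A₂) ∧ good (Y F ξ ζ t ω) ∧
      ∀ x ∈ Set.Icc i.1 (i.1 + ℓ - 1), Y F ξ ζ (t + 1) ω x = W ((x : ZMod 4) + i.2)} with hE
  have hsub : {ω | IsEllNice abc ℓ₃ (X F ξ t ω) (Set.Icc A₁ A₂) ∧ good (Y F ξ ζ t ω) ∧
      Coincides (Y F ξ ζ (t + 1) ω) (Set.Icc A₁ A₂) S ℓ} ⊆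
      ⋃ i ∈ Finset.Icc A₁ A₂ ×ˢ (Finset.univ : Finset (ZMod 4)), E i := by
    rintro ω ⟨hn, hg, hc⟩
    obtain ⟨g, hgA, l, hsubA, hy⟩ := exists_of_coincides hS hc
    exact Set.mem_biUnion (x := (g, l))
      (Finset.mem_coe.2 (Finset.mem_product.2 ⟨hgA, Finset.mem_univ _⟩)) ⟨hsubA, hn, hg, hy⟩
  calc _ ≤ _ := measureReal_mono hsub (measure_ne_top _ _)
    _ ≤ ∑ i ∈ Finset.Icc A₁ A₂ ×ˢ (Finset.univ : Finset (ZMod 4)), P.real (E i) :=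
        measureReal_biUnion_finset_le _ _
    _ ≤ ∑ i ∈ Finset.Icc A₁ A₂ ×ˢ (Finset.univ : Finset (ZMod 4)), stepErr p (eps P F) m M := by
        refine Finset.sum_le_sum fun i _ => ?_
        by_cases hA : Set.Icc i.1 (i.1 + ℓ - 1) ⊆ Set.Icc A₁ A₂
        · exact (measureReal_mono fun ω hω => hω.2).trans (hF.measureReal_word_le hp ξ ζ t hd hρ
            hM0 hM hmb hℓ₃ hA fun y u => hgood y u i.2)
        · have : E i = ∅ := by
            ext ω; simp only [hE, Set.mem_ofPred_eq, Set.mem_empty_iff_false, iff_false]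
            exact fun h => hA h.1
          rw [this]; simpa using stepErr_nonneg hp _ _ _
    _ = _ := by
        rw [Finset.sum_const, Finset.card_product, nsmul_eq_mul, Int.card_Icc,
          show A₂ + 1 - A₁ = A₂ - A₁ + 1 by ring]
        simp [ZMod.card]

lemma Coincides.union {y : Config} {A : Set ℤ} {S S' : Set Config} {ℓ : ℕ}
    (h : Coincides y A (S ∪ S') ℓ) : Coincides y A S ℓ ∨ Coincides y A S' ℓ := by
  obtain ⟨g, k, hgk, hsub, hlen, σ, hσ | hσ, hy⟩ := h
  · exact Or.inl ⟨g, k, hgk, hsub, hlen, σ, hσ, hy⟩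
  · exact Or.inr ⟨g, k, hgk, hsub, hlen, σ, hσ, hy⟩

/-- In a nice environment, the pattern `0111` is unlikely to appear on a long interval. -/
lemma IsBasicCoupling.measureReal_coincides0111_le (hF : IsBasicCoupling P p F) (hp : p ≤ 1)
    (ξ ζ : Config) (t : ℕ) {abc : Triple} (habc : qMax P F abc = eps P F)
    {ℓ₂ ℓ₃ b m M : ℕ} (hM0 : 1 ≤ M) (hM : M * 8 + 2 ≤ b) (hmb : m * b ≤ ℓ₂) (hℓ₃ : ℓ₃ ≤ b)
    (A₁ A₂ : ℤ) :
    P.real {ω | IsEllNice abc ℓ₃ (X F ξ t ω) (Set.Icc A₁ A₂) ∧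
      Coincides (Y F ξ ζ (t + 1) ω) (Set.Icc A₁ A₂) orbit0111 ℓ₂} ≤
      (A₂ - A₁ + 1).toNat * 4 * stepErr p (eps P F) m M := by
  obtain ⟨d, hd, hρ⟩ := hF.exists_direction habc
  have := hF.measureReal_coincides_le hp ξ ζ t hd hρ (good := fun _ => True) (S := orbit0111)
    (W := word0111) (A₁ := A₁) (A₂ := A₂) hM0 hM hmb hℓ₃ (fun σ hσ => mem_orbit0111.1 hσ)
    (fun y u l _ _ h => (forcing_word0111 hd).recurs h)
  simpa using this

/-- In a nice environment, and in the absence of the pattern `0111`, the patterns `1` and `01` are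
unlikely to appear on a long interval. -/
lemma IsBasicCoupling.measureReal_coincides01_le (hF : IsBasicCoupling P p F) (hp : p ≤ 1)
    (ξ ζ : Config) (t : ℕ) {abc : Triple} (habc : qMax P F abc = eps P F)
    {ℓ₁ ℓ₂ ℓ₃ b m M : ℕ} (hM0 : 1 ≤ M) (hM : M * 8 + 2 ≤ b) (hmb : m * b ≤ ℓ₁) (hℓ₃ : ℓ₃ ≤ b)
    (hℓ₂ : ℓ₂ ≤ b) (A₁ A₂ : ℤ) :
    P.real {ω | IsEllNice abc ℓ₃ (X F ξ t ω) (Set.Icc A₁ A₂) ∧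
      ¬ Coincides (Y F ξ ζ t ω) (Set.Icc A₁ A₂) orbit0111 ℓ₂ ∧
      Coincides (Y F ξ ζ (t + 1) ω) (Set.Icc A₁ A₂) (orbit1 ∪ orbit01) ℓ₁} ≤
      (A₂ - A₁ + 1).toNat * 8 * stepErr p (eps P F) m M := by
  obtain ⟨d, hd, hρ⟩ := hF.exists_direction habc
  have h1 := hF.measureReal_coincides_le hp ξ ζ t hd hρ
    (good := fun y => ¬ Coincides y (Set.Icc A₁ A₂) orbit0111 ℓ₂) (S := orbit1)
    (W := word1) (A₁ := A₁) (A₂ := A₂) hM0 hM hmb hℓ₃ (fun σ hσ => ⟨0, mem_orbit1 hσ⟩)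
    (fun y u l _ _ h => (forcing_word1 hd).recurs h)
  have h2 := hF.measureReal_coincides_le hp ξ ζ t hd hρ
    (good := fun y => ¬ Coincides y (Set.Icc A₁ A₂) orbit0111 ℓ₂) (S := orbit01)
    (W := word01) (A₁ := A₁) (A₂ := A₂) hM0 hM hmb hℓ₃ (fun σ hσ => mem_orbit01 hσ)
    (fun y u l hy hA h => word01_recurs hd (by omega) hℓ₂ hA hy h)
  refine (measureReal_mono ?_).trans ((measureReal_union_le _ _).trans
    ((add_le_add h1 h2).trans (by linarith)))
  rintro ω ⟨hn, hy, hc⟩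
  rcases hc.union with h | h
  · exact Or.inl ⟨hn, hy, h⟩
  · exact Or.inr ⟨hn, hy, h⟩

end Danger

/-! ### Fronts of empty intervals: failures, losses, births and survivals. -/

section Front

variable {Ω : Type*} [MeasurableSpace Ω]

/-- The flip/preserve process seen from `o`, in the direction `σ = ±1`. -/
def ray (F : ℤ → ℕ → Ω → LocalRule) (ξ ζ : Config) (o σ : ℤ) (t : ℕ) (ω : Ω) (j : ℤ) : Cell :=
  Y F ξ ζ t ω (o + σ * j)

/-- The first site occupied at time `t` is `j`. -/
def edge (F : ℤ → ℕ → Ω → LocalRule) (ξ ζ : Config) (o σ : ℤ) (t : ℕ) (j : ℤ) : Set Ω :=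
  {ω | (∀ k, 0 ≤ k → k < j → ray F ξ ζ o σ t ω k = 0) ∧ ray F ξ ζ o σ t ω j = 1}

/-- The first occupied site does not move towards the origin. -/
def fail (F : ℤ → ℕ → Ω → LocalRule) (ξ ζ : Config) (o σ : ℤ) (t : ℕ) (j : ℤ) : Set Ω :=
  edge F ξ ζ o σ t j ∩ {ω | ray F ξ ζ o σ (t + 1) ω (j - 1) = 0}

/-- The first occupied site disappears together with the `n` sites beyond it. -/
def loss (F : ℤ → ℕ → Ω → LocalRule) (ξ ζ : Config) (o σ : ℤ) (n t : ℕ) (j : ℤ) : Set Ω :=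
  edge F ξ ζ o σ t j ∩ {ω | ∀ k, j - 1 ≤ k → k < j + n → ray F ξ ζ o σ (t + 1) ω k = 0}

/-- The first occupied site moves towards the origin and gets isolated. -/
def birth (F : ℤ → ℕ → Ω → LocalRule) (ξ ζ : Config) (o σ : ℤ) (n t : ℕ) (j : ℤ) : Set Ω :=
  edge F ξ ζ o σ t j ∩ {ω | ray F ξ ζ o σ (t + 1) ω (j - 1) = 1 ∧
    ∀ k, j ≤ k → k < j + n → ray F ξ ζ o σ (t + 1) ω k = 0}

/-- The isolated site is born and its two fronts move at full speed during `d` steps. -/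
def survival (F : ℤ → ℕ → Ω → LocalRule) (ξ ζ : Config) (o σ : ℤ) (n t : ℕ) (j : ℤ) (d : ℕ) :
    Set Ω :=
  birth F ξ ζ o σ n t j ∩ {ω | ∀ e ≤ d, ray F ξ ζ o σ (t + 1 + e) ω (j - 1 - e) = 1 ∧
    ray F ξ ζ o σ (t + 1 + e) ω (j - 1 + e) = 1}

variable (F : ℤ → ℕ → Ω → LocalRule) (ξ ζ : Config) (o : ℤ) {σ : ℤ}

lemma measurable_ray (o σ : ℤ) (t : ℕ) (j : ℤ) :
    Measurable[past F t] fun ω => ray F ξ ζ o σ t ω j := measurable_Y F ξ ζ t _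

lemma measurableSet_ray_eq (o σ : ℤ) (t : ℕ) (j : ℤ) (v : Cell) :
    MeasurableSet[past F t] {ω | ray F ξ ζ o σ t ω j = v} :=
  measurable_ray F ξ ζ o σ t j (measurableSet_singleton v)

lemma measurableSet_ray_zero (o σ : ℤ) (t : ℕ) (p : ℤ → Prop) :
    MeasurableSet[past F t] {ω | ∀ k, p k → ray F ξ ζ o σ t ω k = 0} := by
  have : {ω | ∀ k, p k → ray F ξ ζ o σ t ω k = 0} =
      ⋂ k : ℤ, ⋂ _ : p k, {ω | ray F ξ ζ o σ t ω k = 0} := by ext ω; simp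
  rw [this]
  exact MeasurableSet.iInter fun k => MeasurableSet.iInter fun _ =>
    measurableSet_ray_eq F ξ ζ o σ t k 0

lemma measurableSet_edge (o σ : ℤ) (t : ℕ) (j : ℤ) :
    MeasurableSet[past F t] (edge F ξ ζ o σ t j) := by
  have h := (measurableSet_ray_zero F ξ ζ o σ t (fun k => 0 ≤ k ∧ k < j)).inter
    (measurableSet_ray_eq F ξ ζ o σ t j 1)
  convert h using 1
  ext ω; simp [edge]

lemma measurableSet_birth (o σ : ℤ) (n t : ℕ) (j : ℤ) :
    MeasurableSet[past F (t + 1)] (birth F ξ ζ o σ n t j) := by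
  have h := (past_mono F t.le_succ _ (measurableSet_edge F ξ ζ o σ t j)).inter
    ((measurableSet_ray_eq F ξ ζ o σ (t + 1) (j - 1) 1).inter
    (measurableSet_ray_zero F ξ ζ o σ (t + 1) (fun k => j ≤ k ∧ k < j + n)))
  convert h using 1
  ext ω; simp [birth]

lemma measurableSet_survival (o σ : ℤ) (n t : ℕ) (j : ℤ) (d : ℕ) :
    MeasurableSet[past F (t + 1 + d)] (survival F ξ ζ o σ n t j d) := by
  have h1 : MeasurableSet[past F (t + 1 + d)] (⋂ e : ℕ, ⋂ _ : e ≤ d,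
      ({ω | ray F ξ ζ o σ (t + 1 + e) ω (j - 1 - e) = 1} ∩
        {ω | ray F ξ ζ o σ (t + 1 + e) ω (j - 1 + e) = 1})) := by
    refine MeasurableSet.iInter fun e => MeasurableSet.iInter fun he => ?_
    exact past_mono F (by omega) _ ((measurableSet_ray_eq F ξ ζ o σ (t + 1 + e) _ 1).inter
      (measurableSet_ray_eq F ξ ζ o σ (t + 1 + e) _ 1))
  have h := (past_mono F (Nat.le_add_right (t + 1) d) _
    (measurableSet_birth F ξ ζ o σ n t j)).inter h1
  convert h using 1
  ext ω; simp [survival]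

lemma edge_unique {o σ : ℤ} {t : ℕ} {j j' : ℤ} (hj : 0 ≤ j) (hj' : 0 ≤ j') {ω : Ω}
    (h : ω ∈ edge F ξ ζ o σ t j) (h' : ω ∈ edge F ξ ζ o σ t j') : j = j' := by
  rcases lt_trichotomy j j' with hlt | heq | hlt
  · exact absurd (h.2.symm.trans (h'.1 j hj hlt)) one_ne_zero
  · exact heq
  · exact absurd (h'.2.symm.trans (h.1 j' hj' hlt)) one_ne_zero

variable {F ξ ζ o}

lemma ray_succ_eq_zero (hσ : σ = 1 ∨ σ = -1) {t : ℕ} {ω : Ω} {j : ℤ}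
    (h0 : ray F ξ ζ o σ t ω (j - 1) = 0) (h1 : ray F ξ ζ o σ t ω j = 0)
    (h2 : ray F ξ ζ o σ t ω (j + 1) = 0) : ray F ξ ζ o σ (t + 1) ω j = 0 := by
  unfold ray at *
  rcases hσ with rfl | rfl
  · refine Y_succ_eq_zero ξ ζ ?_ h1 ?_
    · rw [← h0]; congr 1; ring
    · rw [← h2]; congr 1; ring
  · refine Y_succ_eq_zero ξ ζ ?_ h1 ?_
    · rw [← h2]; congr 1; ring
    · rw [← h0]; congr 1; ring

/-- An empty interval shrinks at speed at most one. -/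
lemma ray_zero_interval (hσ : σ = 1 ∨ σ = -1) {t : ℕ} {ω : Ω} {a c : ℤ}
    (h : ∀ k, a ≤ k → k ≤ c → ray F ξ ζ o σ t ω k = 0) (d : ℕ) :
    ∀ k, a + d ≤ k → k ≤ c - d → ray F ξ ζ o σ (t + d) ω k = 0 := by
  induction d with
  | zero => intro k h1 h2; exact h k (by simpa using h1) (by simpa using h2)
  | succ d ih =>
    intro k h1 h2
    push_cast at h1 h2
    exact ray_succ_eq_zero hσ (ih _ (by linarith) (by linarith)) (ih _ (by linarith) (by linarith))
      (ih _ (by linarith) (by linarith))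

variable {P : Measure Ω} {p : ℝ} [IsProbabilityMeasure P]

/-- A front fails to move with probability at most `ε`. -/
lemma IsBasicCoupling.front_le (hF : IsBasicCoupling P p F) (hσ : σ = 1 ∨ σ = -1) {t : ℕ}
    {H : Set Ω} (hH : MeasurableSet[past F t] H) {j : ℤ}
    (h : ∀ ω ∈ H, ray F ξ ζ o σ t ω j = 0 ∧
      ((ray F ξ ζ o σ t ω (j - 1) = 0 ∧ ray F ξ ζ o σ t ω (j + 1) = 1) ∨
        (ray F ξ ζ o σ t ω (j - 1) = 1 ∧ ray F ξ ζ o σ t ω (j + 1) = 0))) :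
    P.real (H ∩ {ω | ray F ξ ζ o σ (t + 1) ω j = 0}) ≤ eps P F * P.real H := by
  refine hF.step_site_le ξ ζ hH fun ω hω => outProb_zero_le_eps ?_
  obtain ⟨h1, h2⟩ := h ω hω
  unfold ray at h1 h2
  simp only [localState, nb]
  rcases hσ with rfl | rfl
  · rw [show o + 1 * (j - 1) = o + 1 * j - 1 by ring,
      show o + 1 * (j + 1) = o + 1 * j + 1 by ring] at h2
    rcases h2 with ⟨h3, h4⟩ | ⟨h3, h4⟩
    · left; rw [h1, h3, h4]
    · right; rw [h1, h3, h4]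
  · rw [show o + -1 * (j - 1) = o + -1 * j + 1 by ring,
      show o + -1 * (j + 1) = o + -1 * j - 1 by ring] at h2
    rcases h2 with ⟨h3, h4⟩ | ⟨h3, h4⟩
    · right; rw [h1, h3, h4]
    · left; rw [h1, h3, h4]

lemma IsBasicCoupling.fail_le (hF : IsBasicCoupling P p F) (hσ : σ = 1 ∨ σ = -1) {t : ℕ} {j : ℤ}
    (hj : 2 ≤ j) :
    P.real (fail F ξ ζ o σ t j) ≤ eps P F * P.real (edge F ξ ζ o σ t j) := by
  refine hF.front_le hσ (measurableSet_edge F ξ ζ o σ t j) fun ω hω => ?_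
  refine ⟨hω.1 _ (by linarith) (by linarith), Or.inl ⟨hω.1 _ (by linarith) (by linarith), ?_⟩⟩
  rw [sub_add_cancel]; exact hω.2

/-- The first occupied site is unique, so summing over its position costs nothing. -/
lemma IsBasicCoupling.sum_fail_le (hF : IsBasicCoupling P p F) (hσ : σ = 1 ∨ σ = -1) {b : ℕ}
    (hb : 2 ≤ b) (t : ℕ) (R : ℤ) :
    ∑ j ∈ Finset.Icc (b : ℤ) R, P.real (fail F ξ ζ o σ t j) ≤ eps P F := by
  have hb' : (2 : ℤ) ≤ b := by exact_mod_cast hb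
  have hε : 0 ≤ eps P F := by
    refine le_trans ?_ (outProb_zero_le_eps (P := P) (F := F) (n := ((0, 0, 0), (0, 0, 1)))
      (Or.inl rfl))
    exact measureReal_nonneg
  calc _ ≤ ∑ j ∈ Finset.Icc (b : ℤ) R, eps P F * P.real (edge F ξ ζ o σ t j) :=
        Finset.sum_le_sum fun j hj => hF.fail_le hσ (hb'.trans (Finset.mem_Icc.1 hj).1)
    _ = eps P F * P.real (⋃ j ∈ Finset.Icc (b : ℤ) R, edge F ξ ζ o σ t j) := by
        rw [← Finset.mul_sum, measureReal_biUnion_finset]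
        · intro j hj j' hj' hne
          refine Set.disjoint_left.2 fun ω h h' => hne (edge_unique F ξ ζ ?_ ?_ h h')
          · linarith [(Finset.mem_Icc.1 hj).1]
          · linarith [(Finset.mem_Icc.1 hj').1]
        · exact fun j _ => hF.gen_le _ _ (measurableSet_edge F ξ ζ o σ t j)
    _ ≤ eps P F := mul_le_of_le_one_right hε measureReal_le_one

/-- The two outcomes differ only at the site `j - 1`, which sees 001 or 100 and thus takes the value
0 with probability at most ε and 1 with probability at least 1/2. The other factors are common, and
need not be estimated. -/
lemma IsBasicCoupling.loss_le (hF : IsBasicCoupling P p F) (hσ : σ = 1 ∨ σ = -1) {n t : ℕ}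
    {j : ℤ} (hj : 2 ≤ j) (hε : eps P F ≤ 1 / 2) :
    P.real (loss F ξ ζ o σ n t j) ≤ 2 * eps P F * P.real (birth F ξ ζ o σ n t j) := by
  have hinj : Function.Injective fun k : ℤ => o + σ * k := by
    intro a b hab
    rcases hσ with rfl | rfl <;> simpa using hab
  set S₀ : Finset ℤ := (Finset.Ico j (j + n)).image fun k => o + σ * k with hS₀
  set x₀ : ℤ := o + σ * (j - 1) with hx₀
  have hx₀S : x₀ ∉ S₀ := by
    intro hc
    obtain ⟨k, hk, hkx⟩ := Finset.mem_image.1 hc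
    have := hinj hkx
    have := (Finset.mem_Ico.1 hk).1
    linarith
  have h := hF.step_le ξ ζ (measurableSet_edge F ξ ζ o σ t j) (c := 2 * eps P F)
    (S := insert x₀ S₀) (S' := insert x₀ S₀) (τ := fun _ => 0)
    (τ' := fun x => if x = x₀ then 1 else 0) (fun ω hω => ?_)
  · refine le_trans (measureReal_mono ?_) (h.trans (mul_le_mul_of_nonneg_left
      (measureReal_mono ?_) ?_))
    · rintro ω ⟨hω, hz⟩
      refine ⟨hω, fun x hx => ?_⟩
      rcases Finset.mem_insert.1 hx with rfl | hx
      · exact hz _ le_rfl (by have : (0 : ℤ) ≤ n := Int.natCast_nonneg n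
                              linarith)
      · obtain ⟨k, hk, rfl⟩ := Finset.mem_image.1 hx
        have := Finset.mem_Ico.1 hk
        exact hz k (by linarith) this.2
    · rintro ω ⟨hω, hz⟩
      refine ⟨hω, ?_, fun k hk1 hk2 => ?_⟩
      · have := hz x₀ (Finset.mem_insert_self _ _)
        exact this.trans (if_pos rfl)
      · have hmem : o + σ * k ∈ S₀ := Finset.mem_image_of_mem _ (Finset.mem_Ico.2 ⟨hk1, hk2⟩)
        have := hz _ (Finset.mem_insert_of_mem hmem)
        exact this.trans (if_neg (ne_of_mem_of_not_mem hmem hx₀S))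
    · exact mul_nonneg (by norm_num) (le_trans measureReal_nonneg
        (outProb_zero_le_eps (P := P) (F := F) (n := ((0, 0, 0), (0, 0, 1))) (Or.inl rfl)))
  · have hcongr : ∏ x ∈ S₀, outProb P F (localState F ξ ζ t x ω) (if x = x₀ then 1 else 0) =
        ∏ x ∈ S₀, outProb P F (localState F ξ ζ t x ω) 0 :=
      Finset.prod_congr rfl fun x hx => by rw [if_neg (ne_of_mem_of_not_mem hx hx₀S)]
    rw [Finset.prod_insert hx₀S, Finset.prod_insert hx₀S, if_pos rfl, hcongr]
    have hle : outProb P F (localState F ξ ζ t x₀ ω) 0 ≤ eps P F := by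
      apply outProb_zero_le_eps
      have h1 := hω.1 (j - 1) (by linarith) (by linarith)
      have h2 := hω.1 (j - 2) (by linarith) (by linarith)
      have h3 := hω.2
      unfold ray at h1 h2 h3
      simp only [localState, nb, hx₀]
      rcases hσ with rfl | rfl
      · left
        rw [show o + 1 * (j - 1) - 1 = o + 1 * (j - 2) by ring,
          show o + 1 * (j - 1) + 1 = o + 1 * j by ring, h1, h2, h3]
      · right
        rw [show o + -1 * (j - 1) + 1 = o + -1 * (j - 2) by ring,
          show o + -1 * (j - 1) - 1 = o + -1 * j by ring, h1, h2, h3]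
    have hadd := hF.outProb_add (localState F ξ ζ t x₀ ω)
    have h0 := hF.outProb_nonneg (localState F ξ ζ t x₀ ω) 0
    have hprod : 0 ≤ ∏ x ∈ S₀, outProb P F (localState F ξ ζ t x ω) 0 :=
      Finset.prod_nonneg fun _ _ => hF.outProb_nonneg _ _
    rw [← mul_assoc]
    refine mul_le_mul_of_nonneg_right ?_ hprod
    nlinarith

lemma survival_zero {n t : ℕ} {j : ℤ} :
    survival F ξ ζ o σ n t j 0 = birth F ξ ζ o σ n t j := by
  refine Set.inter_eq_left.2 fun ω hω e he => ?_
  obtain rfl : e = 0 := by omega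
  simpa using hω.2.1

/-- Both fronts of the isolated site still face empty sites: those preceding the edge at time `t`
and the `n` zeros beyond it at time `t + 1`, as these intervals shrink at speed at most one. Each
front then fails with probability at most ε. -/
lemma IsBasicCoupling.survival_succ (hF : IsBasicCoupling P p F) (hσ : σ = 1 ∨ σ = -1)
    {n t d d₀ : ℕ} {j : ℤ} (hd : d + 1 ≤ d₀) (hn : 2 * d₀ ≤ n) (hj : 2 * (d₀ : ℤ) + 2 ≤ j) :
    P.real (survival F ξ ζ o σ n t j d) - 2 * eps P F * P.real (birth F ξ ζ o σ n t j) ≤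
      P.real (survival F ξ ζ o σ n t j (d + 1)) := by
  set H := survival F ξ ζ o σ n t j d with hH
  have hd' : (d : ℤ) + 1 ≤ d₀ := by exact_mod_cast hd
  have hn' : 2 * (d₀ : ℤ) ≤ n := by exact_mod_cast hn
  have hHm := measurableSet_survival F ξ ζ o σ n t j d
  have hleft : ∀ ω ∈ H, ∀ k, 1 + (d : ℤ) ≤ k → k ≤ j - 2 - d →
      ray F ξ ζ o σ (t + 1 + d) ω k = 0 := by
    intro ω hω k h1 h2
    have := ray_zero_interval hσ (t := t) (a := 0) (c := j - 1)
      (fun k hk1 hk2 => hω.1.1.1 k hk1 (by linarith)) (1 + d) k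
    rw [← add_assoc] at this
    exact this (by push_cast; linarith) (by push_cast; linarith)
  have hright : ∀ ω ∈ H, ∀ k, j + (d : ℤ) ≤ k → k ≤ j + n - 1 - d →
      ray F ξ ζ o σ (t + 1 + d) ω k = 0 := by
    intro ω hω
    exact ray_zero_interval hσ (t := t + 1) (a := j) (c := j + n - 1)
      (fun k hk1 hk2 => hω.1.2.2 k hk1 (by linarith)) d
  have h1 := hF.front_le (ξ := ξ) (ζ := ζ) (o := o) hσ hHm (j := j - 2 - d) (fun ω hω =>
    ⟨hleft ω hω _ (by linarith) le_rfl, Or.inl ⟨hleft ω hω _ (by linarith) (by linarith), by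
      rw [show j - 2 - (d : ℤ) + 1 = j - 1 - d by ring]; exact (hω.2 d le_rfl).1⟩⟩)
  have h2 := hF.front_le (ξ := ξ) (ζ := ζ) (o := o) hσ hHm (j := j + d) (fun ω hω =>
    ⟨hright ω hω _ le_rfl (by linarith), Or.inr ⟨by
      rw [show j + (d : ℤ) - 1 = j - 1 + d by ring]; exact (hω.2 d le_rfl).2,
      hright ω hω _ (by linarith) (by linarith)⟩⟩)
  have hsub : H ⊆ survival F ξ ζ o σ n t j (d + 1) ∪
      ((H ∩ {ω | ray F ξ ζ o σ (t + 1 + d + 1) ω (j - 2 - d) = 0}) ∪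
        (H ∩ {ω | ray F ξ ζ o σ (t + 1 + d + 1) ω (j + d) = 0})) := by
    intro ω hω
    by_cases e1 : ray F ξ ζ o σ (t + 1 + d + 1) ω (j - 2 - d) = 0
    · exact Or.inr (Or.inl ⟨hω, e1⟩)
    by_cases e2 : ray F ξ ζ o σ (t + 1 + d + 1) ω (j + d) = 0
    · exact Or.inr (Or.inr ⟨hω, e2⟩)
    left
    refine ⟨hω.1, fun e he => ?_⟩
    rcases Nat.lt_or_ge d e with hlt | hge
    · obtain rfl : e = d + 1 := by omega
      have hc : ∀ c : Cell, c ≠ 0 → c = 1 := by decide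
      rw [← add_assoc]
      constructor
      · rw [← hc _ e1]; congr 1; push_cast; ring
      · rw [← hc _ e2]; congr 1; push_cast; ring
    · exact hω.2 e hge
  have h3 : P.real H ≤ P.real (birth F ξ ζ o σ n t j) := measureReal_mono Set.inter_subset_left
  have hε : 0 ≤ eps P F := le_trans measureReal_nonneg
    (outProb_zero_le_eps (P := P) (F := F) (n := ((0, 0, 0), (0, 0, 1))) (Or.inl rfl))
  have h4 : P.real H ≤ P.real (survival F ξ ζ o σ n t j (d + 1)) +
      (eps P F * P.real H + eps P F * P.real H) :=
    (measureReal_mono hsub).trans ((measureReal_union_le _ _).trans (add_le_add_right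
      ((measureReal_union_le _ _).trans (add_le_add h1 h2)) _))
  nlinarith

/-- Each of the `d₀` steps loses at most a proportion 2ε of the births, and 4εd₀ ≤ 1 leaves half of
them. -/
lemma IsBasicCoupling.birth_le (hF : IsBasicCoupling P p F) (hσ : σ = 1 ∨ σ = -1)
    {n t d₀ : ℕ} {j : ℤ} (hn : 2 * d₀ ≤ n) (hj : 2 * (d₀ : ℤ) + 2 ≤ j)
    (hε : 4 * eps P F * d₀ ≤ 1) :
    P.real (birth F ξ ζ o σ n t j) ≤ 2 * P.real (survival F ξ ζ o σ n t j d₀) := by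
  have h : ∀ d ≤ d₀, P.real (birth F ξ ζ o σ n t j) -
      d * (2 * eps P F * P.real (birth F ξ ζ o σ n t j)) ≤
        P.real (survival F ξ ζ o σ n t j d) := by
    intro d
    induction d with
    | zero => intro _; simp [survival_zero]
    | succ d ih =>
      intro hd
      have h1 := ih (by omega)
      have h2 := hF.survival_succ (ξ := ξ) (ζ := ζ) (o := o) hσ (t := t) hd hn hj
      push_cast
      linarith
  have h1 := h d₀ le_rfl
  have h2 : (0 : ℝ) ≤ P.real (birth F ξ ζ o σ n t j) := measureReal_nonneg
  nlinarith

/-- An isolated site which survives prevents further births. -/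
lemma survival_separated (hσ : σ = 1 ∨ σ = -1) {n t t' d₀ : ℕ} {j j' : ℤ} {b : ℕ}
    (hn : 2 * d₀ ≤ n) (hb : 2 * d₀ + 2 ≤ b) (hj : (b : ℤ) ≤ j) (hj' : (b : ℤ) ≤ j')
    (htt : t < t') (htd : t' ≤ t + d₀) {ω : Ω} (h : ω ∈ survival F ξ ζ o σ n t j d₀)
    (h' : ω ∈ birth F ξ ζ o σ n t' j') : False := by
  obtain ⟨d, rfl⟩ : ∃ d, t' = t + 1 + d := ⟨t' - (t + 1), by omega⟩
  have hd : (d : ℤ) + 1 ≤ d₀ := by have : d + 1 ≤ d₀ := by omega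
                                   exact_mod_cast this
  have hb' : 2 * (d₀ : ℤ) + 2 ≤ b := by exact_mod_cast hb
  have hn' : 2 * (d₀ : ℤ) ≤ n := by exact_mod_cast hn
  have h1 := (h.2 d (by omega)).1
  -- At time `t'`, the first occupied site has to be the near front of the surviving site.
  have hle : j' ≤ j - 1 - d := by
    by_contra hlt
    have := h'.1.1 (j - 1 - d) (by linarith) (by linarith)
    exact one_ne_zero (h1.symm.trans this)
  have hge : j - 1 - d ≤ j' := by
    by_contra hlt
    have h2 := ray_zero_interval hσ (t := t) (a := 0) (c := j - 1)
      (fun k hk1 hk2 => h.1.1.1 k hk1 (by linarith)) (1 + d) j' (by push_cast; linarith)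
      (by push_cast; linarith)
    rw [← add_assoc] at h2
    exact one_ne_zero (h'.1.2.symm.trans h2)
  have hjj : j' = j - 1 - d := le_antisymm hle hge
  -- One step later the far front, at distance `2d + 1 < n` from `j'`, is occupied inside the
  -- stretch that the second birth requires to be empty.
  have h2 := (h.2 (d + 1) (by omega)).2
  have h3 := h'.2.2 (j - 1 + (d + 1 : ℕ)) (by push_cast; linarith) (by push_cast; linarith)
  rw [← add_assoc] at h2
  exact one_ne_zero (h2.symm.trans h3)

/-- Within a window of `d₀ + 1` consecutive times the survival events are disjoint, so each window
contributes at most 1. -/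
lemma IsBasicCoupling.sum_survival_le (hF : IsBasicCoupling P p F) (hσ : σ = 1 ∨ σ = -1)
    {n d₀ b : ℕ} (hn : 2 * d₀ ≤ n) (hb : 2 * d₀ + 2 ≤ b) (R : ℤ) (T : ℕ) :
    ∑ i ∈ Finset.range T ×ˢ Finset.Icc (b : ℤ) R, P.real (survival F ξ ζ o σ n i.1 i.2 d₀) ≤
      (T / (d₀ + 1) + 1 : ℕ) := by
  have hmaps : ∀ i ∈ Finset.range T ×ˢ Finset.Icc (b : ℤ) R,
      i.1 / (d₀ + 1) ∈ Finset.range (T / (d₀ + 1) + 1) := by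
    intro i hi
    have := Finset.mem_range.1 (Finset.mem_product.1 hi).1
    exact Finset.mem_range.2 (Nat.lt_succ_of_le (Nat.div_le_div_right this.le))
  rw [← Finset.sum_fiberwise_of_maps_to hmaps]
  calc _ ≤ ∑ _ ∈ Finset.range (T / (d₀ + 1) + 1), (1 : ℝ) := by
        refine Finset.sum_le_sum fun r _ => ?_
        rw [← measureReal_biUnion_finset]
        · exact measureReal_le_one
        · rintro ⟨t, j⟩ hi ⟨t', j'⟩ hi' hne
          refine Set.disjoint_left.2 fun ω h h' => hne ?_
          simp only [Finset.coe_filter, Finset.mem_product, Finset.mem_range, Finset.mem_Icc,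
            Set.mem_ofPred_eq] at hi hi'
          have hdiv : ∀ a : ℕ, a / (d₀ + 1) = r → (d₀ + 1) * r ≤ a ∧ a < (d₀ + 1) * r + (d₀ + 1) := by
            intro a ha
            have h1 := Nat.div_add_mod a (d₀ + 1)
            have h2 : a % (d₀ + 1) < d₀ + 1 := Nat.mod_lt a (Nat.succ_pos d₀)
            rw [ha] at h1
            constructor <;> omega
          have e1 := hdiv t hi.2
          have e2 := hdiv t' hi'.2
          rcases lt_trichotomy t t' with hlt | rfl | hlt
          · exact (survival_separated hσ hn hb hi.1.2.1 hi'.1.2.1 hlt (by omega) h h'.1).elim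
          · exact congrArg (Prod.mk t) (edge_unique F ξ ζ (by linarith [hi.1.2.1])
              (by linarith [hi'.1.2.1]) h.1.1 h'.1.1)
          · exact (survival_separated hσ hn hb hi'.1.2.1 hi.1.2.1 hlt (by omega) h' h.1).elim
        · exact fun i _ => hF.gen_le _ _ (measurableSet_survival F ξ ζ o σ n i.1 i.2 d₀)
    _ = _ := by simp

/-- Large losses are unlikely. -/
lemma IsBasicCoupling.sum_loss_le (hF : IsBasicCoupling P p F) (hσ : σ = 1 ∨ σ = -1)
    {n d₀ b : ℕ} (hn : 2 * d₀ ≤ n) (hb : 2 * d₀ + 2 ≤ b) (hd₀ : 1 ≤ d₀)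
    (hε : 4 * eps P F * d₀ ≤ 1) (R : ℤ) (T : ℕ) :
    ∑ i ∈ Finset.range T ×ˢ Finset.Icc (b : ℤ) R, P.real (loss F ξ ζ o σ n i.1 i.2) ≤
      4 * eps P F * (T / (d₀ + 1) + 1 : ℕ) := by
  have hε0 : 0 ≤ eps P F := le_trans measureReal_nonneg
    (outProb_zero_le_eps (P := P) (F := F) (n := ((0, 0, 0), (0, 0, 1))) (Or.inl rfl))
  have hd₀' : (1 : ℝ) ≤ d₀ := by exact_mod_cast hd₀
  have hε2 : eps P F ≤ 1 / 2 := by nlinarith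
  have hb' : 2 * (d₀ : ℤ) + 2 ≤ b := by exact_mod_cast hb
  calc _ ≤ ∑ i ∈ Finset.range T ×ˢ Finset.Icc (b : ℤ) R,
        4 * eps P F * P.real (survival F ξ ζ o σ n i.1 i.2 d₀) := by
        refine Finset.sum_le_sum fun i hi => ?_
        have hi' := (Finset.mem_Icc.1 (Finset.mem_product.1 hi).2).1
        have h1 := hF.loss_le (ξ := ξ) (ζ := ζ) (o := o) hσ (n := n) (t := i.1) (j := i.2)
          (by linarith) hε2
        have h2 := hF.birth_le (ξ := ξ) (ζ := ζ) (o := o) hσ (t := i.1) (j := i.2) hn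
          (by linarith) hε
        nlinarith
    _ ≤ _ := by
        rw [← Finset.mul_sum]
        exact mul_le_mul_of_nonneg_left (hF.sum_survival_le hσ hn hb R T) (by positivity)

end Front

/-! ### Following an empty interval backwards in time. -/

section Tracking

variable {Ω : Type*} [MeasurableSpace Ω] {F : ℤ → ℕ → Ω → LocalRule} {ξ ζ : Config}

/-- If the first occupied site `j` at time `t` is at most `H + 1`, the emptiness of `j - 1` at time
`t + 1` is a failure. Since it is not a loss, `H < j + n - 1`, so the interval recedes by at most
`n`. -/
lemma track_ray {o σ : ℤ} {t b n : ℕ} {ω : Ω} {H R : ℤ}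
    (hz : ∀ k : ℤ, 0 ≤ k → k < b → ray F ξ ζ o σ t ω k = 0)
    (h1 : ∀ k : ℤ, 0 ≤ k → k ≤ H → ray F ξ ζ o σ (t + 1) ω k = 0) (hb : 1 ≤ b) (hR : H + 1 ≤ R)
    (hloss : ∀ j ∈ Finset.Icc (b : ℤ) R, ω ∉ loss F ξ ζ o σ n t j) :
    (∀ k : ℤ, 0 ≤ k → k ≤ H + 1 → ray F ξ ζ o σ t ω k = 0) ∨
      ((∃ j ∈ Finset.Icc (b : ℤ) R, ω ∈ fail F ξ ζ o σ t j) ∧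
        ∀ k : ℤ, 0 ≤ k → k ≤ H - n → ray F ξ ζ o σ t ω k = 0) := by
  classical
  by_cases hall : ∀ k : ℤ, 0 ≤ k → k ≤ H + 1 → ray F ξ ζ o σ t ω k = 0
  · exact Or.inl hall
  right
  have hex : ∃ k : ℕ, ray F ξ ζ o σ t ω k ≠ 0 := by
    push Not at hall
    obtain ⟨k, hk0, -, hk⟩ := hall
    obtain ⟨k', rfl⟩ := Int.eq_ofNat_of_zero_le hk0
    exact ⟨k', hk⟩
  set j := Nat.find hex with hj
  have hjne := Nat.find_spec hex
  have hmin : ∀ k : ℤ, 0 ≤ k → k < j → ray F ξ ζ o σ t ω k = 0 := by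
    intro k hk0 hk
    obtain ⟨k', rfl⟩ := Int.eq_ofNat_of_zero_le hk0
    by_contra hc
    exact Nat.find_min hex (m := k') (by omega) hc
  have hjb : (b : ℤ) ≤ j := by
    by_contra hc
    exact hjne (hz _ (by positivity) (by linarith))
  have hjH : (j : ℤ) ≤ H + 1 := by
    by_contra hc
    exact hall fun k hk0 hk => hmin k hk0 (by linarith)
  have hb' : (1 : ℤ) ≤ b := by exact_mod_cast hb
  have hc1 : ∀ c : Cell, c ≠ 0 → c = 1 := by decide
  have hedge : ω ∈ edge F ξ ζ o σ t j := ⟨hmin, hc1 _ hjne⟩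
  have hmem : (j : ℤ) ∈ Finset.Icc (b : ℤ) R := Finset.mem_Icc.2 ⟨hjb, by linarith⟩
  refine ⟨⟨j, hmem, hedge, h1 _ (by linarith) (by linarith)⟩, ?_⟩
  have hnl := hloss j hmem
  have hlt : H < j + n - 1 := by
    by_contra hc
    exact hnl ⟨hedge, fun k hk1 hk2 => h1 k (by linarith) (by linarith)⟩
  exact fun k hk0 hk => hmin k hk0 (by linarith)

/-- The two ends of a block, from which the process is observed in the direction of the other
end. -/
def blockEnd (g : ℤ) (b i : ℕ) (s : Bool) : ℤ := if s then g + i * b else g + i * b + b - 1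

def direction (s : Bool) : ℤ := if s then 1 else -1

lemma direction_eq (s : Bool) : direction s = 1 ∨ direction s = -1 := by cases s <;> simp [direction]

/-- The number of failures at time `t` of the fronts surrounding the blocks. -/
noncomputable def failCount (F : ℤ → ℕ → Ω → LocalRule) (ξ ζ : Config) (g : ℤ) (b m : ℕ) (R : ℤ)
    (t : ℕ) (ω : Ω) : ℕ := by
  classical
  exact ((Finset.range m ×ˢ (Finset.univ : Finset Bool) ×ˢ Finset.Icc (b : ℤ) R).filter fun i =>
    ω ∈ fail F ξ ζ (blockEnd g b i.1 i.2.1) (direction i.2.1) t i.2.2).card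

lemma one_le_failCount {g : ℤ} {b m : ℕ} {R : ℤ} {t : ℕ} {ω : Ω} {i : ℕ} (hi : i < m) (s : Bool)
    (h : ∃ j ∈ Finset.Icc (b : ℤ) R, ω ∈ fail F ξ ζ (blockEnd g b i s) (direction s) t j) :
    1 ≤ failCount F ξ ζ g b m R t ω := by
  classical
  obtain ⟨j, hj, hω⟩ := h
  refine Finset.card_pos.2 ⟨(i, s, j), Finset.mem_filter.2 ⟨?_, hω⟩⟩
  exact Finset.mem_product.2 ⟨Finset.mem_range.2 hi, Finset.mem_product.2 ⟨Finset.mem_univ _, hj⟩⟩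

/-- An interval which is empty at time `t + 1` and contains an empty block at time `t` was empty
at time `t`, up to the failures. -/
lemma track_step {g c h R : ℤ} {t b m n i : ℕ} {ω : Ω} (hi : i < m) (hb : 1 ≤ b)
    (hz : ∀ x ∈ Set.Icc (g + i * b) (g + i * b + b - 1), Y F ξ ζ t ω x = 0)
    (hch : Set.Icc (g + i * b) (g + i * b + b - 1) ⊆ Set.Icc c h)
    (h1 : ∀ x ∈ Set.Icc c h, Y F ξ ζ (t + 1) ω x = 0) (hR : h - c + 1 ≤ R)
    (hloss : ∀ s, ∀ j ∈ Finset.Icc (b : ℤ) R,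
      ω ∉ loss F ξ ζ (blockEnd g b i s) (direction s) n t j) :
    ∀ x ∈ Set.Icc (c - 1 + (n + 1) * failCount F ξ ζ g b m R t ω)
      (h + 1 - (n + 1) * failCount F ξ ζ g b m R t ω), Y F ξ ζ t ω x = 0 := by
  set fc : ℤ := ((failCount F ξ ζ g b m R t ω : ℕ) : ℤ) with hfc
  have hfc0 : 0 ≤ fc := by positivity
  have hb' : (1 : ℤ) ≤ b := by exact_mod_cast hb
  have hn0 : (0 : ℤ) ≤ n := by positivity
  have hmul : 0 ≤ ((n : ℤ) + 1) * fc := by positivity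
  set u : ℤ := g + i * b with hu
  have hcu := (hch (Set.left_mem_Icc.2 (by linarith : u ≤ u + b - 1))).1
  have hvh := (hch (Set.right_mem_Icc.2 (by linarith : u ≤ u + b - 1))).2
  have hray : ∀ s t k, ray F ξ ζ (blockEnd g b i s) (direction s) t ω k =
      Y F ξ ζ t ω (if s then u + k else u + b - 1 - k) := by
    intro s t k
    cases s <;> simp [ray, blockEnd, direction, hu, sub_eq_add_neg]
  intro x hx
  -- A failure costs `n` sites and the gain of one site that would occur without it, hence the
  -- factor `n + 1`.
  have hfc1 : ∀ s, (∃ j ∈ Finset.Icc (b : ℤ) R,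
      ω ∈ fail F ξ ζ (blockEnd g b i s) (direction s) t j) → (n : ℤ) + 1 ≤ (n + 1) * fc := by
    intro s hs
    have : (1 : ℤ) ≤ fc := Int.ofNat_le.2 (one_le_failCount hi s hs)
    nlinarith
  rcases le_total u x with hux | hxu
  · have h2 := track_ray (F := F) (ξ := ξ) (ζ := ζ) (o := blockEnd g b i true)
      (σ := direction true) (t := t) (n := n) (ω := ω) (H := h - u) (R := R) (b := b)
      (fun k hk0 hk => by
        rw [hray]; exact hz _ ⟨by simpa using hk0, by simp only [if_true]; linarith⟩)
      (fun k hk0 hk => by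
        rw [hray]
        exact h1 _ ⟨by simp only [if_true]; linarith, by simp only [if_true]; linarith⟩)
      hb (by linarith) (hloss true)
    have e : Y F ξ ζ t ω x = ray F ξ ζ (blockEnd g b i true) (direction true) t ω (x - u) := by
      rw [hray]; simp
    rw [e]
    rcases h2 with h2 | ⟨hf, h2⟩
    · exact h2 _ (by linarith) (by linarith [hx.2])
    · exact h2 _ (by linarith) (by linarith [hx.2, hfc1 true hf])
  · have h2 := track_ray (F := F) (ξ := ξ) (ζ := ζ) (o := blockEnd g b i false)
      (σ := direction false) (t := t) (n := n) (ω := ω) (H := u + b - 1 - c) (R := R) (b := b)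
      (fun k hk0 hk => by
        rw [hray]
        exact hz _ ⟨by simp only [Bool.false_eq_true, if_false]; linarith,
          by simp only [Bool.false_eq_true, if_false]; linarith⟩)
      (fun k hk0 hk => by
        rw [hray]
        exact h1 _ ⟨by simp only [Bool.false_eq_true, if_false]; linarith,
          by simp only [Bool.false_eq_true, if_false]; linarith⟩)
      hb (by linarith) (hloss false)
    have e : Y F ξ ζ t ω x =
        ray F ξ ζ (blockEnd g b i false) (direction false) t ω (u + b - 1 - x) := by
      rw [hray]; simp
    rw [e]
    rcases h2 with h2 | ⟨hf, h2⟩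
    · exact h2 _ (by linarith) (by linarith [hx.1])
    · exact h2 _ (by linarith) (by linarith [hx.1, hfc1 false hf])

/-- An interval which is empty at time `T` was empty at time `0`, up to the failures. -/
lemma track {g c₀ c₁ R : ℤ} {T b m n ℓ L : ℕ} {ω : Ω} (hb : 1 ≤ b) (hmb : m * b ≤ ℓ)
    (hT : ∀ x ∈ Set.Icc c₀ c₁, Y F ξ ζ T ω x = 0)
    (hz : ∀ t < T, (∀ x ∈ Set.Icc g (g + ℓ - 1), Y F ξ ζ (t + 1) ω x = 0) →
      ∃ i < m, ∀ x ∈ Set.Icc (g + i * b) (g + i * b + b - 1), Y F ξ ζ t ω x = 0)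
    (hloss : ∀ t < T, ∀ i < m, ∀ s, ∀ j ∈ Finset.Icc (b : ℤ) R,
      ω ∉ loss F ξ ζ (blockEnd g b i s) (direction s) n t j)
    (hN : (n + 1) * ∑ t ∈ Finset.range T, failCount F ξ ζ g b m R t ω ≤ L)
    (hc₀ : c₀ + L ≤ g) (hc₁ : g + ℓ - 1 ≤ c₁ - L) (hR : c₁ - c₀ + 2 * T ≤ R) :
    ∀ x ∈ Set.Icc (c₀ - T + L) (c₁ + T - L), Y F ξ ζ 0 ω x = 0 := by
  set fc : ℕ → ℕ := fun t => failCount F ξ ζ g b m R t ω with hfc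
  -- Here `τ` counts the steps backwards from `T`. As the total cost is at most `L`, the interval
  -- always contains `[g, g + ℓ - 1]`, where `hz` supplies the next empty block.
  have main : ∀ τ ≤ T, ∀ x ∈ Set.Icc
      (c₀ - τ + (n + 1) * (∑ t ∈ Finset.Ico (T - τ) T, fc t : ℕ))
      (c₁ + τ - (n + 1) * (∑ t ∈ Finset.Ico (T - τ) T, fc t : ℕ)), Y F ξ ζ (T - τ) ω x = 0 := by
    intro τ
    induction τ with
    | zero => intro _ x hx; exact hT x (by simpa using hx)
    | succ τ ih =>
      intro hτ
      have ih' := ih (by omega)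
      set t := T - (τ + 1) with ht
      have ht1 : T - τ = t + 1 := by omega
      rw [ht1] at ih'
      have hsum : ∑ t ∈ Finset.Ico t T, fc t = fc t + ∑ t ∈ Finset.Ico (t + 1) T, fc t :=
        Finset.sum_eq_sum_Ico_succ_bot (by omega) _
      set N : ℕ := ∑ t ∈ Finset.Ico (t + 1) T, fc t with hNdef
      have hNL : ((n : ℤ) + 1) * N ≤ L := by
        have : N ≤ ∑ t ∈ Finset.range T, fc t := by
          rw [Finset.range_eq_Ico]
          exact Finset.sum_le_sum_of_subset (Finset.Ico_subset_Ico_left (Nat.zero_le _))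
        exact_mod_cast (Nat.mul_le_mul_left (n + 1) this).trans hN
      have hτT : (τ : ℤ) + 1 ≤ T := by exact_mod_cast hτ
      have hτ0 : (0 : ℤ) ≤ τ := by positivity
      have hN0 : 0 ≤ ((n : ℤ) + 1) * N := by positivity
      obtain ⟨i, hi, hzi⟩ := hz t (by omega) fun x hx =>
        ih' x ⟨by linarith [hx.1], by linarith [hx.2]⟩
      have hib : ((i : ℤ) + 1) * b ≤ m * b :=
        mul_le_mul_of_nonneg_right (by exact_mod_cast hi) (by positivity)
      have hib0 : (0 : ℤ) ≤ i * b := by positivity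
      have hmb' : (m * b : ℤ) ≤ ℓ := by exact_mod_cast hmb
      have h2 := track_step (m := m) (R := R) (n := n) hi hb hzi
        (Set.Icc_subset_Icc (by linarith) (by linarith)) ih' (by linarith)
        (hloss t (by omega) i hi)
      intro x hx
      rw [hsum] at hx
      push_cast at hx
      have hfc' : (fc t : ℤ) = failCount F ξ ζ g b m R t ω := rfl
      rw [hfc'] at hx
      refine h2 x ⟨le_trans (le_of_eq ?_) hx.1, hx.2.trans (le_of_eq ?_)⟩ <;> ring
  have h := main T le_rfl
  rw [Nat.sub_self, ← Finset.range_eq_Ico] at h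
  have hN' : ((n : ℤ) + 1) * (∑ t ∈ Finset.range T, fc t : ℕ) ≤ L := by exact_mod_cast hN
  exact fun x hx => h x ⟨by linarith [hx.1], by linarith [hx.2]⟩

variable {P : Measure Ω} {p : ℝ} [IsProbabilityMeasure P]

lemma markov_card {ι : Type*} (s : Finset ι) (E : ι → Set Ω) (hE : ∀ i ∈ s, MeasurableSet (E i))
    {c : ℝ} (hc : 0 < c) :
    P.real {ω | c ≤ ∑ i ∈ s, (E i).indicator (1 : Ω → ℝ) ω} ≤ (∑ i ∈ s, P.real (E i)) / c := by
  have hint : ∀ i ∈ s, Integrable ((E i).indicator (1 : Ω → ℝ)) P := fun i hi =>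
    (integrable_const (1 : ℝ)).indicator (hE i hi)
  have h := mul_meas_ge_le_integral_of_nonneg (μ := P)
    (f := fun ω => ∑ i ∈ s, (E i).indicator (1 : Ω → ℝ) ω)
    (ae_of_all _ fun ω => Finset.sum_nonneg fun i _ =>
      Set.indicator_nonneg (fun _ _ => zero_le_one) ω) (integrable_finsetSum s hint) c
  rw [integral_finsetSum s hint, Finset.sum_congr rfl fun i hi => integral_indicator_one (hE i hi)]
    at h
  rwa [le_div_iff₀' hc]

lemma IsBasicCoupling.sum_fail_blocks_le (hF : IsBasicCoupling P p F) (g : ℤ) {b : ℕ}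
    (hb : 2 ≤ b) (m : ℕ) (R : ℤ) (t : ℕ) :
    ∑ i ∈ Finset.range m ×ˢ (Finset.univ : Finset Bool) ×ˢ Finset.Icc (b : ℤ) R,
      P.real (fail F ξ ζ (blockEnd g b i.1 i.2.1) (direction i.2.1) t i.2.2) ≤
        m * (2 * eps P F) := by
  rw [Finset.sum_product]
  have h := Finset.sum_le_card_nsmul (Finset.range m) (fun i => ∑ k ∈ (Finset.univ : Finset Bool) ×ˢ
    Finset.Icc (b : ℤ) R, P.real (fail F ξ ζ (blockEnd g b i k.1) (direction k.1) t k.2))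
    (2 * eps P F) (fun i _ => ?_)
  · rw [Finset.card_range, nsmul_eq_mul] at h
    exact h
  · rw [Finset.sum_product, Fintype.sum_bool, two_mul]
    exact add_le_add (hF.sum_fail_le (direction_eq true) hb t R)
      (hF.sum_fail_le (direction_eq false) hb t R)

lemma failCount_eq_sum (g : ℤ) (b m : ℕ) (R : ℤ) (t : ℕ) (ω : Ω) :
    (failCount F ξ ζ g b m R t ω : ℝ) =
      ∑ i ∈ Finset.range m ×ˢ (Finset.univ : Finset Bool) ×ˢ Finset.Icc (b : ℤ) R,
        (fail F ξ ζ (blockEnd g b i.1 i.2.1) (direction i.2.1) t i.2.2).indicator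
          (1 : Ω → ℝ) ω := by
  classical
  rw [failCount, Finset.card_filter]
  push_cast
  exact Finset.sum_congr rfl fun i _ => by simp [Set.indicator]

/-- Markov's inequality: at each time there are two fronts per block, each failing with probability
at most ε. All the blocks are counted because the empty one is random. -/
lemma IsBasicCoupling.failCount_le (hF : IsBasicCoupling P p F) (g : ℤ) {b : ℕ} (hb : 2 ≤ b)
    (m : ℕ) (R : ℤ) (T n L : ℕ) :
    P.real {ω | ¬ (n + 1) * ∑ t ∈ Finset.range T, failCount F ξ ζ g b m R t ω ≤ L} ≤
      2 * T * m * (n + 1) * eps P F / (L + 1) := by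
  obtain ⟨s, hs⟩ : ∃ s, s = Finset.range m ×ˢ (Finset.univ : Finset Bool) ×ˢ
    Finset.Icc (b : ℤ) R := ⟨_, rfl⟩
  obtain ⟨E, hE⟩ : ∃ E : ℕ × ℕ × Bool × ℤ → Set Ω, ∀ t i, E (t, i) =
    fail F ξ ζ (blockEnd g b i.1 i.2.1) (direction i.2.1) t i.2.2 :=
    ⟨fun k => fail F ξ ζ (blockEnd g b k.2.1 k.2.2.1) (direction k.2.2.1) k.1 k.2.2.2,
      fun _ _ => rfl⟩
  have hEm : ∀ i ∈ Finset.range T ×ˢ s, MeasurableSet (E i) := by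
    rintro ⟨t, i⟩ _
    rw [hE]
    exact (hF.gen_le _ _ (measurableSet_edge F ξ ζ _ _ _ _)).inter
      (hF.gen_le _ _ (measurableSet_ray_eq F ξ ζ _ _ _ _ _))
  have hcount : ∀ ω, ((∑ t ∈ Finset.range T, failCount F ξ ζ g b m R t ω : ℕ) : ℝ) =
      ∑ i ∈ Finset.range T ×ˢ s, (E i).indicator (1 : Ω → ℝ) ω := by
    intro ω
    rw [Finset.sum_product, Nat.cast_sum]
    simp_rw [failCount_eq_sum, hE, hs]
  have hn : (0 : ℝ) < n + 1 := by positivity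
  have hsum : ∑ i ∈ Finset.range T ×ˢ s, P.real (E i) ≤ T * (m * (2 * eps P F)) := by
    rw [Finset.sum_product]
    have h := Finset.sum_le_card_nsmul (Finset.range T) (fun t => ∑ i ∈ s, P.real (E (t, i)))
      (m * (2 * eps P F)) (fun t _ => by
        simp_rw [hE, hs]
        exact hF.sum_fail_blocks_le g hb m R t)
    rwa [Finset.card_range, nsmul_eq_mul] at h
  have hL : (0 : ℝ) < (L + 1) / (n + 1) := by positivity
  calc _ ≤ P.real {ω | ((L : ℝ) + 1) / (n + 1) ≤
        ∑ i ∈ Finset.range T ×ˢ s, (E i).indicator (1 : Ω → ℝ) ω} := by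
        refine measureReal_mono fun ω hω => ?_
        simp only [Set.mem_ofPred_eq, not_le] at hω ⊢
        rw [← hcount, div_le_iff₀' hn]
        exact_mod_cast hω
    _ ≤ _ := markov_card _ E hEm hL
    _ ≤ (T * (m * (2 * eps P F))) / ((L + 1) / (n + 1)) :=
        div_le_div_of_nonneg_right hsum hL.le
    _ = _ := by field_simp

/-- If the process vanishes on an interval, without having been dangerous just before, then some
block was empty just before. -/
lemma IsBasicCoupling.no_empty_block_le (hF : IsBasicCoupling P p F) (hp : p ≤ 1) (t : ℕ) {g : ℤ}
    {b m ℓ ℓ₁ : ℕ} (hb : 1 ≤ b) (hmb : m * b ≤ ℓ) (hℓ₁ : ℓ₁ ≤ b) :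
    P.real {ω | ¬ Coincides (Y F ξ ζ t ω) (Set.Icc g (g + ℓ - 1)) (orbit1 ∪ orbit01) ℓ₁ ∧
      (∀ x ∈ Set.Icc g (g + ℓ - 1), Y F ξ ζ (t + 1) ω x = 0) ∧
      ∀ i < m, ∃ x ∈ Set.Icc (g + i * b) (g + i * b + b - 1), Y F ξ ζ t ω x ≠ 0} ≤
      (2 * (1 - p)) ^ m := by
  refine le_trans (measureReal_mono ?_) (hF.step_le_of_prod_le ξ ζ (t := t)
    (pow_nonneg (by linarith) m) (Finset.Icc g (g + ℓ - 1)) (fun _ => 0))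
  rintro ω ⟨hdan, hzero, hne⟩
  refine ⟨hF.prod_outProb_le_of_mismatch (τ := fun _ => 0) hmb fun i hi => ?_,
    fun x hx => hzero x (Finset.mem_Icc.1 hx)⟩
  by_contra hcon
  push Not at hcon
  have hib : ((i : ℤ) + 1) * b ≤ m * b :=
    mul_le_mul_of_nonneg_right (by exact_mod_cast hi) (by positivity)
  have hib0 : (0 : ℤ) ≤ i * b := by positivity
  have hmb' : (m * b : ℤ) ≤ ℓ := by exact_mod_cast hmb
  obtain ⟨x, hx, hxne⟩ := hne i hi
  exact hxne (eq_zero_of_periodic hb hℓ₁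
    (Set.Icc_subset_Icc (by linarith) (by linarith)) hdan hcon x hx)

/-- The flip/preserve process is unlikely to vanish on a long interval, unless it has been
dangerous or was zero initially. -/
lemma IsBasicCoupling.vanish_le (hF : IsBasicCoupling P p F) (hp : p ≤ 1)
    {g c₀ c₁ : ℤ} {T b m n d₀ ℓ ℓ₁ L : ℕ} (hmb : m * b ≤ ℓ) (hℓ₁ : ℓ₁ ≤ b)
    (hn : 2 * d₀ ≤ n) (hb : 2 * d₀ + 2 ≤ b) (hd₀ : 1 ≤ d₀) (hε : 4 * eps P F * d₀ ≤ 1)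
    (hc₀ : c₀ + L ≤ g) (hc₁ : g + ℓ - 1 ≤ c₁ - L)
    (h0 : ∃ x ∈ Set.Icc (c₀ - T + L) (c₁ + T - L), (ξ + ζ) x - ξ x ≠ 0) :
    P.real {ω | (∀ t < T, ¬ Coincides (Y F ξ ζ t ω) (Set.Icc g (g + ℓ - 1))
      (orbit1 ∪ orbit01) ℓ₁) ∧ ∀ x ∈ Set.Icc c₀ c₁, Y F ξ ζ T ω x = 0} ≤
      T * (2 * (1 - p)) ^ m + m * (8 * eps P F * (T / (d₀ + 1) + 1 : ℕ)) +
        2 * T * m * (n + 1) * eps P F / (L + 1) := by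
  set R : ℤ := c₁ - c₀ + 2 * T with hR
  set E₁ : ℕ → Set Ω := fun t =>
    {ω | ¬ Coincides (Y F ξ ζ t ω) (Set.Icc g (g + ℓ - 1)) (orbit1 ∪ orbit01) ℓ₁ ∧
      (∀ x ∈ Set.Icc g (g + ℓ - 1), Y F ξ ζ (t + 1) ω x = 0) ∧
      ∀ i < m, ∃ x ∈ Set.Icc (g + i * b) (g + i * b + b - 1), Y F ξ ζ t ω x ≠ 0} with hE₁
  set s₂ := (Finset.range m ×ˢ (Finset.univ : Finset Bool)) with hs₂
  set s₃ := Finset.range T ×ˢ Finset.Icc (b : ℤ) R with hs₃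
  set E₂ : (ℕ × Bool) → (ℕ × ℤ) → Set Ω := fun i k =>
    loss F ξ ζ (blockEnd g b i.1 i.2) (direction i.2) n k.1 k.2 with hE₂
  set E₃ : Set Ω :=
    {ω | ¬ (n + 1) * ∑ t ∈ Finset.range T, failCount F ξ ζ g b m R t ω ≤ L} with hE₃
  -- Outside the three bad events (no empty block, a loss, too many failures), `track` shows that
  -- the initial perturbation vanishes where `h0` says it does not.
  have hsub : {ω | (∀ t < T, ¬ Coincides (Y F ξ ζ t ω) (Set.Icc g (g + ℓ - 1))
      (orbit1 ∪ orbit01) ℓ₁) ∧ ∀ x ∈ Set.Icc c₀ c₁, Y F ξ ζ T ω x = 0} ⊆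
      ((⋃ t ∈ Finset.range T, E₁ t) ∪ ⋃ i ∈ s₂, ⋃ k ∈ s₃, E₂ i k) ∪ E₃ := by
    rintro ω ⟨hdan, hzero⟩
    by_contra hcon
    simp only [Set.mem_union, not_or, Set.mem_iUnion, not_exists] at hcon
    obtain ⟨⟨h1, h2⟩, h3⟩ := hcon
    obtain ⟨x, hx, hxne⟩ := h0
    refine hxne (track (F := F) (m := m) (n := n) (b := b) (R := R) (L := L) (ℓ := ℓ) (g := g)
      (by omega) hmb hzero ?_ ?_ ?_ hc₀ hc₁ le_rfl x hx)
    · intro t ht hz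
      by_contra hc
      push Not at hc
      exact h1 t (Finset.mem_range.2 ht) ⟨hdan t ht, hz, hc⟩
    · intro t ht i hi s j hj
      exact h2 (i, s) (Finset.mem_product.2 ⟨Finset.mem_range.2 hi, Finset.mem_univ _⟩) (t, j)
        (Finset.mem_product.2 ⟨Finset.mem_range.2 ht, hj⟩)
    · by_contra hc
      exact h3 hc
  have b1 : P.real (⋃ t ∈ Finset.range T, E₁ t) ≤ T * (2 * (1 - p)) ^ m := by
    refine (measureReal_biUnion_finset_le _ _).trans ?_
    calc _ ≤ ∑ t ∈ Finset.range T, (2 * (1 - p)) ^ m :=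
          Finset.sum_le_sum fun t _ => hF.no_empty_block_le hp t (by omega) hmb hℓ₁
      _ = _ := by rw [Finset.sum_const, Finset.card_range, nsmul_eq_mul]
  have b2 : P.real (⋃ i ∈ s₂, ⋃ k ∈ s₃, E₂ i k) ≤
      m * (8 * eps P F * (T / (d₀ + 1) + 1 : ℕ)) := by
    refine (measureReal_biUnion_finset_le _ _).trans ?_
    calc _ ≤ ∑ i ∈ s₂, 4 * eps P F * (T / (d₀ + 1) + 1 : ℕ) :=
          Finset.sum_le_sum fun i _ => (measureReal_biUnion_finset_le _ _).trans
            (hF.sum_loss_le (direction_eq _) hn hb hd₀ hε R T)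
      _ = _ := by
          rw [Finset.sum_const, hs₂, Finset.card_product, Finset.card_range, nsmul_eq_mul]
          simp only [Finset.card_univ, Fintype.card_bool]
          push_cast; ring
  have b3 : P.real E₃ ≤ 2 * T * m * (n + 1) * eps P F / (L + 1) :=
    hF.failCount_le g (by omega) m R T n L
  exact (measureReal_mono hsub (measure_ne_top _ _)).trans ((measureReal_union_le _ _).trans
    (add_le_add ((measureReal_union_le _ _).trans (add_le_add b1 b2)) b3))

end Tracking

/-! ### Absence of dangerous patterns, step by step in time. -/

section Propagation

lemma K_eq (ε : ℝ) : K ε = 10 * ⌈ε ^ (-(3 / 2) : ℝ)⌉₊ := rfl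

lemma Jplus_eq (ε : ℝ) : Jplus ε = Set.Icc (12 * (⌈ε ^ (-(3 / 2) : ℝ)⌉₊ : ℤ))
    (18 * (⌈ε ^ (-(3 / 2) : ℝ)⌉₊ : ℤ)) := by
  unfold Jplus; rw [K_eq]; push_cast; congr 1 <;> omega

lemma Jminus_eq (ε : ℝ) : Jminus ε = Set.Icc (-(18 * (⌈ε ^ (-(3 / 2) : ℝ)⌉₊ : ℤ)))
    (-(12 * (⌈ε ^ (-(3 / 2) : ℝ)⌉₊ : ℤ))) := by
  unfold Jminus; rw [K_eq]; push_cast; congr 1 <;> omega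

lemma periodicOrbit_translate {m : ℕ} {a : ZMod m → Cell} {σ : Config}
    (h : σ ∈ periodicOrbit m a) (c : ℤ) : translate c σ ∈ periodicOrbit m a := by
  obtain ⟨l, hl⟩ := h
  refine ⟨l + c, fun x => ?_⟩
  simp only [translate, hl]
  push_cast; congr 1; ring

lemma Coincides.of_translate {s : Config} {a u v : ℤ} {S : Set Config} {ℓ : ℕ}
    (hS : ∀ σ ∈ S, translate (-a) σ ∈ S) (h : Coincides (translate a s) (Set.Icc u v) S ℓ) :
    Coincides s (Set.Icc (a + u) (a + v)) S ℓ := by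
  obtain ⟨g, k, hgk, hsub, hlen, σ, hσ, hy⟩ := h
  refine ⟨a + g, a + k, by linarith, fun x hx => ?_, by linarith, _, hS σ hσ, fun x hx => ?_⟩
  · have := hsub (show x - a ∈ Set.Icc g k from ⟨by linarith [hx.1], by linarith [hx.2]⟩)
    exact ⟨by linarith [this.1], by linarith [this.2]⟩
  · have := hy (x - a) ⟨by linarith [hx.1], by linarith [hx.2]⟩
    simpa [translate, add_comm, sub_eq_add_neg, add_left_comm] using this

lemma Dangerous.of_translate {ε : ℝ} {s : Config} {a u v : ℤ}
    (h : Dangerous ε (translate a s) (Set.Icc u v)) :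
    Dangerous ε s (Set.Icc (a + u) (a + v)) := by
  refine h.imp (Coincides.of_translate ?_) (Coincides.of_translate ?_)
  · rintro σ (h | h)
    · exact Or.inl (periodicOrbit_translate h _)
    · exact Or.inr (periodicOrbit_translate h _)
  · exact fun σ h => periodicOrbit_translate h _

/-- The scales at which one step of the process is analyzed: an interval with `ℓ₂` elements
contains `m` blocks with `b₂` elements, and an interval with `ℓ₁` elements contains `m` blocks
with `b₁` elements. -/
structure StepScales (ε : ℝ) (m M b₁ b₂ : ℕ) : Prop where
  one_le : 1 ≤ M
  le_b₂ : M * 8 + 2 ≤ b₂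
  le_ell_two : m * b₂ ≤ ell ε 2
  ell_three_le : ell ε 3 ≤ b₂
  le_b₁ : M * 8 + 2 ≤ b₁
  le_ell_one : m * b₁ ≤ ell ε 1
  ell_three_le' : ell ε 3 ≤ b₁
  ell_two_le : ell ε 2 ≤ b₁

variable {Ω : Type*} [MeasurableSpace Ω] {P : Measure Ω} {p : ℝ} {F : ℤ → ℕ → Ω → LocalRule}
  [IsProbabilityMeasure P]

/-- In a nice environment, a process which is not dangerous is unlikely to become dangerous. -/
lemma IsBasicCoupling.dangerous_succ_le (hF : IsBasicCoupling P p F) (hp : p ≤ 1)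
    (ξ ζ : Config) (t : ℕ) {abc : Triple} (habc : qMax P F abc = eps P F) {m M b₁ b₂ : ℕ}
    (hS : StepScales (eps P F) m M b₁ b₂) (A₁ A₂ : ℤ) :
    P.real {ω | IsEllNice abc (ell (eps P F) 3) (X F ξ t ω) (Set.Icc A₁ A₂) ∧
      ¬ Dangerous (eps P F) (Y F ξ ζ t ω) (Set.Icc A₁ A₂) ∧
      Dangerous (eps P F) (Y F ξ ζ (t + 1) ω) (Set.Icc A₁ A₂)} ≤
      (A₂ - A₁ + 1).toNat * 12 * stepErr p (eps P F) m M := by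
  have h1 := hF.measureReal_coincides0111_le hp ξ ζ t habc hS.one_le hS.le_b₂ hS.le_ell_two
    hS.ell_three_le A₁ A₂
  have h2 := hF.measureReal_coincides01_le hp ξ ζ t habc hS.one_le hS.le_b₁ hS.le_ell_one
    hS.ell_three_le' hS.ell_two_le A₁ A₂
  refine (measureReal_mono ?_).trans ((measureReal_union_le _ _).trans
    ((add_le_add h1 h2).trans (by linarith)))
  rintro ω ⟨hn, hy, hc | hc⟩
  · exact Or.inr ⟨hn, fun h => hy (Or.inr h), hc⟩
  · exact Or.inl ⟨hn, hc⟩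

/-- If the environment is nice for two steps, then the process is unlikely to be dangerous,
whatever its initial state. -/
lemma IsBasicCoupling.dangerous_add_two_le (hF : IsBasicCoupling P p F) (hp : p ≤ 1)
    (ξ ζ : Config) (t : ℕ) {abc : Triple} (habc : qMax P F abc = eps P F) {m M b₁ b₂ : ℕ}
    (hS : StepScales (eps P F) m M b₁ b₂) (A₁ A₂ : ℤ) {ν : ℝ}
    (hν : ∀ t' ≥ t, P.real {ω | ¬ IsEllNice abc (ell (eps P F) 3) (X F ξ t' ω)
      (Set.Icc A₁ A₂)} ≤ ν) :
    P.real {ω | Dangerous (eps P F) (Y F ξ ζ (t + 2) ω) (Set.Icc A₁ A₂)} ≤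
      2 * ν + (A₂ - A₁ + 1).toNat * 16 * stepErr p (eps P F) m M := by
  have h0 := hF.measureReal_coincides0111_le hp ξ ζ t habc hS.one_le hS.le_b₂ hS.le_ell_two
    hS.ell_three_le A₁ A₂
  have h1 := hF.measureReal_coincides0111_le hp ξ ζ (t + 1) habc hS.one_le hS.le_b₂ hS.le_ell_two
    hS.ell_three_le A₁ A₂
  have h2 := hF.measureReal_coincides01_le hp ξ ζ (t + 1) habc hS.one_le hS.le_b₁ hS.le_ell_one
    hS.ell_three_le' hS.ell_two_le A₁ A₂
  have h3 := hν t le_rfl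
  have h4 := hν (t + 1) (Nat.le_succ t)
  refine (measureReal_mono (s₂ := _ ∪ (_ ∪ (_ ∪ (_ ∪ _)))) ?_).trans
    ((measureReal_union_le _ _).trans ((add_le_add h3 ((measureReal_union_le _ _).trans
      (add_le_add h4 ((measureReal_union_le _ _).trans (add_le_add h0
        ((measureReal_union_le _ _).trans (add_le_add h1 h2))))))).trans (by linarith)))
  intro ω hω
  by_cases n0 : IsEllNice abc (ell (eps P F) 3) (X F ξ t ω) (Set.Icc A₁ A₂)
  swap
  · exact Or.inl n0
  by_cases n1 : IsEllNice abc (ell (eps P F) 3) (X F ξ (t + 1) ω) (Set.Icc A₁ A₂)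
  swap
  · exact Or.inr (Or.inl n1)
  -- The first step removes 0111 without any information on the past; its absence then allows the
  -- second step to remove 1 and 01.
  by_cases hc : Coincides (Y F ξ ζ (t + 1) ω) (Set.Icc A₁ A₂) orbit0111 (ell (eps P F) 2)
  · exact Or.inr (Or.inr (Or.inl ⟨n0, hc⟩))
  rcases hω with h | h
  · exact Or.inr (Or.inr (Or.inr (Or.inr ⟨n1, hc, h⟩)))
  · exact Or.inr (Or.inr (Or.inr (Or.inl ⟨n1, h⟩)))

/-- A process which is not dangerous initially is unlikely to be ever dangerous. -/
lemma IsBasicCoupling.exists_dangerous_le (hF : IsBasicCoupling P p F) (hp : p ≤ 1)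
    (ξ ζ : Config) {abc : Triple} (habc : qMax P F abc = eps P F) {m M b₁ b₂ : ℕ}
    (hS : StepScales (eps P F) m M b₁ b₂) (A₁ A₂ : ℤ) {s N : ℕ} {ν θ : ℝ}
    (h0 : ∀ ω, ¬ Dangerous (eps P F) (Y F ξ ζ 0 ω) (Set.Icc A₁ A₂))
    (hθ : P.real {ω | ∃ t < s, ¬ IsEllNice abc (ell (eps P F) 3) (X F ξ t ω)
      (Set.Icc A₁ A₂)} ≤ θ)
    (hν : ∀ t ≥ s, P.real {ω | ¬ IsEllNice abc (ell (eps P F) 3) (X F ξ t ω)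
      (Set.Icc A₁ A₂)} ≤ ν) (hν0 : 0 ≤ ν) :
    P.real {ω | ∃ t < N, Dangerous (eps P F) (Y F ξ ζ t ω) (Set.Icc A₁ A₂)} ≤
      θ + N * ν + N * ((A₂ - A₁ + 1).toNat * 12 * stepErr p (eps P F) m M) := by
  set B : ℕ → Set Ω := fun t =>
    {ω | s ≤ t ∧ ¬ IsEllNice abc (ell (eps P F) 3) (X F ξ t ω) (Set.Icc A₁ A₂)} with hB
  set C : ℕ → Set Ω := fun t =>
    {ω | IsEllNice abc (ell (eps P F) 3) (X F ξ t ω) (Set.Icc A₁ A₂) ∧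
      ¬ Dangerous (eps P F) (Y F ξ ζ t ω) (Set.Icc A₁ A₂) ∧
      Dangerous (eps P F) (Y F ξ ζ (t + 1) ω) (Set.Icc A₁ A₂)} with hC
  have hBle : P.real (⋃ t ∈ Finset.range N, B t) ≤ N * ν := by
    refine (measureReal_biUnion_finset_le _ _).trans ((Finset.sum_le_card_nsmul _ _ ν ?_).trans
      (by simp))
    intro t _
    by_cases h : s ≤ t
    · exact (measureReal_mono fun ω hω => hω.2).trans (hν t h)
    · have : B t = ∅ := by
        ext ω; simp only [hB, Set.mem_ofPred_eq, Set.mem_empty_iff_false, iff_false]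
        exact fun h' => h h'.1
      rw [this]; simpa using hν0
  have hCle : P.real (⋃ t ∈ Finset.range N, C t) ≤
      N * ((A₂ - A₁ + 1).toNat * 12 * stepErr p (eps P F) m M) := by
    refine (measureReal_biUnion_finset_le _ _).trans ((Finset.sum_le_card_nsmul _ _ _
      fun t _ => hF.dangerous_succ_le hp ξ ζ t habc hS A₁ A₂).trans (by simp))
  refine (measureReal_mono (s₂ := _ ∪ _ ∪ _) ?_ (measure_ne_top _ _)).trans
    ((measureReal_union_le _ _).trans
    (add_le_add ((measureReal_union_le _ _).trans (add_le_add hθ hBle)) hCle))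
  intro ω hω
  classical
  -- At the first dangerous time, which is positive, the preceding state is not dangerous; so either
  -- the environment was not nice then, or an unlikely transition took place.
  obtain ⟨hlt, hd⟩ := Nat.find_spec hω
  have hmin := fun t' => Nat.find_min (H := hω) (m := t')
  set t := Nat.find hω
  obtain _ | t := t
  · exact absurd hd (h0 ω)
  have hnd : ¬ Dangerous (eps P F) (Y F ξ ζ t ω) (Set.Icc A₁ A₂) :=
    fun h => hmin t (Nat.lt_succ_self t) ⟨by omega, h⟩
  have htN : t ∈ Finset.range N := Finset.mem_range.2 (by omega)
  by_cases hn : IsEllNice abc (ell (eps P F) 3) (X F ξ t ω) (Set.Icc A₁ A₂)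
  · exact Or.inr (Set.mem_biUnion (Finset.mem_coe.2 htN) ⟨hn, hnd, hd⟩)
  · refine Or.inl ?_
    by_cases hs : s ≤ t
    · exact Or.inr (Set.mem_biUnion (Finset.mem_coe.2 htN) ⟨hs, hn⟩)
    · exact Or.inl ⟨t, by omega, hn⟩

end Propagation

/-! ### The probability that (1,1) is not good, with free scales. -/

section Combination

variable {Ω : Type*} [MeasurableSpace Ω] {P : Measure Ω} {p : ℝ} {F : ℤ → ℕ → Ω → LocalRule}
  [IsProbabilityMeasure P]

/-- The bound on the probability that the block `(1,1)` is not good. -/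
noncomputable def totalErr (p ε : ℝ) (q M m M' d₀ : ℕ) : ℝ :=
  (T ε * (2 * (1 - p)) ^ m + m * (8 * ε * (T ε / (d₀ + 1) + 1 : ℕ)) +
      2 * T ε * m * (2 * d₀ + 1) * ε / (⌈ε ^ (-(3 / 2) : ℝ)⌉₊ + 1)) +
    (theta ε + T ε * niceErr (K ε) q M + T ε * (K ε * 12 * stepErr p ε m M')) +
    2 * (2 * niceErr (K ε) q M + K ε * 16 * stepErr p ε m M') +
    K ε * (2 * niceErr (K ε) q M) / theta ε

lemma IsGood.zero_zero {abc : Triple} {ξ ζ : Config} {ω : Ω} (h : IsGood P F abc ξ ζ 0 0 ω) :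
    (∃ x ∈ I (eps P F), (ξ + ζ) x - ξ x ≠ 0) ∧
      ¬ Dangerous (eps P F) (fun x => (ξ + ζ) x - ξ x) (Jplus (eps P F)) ∧
      Q P F abc (ell (eps P F) 3) ξ ≤ theta (eps P F) := by
  have h0 : ∀ η : Config, translate ((0 : ℤ) * K (eps P F)) η = η := fun η => by
    ext x; simp [translate]
  obtain ⟨h1, -, h3, h4⟩ := h
  rw [h0, zero_mul] at h1 h3 h4
  exact ⟨h1, h3, h4⟩

lemma IsBasicCoupling.measureReal_not_isGood_le (hF : IsBasicCoupling P p F) (hp : 1 / 2 ≤ p)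
    (hp1 : p ≤ 1) {ξ ζ : Config} {abc : Triple} (habc : qMax P F abc = eps P F)
    (hK : 0 < K (eps P F)) {s q M : ℕ} (hs : s ≤ K (eps P F)) (hβ : (2 * p - 1) ^ s ≤ 1 / 252)
    (hq8 : 8 ∣ q) (hqw : 4 * s + 3 ≤ q) (hM0 : 1 ≤ M) (hM : M * q + 2 ≤ ell (eps P F) 3)
    {m M' b₁ b₂ : ℕ} (hS : StepScales (eps P F) m M' b₁ b₂) {b d₀ : ℕ}
    (hmb : m * b ≤ 6 * ⌈(eps P F) ^ (-(3 / 2) : ℝ)⌉₊) (hℓ₁ : ell (eps P F) 1 ≤ b)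
    (hb : 2 * d₀ + 2 ≤ b) (hd₀ : 1 ≤ d₀) (hε : 4 * eps P F * d₀ ≤ 1)
    (h0 : ∀ ω, IsGood P F abc ξ ζ 0 0 ω) :
    P.real {ω | ¬ IsGood P F abc ξ ζ 1 1 ω} ≤ totalErr p (eps P F) q M m M' d₀ := by
  obtain ⟨ω₀⟩ : Nonempty Ω := nonempty_of_isProbabilityMeasure P
  obtain ⟨hI, hJ, hQ⟩ := (h0 ω₀).zero_zero
  set ε := eps P F with hεdef
  set k : ℕ := ⌈ε ^ (-(3 / 2) : ℝ)⌉₊ with hk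
  have hKk : K ε = 10 * k := rfl
  have hTk : T ε = 40 * k := by unfold T; rw [hKk]; ring
  have hk1 : 1 ≤ k := by omega
  have hσ : 0 ≤ stepErr p ε m M' := stepErr_nonneg hp1 _ _ _
  have hν0 : 0 ≤ niceErr (K ε) q M := niceErr_nonneg _ _ _
  have hcard : ∀ A₁ A₂ : ℤ, A₂ - A₁ = 6 * k → ((A₂ - A₁ + 1).toNat : ℝ) ≤ K ε := fun A₁ A₂ h => by
    have : (A₂ - A₁ + 1).toNat ≤ K ε := by omega
    exact_mod_cast this
  have hν : ∀ A₁ A₂ : ℤ, A₂ - A₁ = 6 * k → ∀ t ≥ K ε,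
      P.real {ω | ¬ IsEllNice abc (ell ε 3) (X F ξ t ω) (Set.Icc A₁ A₂)} ≤ niceErr (K ε) q M :=
    fun A₁ A₂ hA t ht => hF.measureReal_X_not_nice_le hp hp1 ξ (hs.trans ht) hβ abc hq8 hqw hM0 hM
      A₁ A₂ (hcard A₁ A₂ hA)
  have hdan : ∀ A₁ A₂ : ℤ, A₂ - A₁ = 6 * k →
      P.real {ω | Dangerous ε (Y F ξ ζ (T ε) ω) (Set.Icc A₁ A₂)} ≤
        2 * niceErr (K ε) q M + K ε * 16 * stepErr p ε m M' := fun A₁ A₂ hA => by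
    have h := hF.dangerous_add_two_le hp1 ξ ζ (T ε - 2) habc hS A₁ A₂
      (fun t ht => hν A₁ A₂ hA t (by omega))
    rw [show T ε - 2 + 2 = T ε by omega] at h
    refine h.trans ?_
    gcongr
    exact_mod_cast hcard A₁ A₂ hA
  have htrack := hF.exists_dangerous_le hp1 ξ ζ habc hS (12 * k) (18 * k) (s := K ε) (N := T ε)
    (θ := theta ε) (fun ω => by rw [← Jplus_eq]; exact hJ) (le_trans (measureReal_mono ?_) hQ)
    (hν _ _ (by ring)) hν0
  swap
  · rintro ω ⟨t, ht, hn⟩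
    refine ⟨t, ht, fun h => hn fun g h' hgh hsub => h g h' hgh ?_⟩
    refine hsub.trans ?_
    rw [← Jplus_eq]; exact Set.subset_union_right
  -- The interval [0, 20k] is K+I, and the blocks lie in J_+ = [12k, 18k]. With T = 40k and an
  -- allowed deficit of k, the interval traced back to time 0 is [-39k, 59k], which contains I =
  -- [-10k, 10k].
  have hvan := hF.vanish_le (ξ := ξ) (ζ := ζ) hp1 (g := 12 * k) (c₀ := 0) (c₁ := 20 * k)
    (T := T ε) (m := m) (b := b) (n := 2 * d₀) (d₀ := d₀) (ℓ := 6 * k + 1) (ℓ₁ := ell ε 1)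
    (L := k) (by omega) hℓ₁ le_rfl hb hd₀ hε (by omega) (by push_cast; omega) ?_
  swap
  · obtain ⟨x, hx, hne⟩ := hI
    refine ⟨x, ?_, hne⟩
    simp only [I, hKk, Set.mem_Icc] at hx
    rw [hTk, Set.mem_Icc]
    push_cast at hx ⊢
    omega
  have hnice := hF.measureReal_Q_gt_le hp hp1 ξ (1 * K ε) (s := s) (T := T ε) (by omega) hβ abc
    hq8 hqw hM0 hM hK (θ := theta ε) (Real.exp_pos _)
  have hl := hdan (1 * K ε + -(18 * k)) (1 * K ε + -(12 * k)) (by ring)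
  have hr := hdan (1 * K ε + 12 * k) (1 * K ε + 18 * k) (by ring)
  refine (measureReal_mono (s₂ := _ ∪ (_ ∪ (_ ∪ (_ ∪ _)))) ?_ (measure_ne_top _ _)).trans
    ((measureReal_union_le _ _).trans ((add_le_add hvan ((measureReal_union_le _ _).trans
      (add_le_add htrack ((measureReal_union_le _ _).trans (add_le_add hl
        ((measureReal_union_le _ _).trans (add_le_add hr hnice))))))).trans ?_))
  · intro ω hω
    by_contra hcon
    simp only [Set.mem_union, not_or, Set.mem_ofPred_eq, not_not] at hcon
    obtain ⟨hv, ht, hl, hr, hn⟩ := hcon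
    refine hω ⟨?_, fun h => hl ?_, fun h => hr ?_, ?_⟩
    · by_contra hz
      push Not at hz
      refine hv ⟨fun t htT hc => ht ⟨t, htT, Or.inl ?_⟩, fun x hx => ?_⟩
      · have h6 : (12 * k + ((6 * k + 1 : ℕ) : ℤ) - 1 : ℤ) = 18 * k := by push_cast; ring
        rwa [h6] at hc
      · have := hz (x - 10 * k) ?_
        · rw [one_mul, one_mul, ← hεdef, hKk] at this
          simpa [translate] using this
        · simp only [I, ← hεdef, hKk, Set.mem_Icc] at hx ⊢
          push_cast
          omega
    · rw [Jminus_eq, one_mul (T _)] at h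
      exact h.of_translate
    · rw [Jplus_eq, one_mul (T _)] at h
      exact h.of_translate
    · rw [one_mul (T _)]; exact hn
  · have hle : (T ε : ℝ) * (((18 * k - 12 * k + 1 : ℤ).toNat : ℝ) * 12 * stepErr p ε m M') ≤
        T ε * (K ε * 12 * stepErr p ε m M') := by
      gcongr
      exact_mod_cast hcard (12 * k) (18 * k) (by ring)
    unfold totalErr
    push_cast at hle ⊢
    linarith

end Combination

/-! ### Choice of the scales as powers of y = ε^{-1/24}, and the resulting estimates. -/

section Asymptotics

/-- The parametrization `ε = y⁻²⁴`, under which all the scales are integer powers of `y`, up to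
powers of `L = log (1/ε)`. -/
structure SmallEps (ε y L : ℝ) : Prop where
  eps_eq : ε = (y ^ 24)⁻¹
  log_eq : L = 24 * Real.log y
  le_log : 100 ≤ L
  log_le : 10 ^ 7 * L ^ 8 ≤ y

variable {ε y L : ℝ}

lemma SmallEps.le_y (h : SmallEps ε y L) : 10 ^ 7 * L ≤ y := by
  refine le_trans ?_ h.log_le
  have := le_self_pow₀ (show (1 : ℝ) ≤ L by linarith [h.le_log]) (show 8 ≠ 0 by norm_num)
  linarith

lemma SmallEps.big (h : SmallEps ε y L) : 10 ^ 9 ≤ y := by linarith [h.le_y, h.le_log]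

lemma SmallEps.rpow_eq (h : SmallEps ε y L) (r : ℝ) (n : ℕ) (hr : 24 * r = n) :
    ε ^ (-r) = y ^ n := by
  have hy : 0 ≤ y := by linarith [h.big]
  rw [h.eps_eq, Real.inv_rpow (by positivity), Real.rpow_neg (by positivity), inv_inv,
    ← Real.rpow_natCast, ← Real.rpow_mul hy, ← Real.rpow_natCast, ← hr]
  norm_num

lemma SmallEps.K_eq (h : SmallEps ε y L) : K ε = 10 * ⌈y ^ 36⌉₊ := by
  unfold K; rw [h.rpow_eq (3 / 2) 36 (by norm_num)]

lemma SmallEps.theta_eq (h : SmallEps ε y L) : theta ε = Real.exp (-(y ^ 8)) := by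
  unfold theta; rw [h.rpow_eq (1 / 3) 8 (by norm_num)]

lemma SmallEps.ell_eq (h : SmallEps ε y L) (n : ℕ) :
    ell ε n = ⌈3 * (⌈y ^ 36⌉₊ : ℝ) / L ^ (2 * n)⌉₊ := by
  have hL : Real.log (1 / ε) = L := by
    rw [h.eps_eq, one_div, inv_inv, Real.log_pow, h.log_eq]; norm_num
  unfold ell ell0
  rw [hL, h.K_eq, zpow_neg, ← Nat.cast_ofNat (R := ℤ), ← Nat.cast_mul, zpow_natCast]
  congr 1; push_cast; ring

lemma SmallEps.ceil_pow (h : SmallEps ε y L) (n : ℕ) :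
    y ^ n ≤ ⌈y ^ n⌉₊ ∧ (⌈y ^ n⌉₊ : ℝ) ≤ 2 * y ^ n := by
  have h1 : 1 ≤ y ^ n := one_le_pow₀ (by linarith [h.big])
  exact ⟨Nat.le_ceil _, by linarith [Nat.ceil_lt_add_one (show 0 ≤ y ^ n by linarith)]⟩

lemma SmallEps.ceil_log (h : SmallEps ε y L) : L ≤ ⌈L⌉₊ ∧ (⌈L⌉₊ : ℝ) ≤ 2 * L :=
  ⟨Nat.le_ceil _, by
    linarith [Nat.ceil_lt_add_one (show 0 ≤ L by linarith [h.le_log]), h.le_log]⟩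

lemma SmallEps.ell_le (h : SmallEps ε y L) (n : ℕ) :
    3 * (⌈y ^ 36⌉₊ : ℝ) / L ^ (2 * n) ≤ ell ε n ∧
      (ell ε n : ℝ) ≤ 3 * (⌈y ^ 36⌉₊ : ℝ) / L ^ (2 * n) + 1 := by
  have hL : 0 < L := by linarith [h.le_log]
  rw [h.ell_eq]
  exact ⟨Nat.le_ceil _, (Nat.ceil_lt_add_one (by positivity)).le⟩

/-- The number of sites, in units of `L ^ 8`. -/
lemma SmallEps.exists_unit (h : SmallEps ε y L) :
    ∃ r : ℝ, 10 ^ 7 * y ^ 35 ≤ r ∧ (⌈y ^ 36⌉₊ : ℝ) = r * L ^ 8 := by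
  have hL : 0 < L := by linarith [h.le_log]
  have hy : 0 < y := by linarith [h.big]
  have hk := (h.ceil_pow 36).1
  refine ⟨⌈y ^ 36⌉₊ / L ^ 8, ?_, by field_simp⟩
  rw [le_div_iff₀ (by positivity)]
  refine le_trans ?_ hk
  calc 10 ^ 7 * y ^ 35 * L ^ 8 = y ^ 35 * (10 ^ 7 * L ^ 8) := by ring
    _ ≤ y ^ 35 * y := by gcongr; exact h.log_le
    _ = y ^ 36 := by ring

lemma SmallEps.mul_pow_le (h : SmallEps ε y L) {c : ℝ} (hc : c ≤ y) {a b : ℕ} (hab : a + 2 ≤ b) :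
    c * y ^ a * (y ^ b)⁻¹ ≤ y⁻¹ := by
  have hy : 1 ≤ y := by linarith [h.big]
  have hy0 : 0 < y := by linarith
  rw [← div_eq_mul_inv, div_le_iff₀ (by positivity)]
  calc c * y ^ a ≤ y * y ^ a := by gcongr
    _ = y⁻¹ * y ^ (a + 2) := by field_simp; ring
    _ ≤ y⁻¹ * y ^ b := by gcongr

/-- An interval of length `c` contains `m` blocks of length `c / m`. -/
lemma SmallEps.le_div (h : SmallEps ε y L) {c : ℕ} {z : ℝ} (hz : 2 ≤ z) (hc : 3 * z * L ≤ c) :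
    z ≤ (c / ⌈L⌉₊ : ℕ) := by
  have hL : 0 < L := by linarith [h.le_log]
  obtain ⟨h1, h2⟩ := h.ceil_log
  have hm : 0 < ⌈L⌉₊ := Nat.ceil_pos.2 hL
  have h3 : c < ⌈L⌉₊ * (c / ⌈L⌉₊ + 1) := Nat.lt_mul_div_succ c hm
  have h4 : (c : ℝ) < ⌈L⌉₊ * ((c / ⌈L⌉₊ : ℕ) + 1) := by exact_mod_cast h3
  have h5 : 3 * z * L < 2 * L * ((c / ⌈L⌉₊ : ℕ) + 1) :=
    hc.trans_lt (h4.trans_le (by gcongr))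
  have h6 : L * (3 * z) < L * (2 * ((c / ⌈L⌉₊ : ℕ) + 1)) := by linarith
  have := lt_of_mul_lt_mul_left h6 hL.le
  linarith

/-- Consecutive ℓ_n differ by a factor L². Cutting into about L blocks uses one factor L, and the
other one leaves blocks longer than the next scale. -/
lemma SmallEps.exists_scales (h : SmallEps ε y L) : ∃ M b₁ b₂ : ℕ,
    StepScales ε ⌈L⌉₊ M b₁ b₂ ∧ 36 * L * y ^ 24 ≤ M := by
  have hL : 100 ≤ L := h.le_log
  have hL0 : 0 < L := by linarith
  have hy := h.big
  have hyL := h.le_y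
  obtain ⟨r, hr, hk⟩ := h.exists_unit
  have hy35 : y ^ 24 * y ≤ y ^ 35 := by
    rw [← pow_succ]; exact pow_le_pow_right₀ (by linarith) (by norm_num)
  have hy24 : 1 ≤ y ^ 24 := one_le_pow₀ (by linarith)
  have hry : y ^ 24 * y ≤ r := by linarith [pow_pos (show 0 < y by linarith) 35]
  have hr1 : 10 ^ 9 ≤ r := by nlinarith
  have e1 := h.ell_le 1
  have e2 := h.ell_le 2
  have e3 := h.ell_le 3
  rw [hk] at e1 e2 e3
  rw [show 3 * (r * L ^ 8) / L ^ (2 * 1) = 3 * r * L ^ 6 by field_simp] at e1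
  rw [show 3 * (r * L ^ 8) / L ^ (2 * 2) = 3 * r * L ^ 4 by field_simp] at e2
  rw [show 3 * (r * L ^ 8) / L ^ (2 * 3) = 3 * r * L ^ 2 by field_simp] at e3
  have hL3 : 1 ≤ L ^ 3 := one_le_pow₀ (by linarith)
  have hL2 : 1 ≤ L ^ 2 := one_le_pow₀ (by linarith)
  have hrL3 : 10 ^ 9 ≤ r * L ^ 3 := by nlinarith
  have hrL2 : 10 ^ 9 ≤ r * L ^ 2 := by nlinarith
  have hrL4 : r * L ^ 4 * 100 ≤ r * L ^ 5 := by
    have : r * L ^ 4 * 100 ≤ r * L ^ 4 * L := by gcongr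
    linarith [show r * L ^ 4 * L = r * L ^ 5 by ring]
  have hrL5 : r * L ^ 2 * 100 ≤ r * L ^ 3 := by
    have : r * L ^ 2 * 100 ≤ r * L ^ 2 * L := by gcongr
    linarith [show r * L ^ 2 * L = r * L ^ 3 by ring]
  have hrL6 : 10 ^ 9 ≤ r * L ^ 4 := by
    have : r * L ^ 2 * 1 ≤ r * L ^ 2 * L ^ 2 := by gcongr
    linarith [show r * L ^ 2 * L ^ 2 = r * L ^ 4 by ring]
  have hb₁ := h.le_div (c := ell ε 1) (z := r * L ^ 5) (by linarith) (by
    linarith [e1.1, show 3 * (r * L ^ 5) * L = 3 * r * L ^ 6 by ring])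
  have hb₂ := h.le_div (c := ell ε 2) (z := r * L ^ 3) (by linarith) (by
    linarith [e2.1, show 3 * (r * L ^ 3) * L = 3 * r * L ^ 4 by ring])
  set b₁ := ell ε 1 / ⌈L⌉₊
  set b₂ := ell ε 2 / ⌈L⌉₊ with hb₂def
  have h32 : ell ε 3 ≤ b₂ := by
    have : (ell ε 3 : ℝ) ≤ b₂ := by linarith [e3.2]
    exact_mod_cast this
  have h21 : ell ε 2 ≤ b₁ := by
    have : (ell ε 2 : ℝ) ≤ b₁ := by linarith [e2.2]
    exact_mod_cast this
  have hb₂2 : b₂ ≤ ell ε 2 := Nat.div_le_self _ _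
  have hb10 : 10 ≤ b₂ := by
    have : (10 : ℝ) ≤ b₂ := by linarith
    exact_mod_cast this
  refine ⟨(b₂ - 2) / 8, b₁, b₂, ⟨by omega, by omega, Nat.mul_div_le _ _, h32, by omega,
    Nat.mul_div_le _ _, by omega, h21⟩, ?_⟩
  have hM : (b₂ : ℝ) ≤ 8 * ((b₂ - 2) / 8 : ℕ) + 10 := by
    have : b₂ ≤ 8 * ((b₂ - 2) / 8) + 10 := by omega
    exact_mod_cast this
  have h1 : y ^ 24 * (10 ^ 7 * L) ≤ r := le_trans (by gcongr) hry
  have h2 : r ≤ r * L ^ 3 := by nlinarith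
  nlinarith

/-- The mixing time y^27 fixes the spacing `q`, and ℓ_3 is at least of order y^35. This leaves of
order y^8 sites or more per class, enough to beat θ² = exp(-2y^8). -/
lemma SmallEps.exists_nice_scales (h : SmallEps ε y L) : ∃ q M : ℕ,
    8 ∣ q ∧ 4 * ⌈y ^ 27⌉₊ + 3 ≤ q ∧ 1 ≤ M ∧ M * q + 2 ≤ ell ε 3 ∧ (q : ℝ) ≤ 24 * y ^ 27 ∧
      2 * y ^ 8 ≤ M / 63504 := by
  have hL : 100 ≤ L := h.le_log
  have hL0 : 0 < L := by linarith
  have hy := h.big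
  have hy0 : 0 < y := by linarith
  obtain ⟨r, hr, hk⟩ := h.exists_unit
  have e3 := (h.ell_le 3).1
  rw [hk, show 3 * (r * L ^ 8) / L ^ (2 * 3) = 3 * r * L ^ 2 by field_simp] at e3
  have hL2 : 1 ≤ L ^ 2 := one_le_pow₀ (by linarith)
  have hy8 : y ≤ y ^ 8 := le_self_pow₀ (by linarith) (by norm_num)
  have hy27 : y ≤ y ^ 27 := le_self_pow₀ (by linarith) (by norm_num)
  have hs := (h.ceil_pow 27).2
  set s := ⌈y ^ 27⌉₊
  have hell : 10 ^ 7 * y ^ 35 ≤ ell ε 3 := by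
    have h1 := pow_pos hy0 35
    have h2 : r * 1 ≤ r * L ^ 2 := by gcongr; linarith
    linarith
  have hq : ((8 * (s + 1) : ℕ) : ℝ) ≤ 24 * y ^ 27 := by push_cast; linarith
  have hq0 : 0 < 8 * (s + 1) := by omega
  have hlt : (ell ε 3 - 2 : ℕ) < 8 * (s + 1) * ((ell ε 3 - 2) / (8 * (s + 1)) + 1) :=
    Nat.lt_mul_div_succ _ hq0
  have hle : (ell ε 3 - 2) / (8 * (s + 1)) * (8 * (s + 1)) ≤ ell ε 3 - 2 := Nat.div_mul_le_self _ _
  set q := 8 * (s + 1)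
  set M := (ell ε 3 - 2) / q
  have hell2 : ell ε 3 ≤ q * (M + 1) + 2 := by omega
  have hell2' : (ell ε 3 : ℝ) ≤ q * (M + 1) + 2 := by exact_mod_cast hell2
  have hM : 2 * y ^ 8 ≤ M / 63504 := by
    have h1 : (q : ℝ) * (M + 1) ≤ 24 * y ^ 27 * (M + 1) := by gcongr
    have h2 : y ^ 27 * (10 ^ 7 * y ^ 8) ≤ y ^ 27 * (24 * (M + 1) + 1) := by
      have : y ^ 27 * (10 ^ 7 * y ^ 8) = 10 ^ 7 * y ^ 35 := by ring
      linarith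
    have := le_of_mul_le_mul_left h2 (by positivity)
    linarith
  have hM1 : 1 ≤ M := by
    have : (1 : ℝ) ≤ M := by linarith
    exact_mod_cast this
  have hq1 : q * 1 ≤ M * q := by rw [mul_comm]; gcongr
  exact ⟨q, M, ⟨s + 1, rfl⟩, by omega, hM1, by omega, hq, hM⟩

lemma SmallEps.exists_front_scales (h : SmallEps ε y L) : ∃ b : ℕ,
    ⌈L⌉₊ * b ≤ 6 * ⌈y ^ 36⌉₊ ∧ ell ε 1 ≤ b ∧ 2 * ⌈y ^ 18⌉₊ + 2 ≤ b := by
  have hL : 100 ≤ L := h.le_log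
  have hL0 : 0 < L := by linarith
  have hy := h.big
  have hy0 : 0 < y := by linarith
  obtain ⟨r, hr, hk⟩ := h.exists_unit
  have e1 := (h.ell_le 1).2
  rw [hk, show 3 * (r * L ^ 8) / L ^ (2 * 1) = 3 * r * L ^ 6 by field_simp] at e1
  have hL6 : 1 ≤ L ^ 6 := one_le_pow₀ (by linarith)
  have hy18 : 1 ≤ y ^ 18 := one_le_pow₀ (by linarith)
  have h35 : y ^ 18 ≤ y ^ 35 := pow_le_pow_right₀ (by linarith) (by norm_num)
  have hr0 : 0 < r := by linarith
  have h1 : r * 1 ≤ r * L ^ 6 := by gcongr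
  have h2 : r * L ^ 6 * 100 ≤ r * L ^ 7 := by
    have : r * L ^ 6 * 100 ≤ r * L ^ 6 * L := by gcongr
    linarith [show r * L ^ 6 * L = r * L ^ 7 by ring]
  have hb := h.le_div (c := 6 * ⌈y ^ 36⌉₊) (z := r * L ^ 7) (by linarith) (by
    push_cast; rw [hk]; nlinarith [pow_pos hL0 8])
  refine ⟨6 * ⌈y ^ 36⌉₊ / ⌈L⌉₊, Nat.mul_div_le _ _, ?_, ?_⟩
  · have : (ell ε 1 : ℝ) ≤ (6 * ⌈y ^ 36⌉₊ / ⌈L⌉₊ : ℕ) := by linarith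
    exact_mod_cast this
  · have := (h.ceil_pow 18).2
    have : ((2 * ⌈y ^ 18⌉₊ + 2 : ℕ) : ℝ) ≤ (6 * ⌈y ^ 36⌉₊ / ⌈L⌉₊ : ℕ) := by push_cast; linarith
    exact_mod_cast this

lemma SmallEps.four_mul_le (h : SmallEps ε y L) : 4 * ε * ⌈y ^ 18⌉₊ ≤ 1 := by
  have hy := h.big
  have hy0 : 0 < y := by linarith
  have h1 := h.mul_pow_le (c := 8) (by linarith) (show 18 + 2 ≤ 24 by norm_num)
  have h2 : y⁻¹ ≤ 1 := inv_le_one_of_one_le₀ (by linarith)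
  rw [h.eps_eq]
  calc 4 * (y ^ 24)⁻¹ * (⌈y ^ 18⌉₊ : ℝ) ≤ 4 * (y ^ 24)⁻¹ * (2 * y ^ 18) := by
        gcongr; exact (h.ceil_pow 18).2
    _ ≤ 1 := by linarith

/-- Since 2p-1 ≤ 1-ε, any time much larger than 1/ε = y^24 suffices; y^27 exceeds it by the factor
y^3. -/
lemma SmallEps.pow_mixing_le (h : SmallEps ε y L) {p : ℝ} (hp : 1 / 2 ≤ p)
    (hε : ε ≤ 2 * (1 - p)) : (2 * p - 1) ^ ⌈y ^ 27⌉₊ ≤ 1 / 252 := by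
  have hy := h.big
  have hy0 : 0 < y := by linarith
  have h1 : 252 ≤ ε * ⌈y ^ 27⌉₊ := by
    rw [h.eps_eq, inv_mul_eq_div, le_div_iff₀ (by positivity)]
    refine le_trans ?_ (h.ceil_pow 27).1
    have h2 : y ≤ y ^ 3 := le_self_pow₀ (by linarith) (by norm_num)
    calc 252 * y ^ 24 ≤ y ^ 3 * y ^ 24 := by gcongr; linarith
      _ = y ^ 27 := by ring
  calc (2 * p - 1) ^ ⌈y ^ 27⌉₊ ≤ Real.exp (-ε) ^ ⌈y ^ 27⌉₊ := by
        refine pow_le_pow_left₀ (by linarith) ?_ _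
        linarith [Real.add_one_le_exp (-ε)]
    _ = (Real.exp (ε * ⌈y ^ 27⌉₊))⁻¹ := by
        rw [← Real.exp_nat_mul, ← Real.exp_neg]; congr 1; ring
    _ ≤ 1 / 252 := by
        rw [one_div]
        refine inv_anti₀ (by norm_num) ?_
        linarith [Real.add_one_le_exp (ε * ⌈y ^ 27⌉₊)]

/-- `exp (- c L)` is a power of `y`. -/
lemma SmallEps.exp_le (h : SmallEps ε y L) {z : ℝ} (n : ℕ) (hz : n * L ≤ 24 * z) :
    Real.exp (-z) ≤ (y ^ n)⁻¹ := by
  have hy : 0 < y := by linarith [h.big]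
  rw [Real.exp_neg]
  refine inv_anti₀ (by positivity) ?_
  rw [← Real.log_le_iff_le_exp (by positivity), Real.log_pow]
  have := h.log_eq
  rw [this] at hz
  linarith

/-- The bound e^{-4} per block over at least L blocks gives e^{-4L} = y^{-96}, which beats the
factor y^72 of the union bounds over times and sites. -/
lemma SmallEps.pow_flip_le (h : SmallEps ε y L) {p : ℝ} (hp1 : p ≤ 1)
    (hp : 2 * (1 - p) ≤ Real.exp (-4)) : (2 * (1 - p)) ^ ⌈L⌉₊ ≤ (y ^ 96)⁻¹ := by
  refine (pow_le_pow_left₀ (by linarith) hp _).trans ?_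
  rw [← Real.exp_nat_mul, mul_neg]
  exact h.exp_le 96 (by push_cast; linarith [h.ceil_log.1])

lemma SmallEps.stepErr_le (h : SmallEps ε y L) {p : ℝ} (hp1 : p ≤ 1)
    (hp : 2 * (1 - p) ≤ Real.exp (-4)) {M : ℕ} (hM : 36 * L * y ^ 24 ≤ M) :
    stepErr p ε ⌈L⌉₊ M ≤ 2 * (y ^ 96)⁻¹ := by
  have hy : 0 < y := by linarith [h.big]
  have h1 : 36 * L ≤ ε * M := by
    rw [h.eps_eq, inv_mul_eq_div, le_div_iff₀ (by positivity)]; exact hM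
  have h2 := h.exp_le 96 (z := ε * (M / 9)) (by push_cast; linarith)
  have h3 := h.pow_flip_le hp1 hp
  unfold stepErr; linarith

lemma SmallEps.K_le (h : SmallEps ε y L) : (K ε : ℝ) ≤ 20 * y ^ 36 := by
  rw [h.K_eq]; push_cast; linarith [(h.ceil_pow 36).2]

lemma SmallEps.T_le (h : SmallEps ε y L) : (T ε : ℝ) ≤ 80 * y ^ 36 := by
  unfold T; push_cast; linarith [h.K_le]

/-- Half of the exponent 2y^8 produces θ, to be divided out in Markov's inequality for `Q`; the
other half beats any fixed power of y. -/
lemma SmallEps.niceErr_le (h : SmallEps ε y L) {q M : ℕ} (hq : (q : ℝ) ≤ 24 * y ^ 27)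
    (hM : 2 * y ^ 8 ≤ M / 63504) : niceErr (K ε) q M ≤ (y ^ 100)⁻¹ * theta ε := by
  have hy := h.big
  have hy0 : 0 < y := by linarith
  have hy8 : y ≤ y ^ 8 := le_self_pow₀ (by linarith) (by norm_num)
  have h1 := h.exp_le 201 (z := y ^ 8) (by push_cast; linarith [h.le_y, h.le_log])
  rw [h.theta_eq]
  unfold niceErr
  calc (K ε : ℝ) ^ 2 * q * 7 * Real.exp (-(M / 63504))
      ≤ (20 * y ^ 36) ^ 2 * (24 * y ^ 27) * 7 * ((y ^ 201)⁻¹ * Real.exp (-(y ^ 8))) := by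
        gcongr
        · exact h.K_le
        · refine le_trans ?_ (mul_le_mul_of_nonneg_right h1 (Real.exp_pos _).le)
          rw [← Real.exp_add]; gcongr; linarith
    _ = 67200 * y ^ 99 * (y ^ 201)⁻¹ * Real.exp (-(y ^ 8)) := by ring
    _ ≤ (y ^ 100)⁻¹ * Real.exp (-(y ^ 8)) := by
        gcongr
        rw [← div_eq_mul_inv, div_le_iff₀ (by positivity)]
        calc 67200 * y ^ 99 ≤ y * y ^ 99 := by gcongr; linarith
          _ ≤ (y ^ 100)⁻¹ * y ^ 200 := by apply le_of_eq; field_simp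
          _ ≤ (y ^ 100)⁻¹ * y ^ 201 := by
              gcongr
              · linarith
              · norm_num

end Asymptotics

/-! ### The total error tends to 0. -/

section Limit

variable {ε y L : ℝ}

lemma SmallEps.totalErr_le (h : SmallEps ε y L) {p : ℝ} (hp1 : p ≤ 1)
    (hp : 2 * (1 - p) ≤ Real.exp (-4)) {q M M' : ℕ} (hq : (q : ℝ) ≤ 24 * y ^ 27)
    (hM : 2 * y ^ 8 ≤ M / 63504) (hM' : 36 * L * y ^ 24 ≤ M') :
    totalErr p ε q M ⌈L⌉₊ M' ⌈y ^ 18⌉₊ ≤ 13 * y⁻¹ := by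
  have hL : 0 < L := by linarith [h.le_log]
  have hy := h.big
  have hyL := h.le_y
  have hy0 : 0 < y := by linarith
  have hy1 : 1 ≤ y := by linarith
  have hθ : 0 < theta ε := Real.exp_pos _
  have hθ1 : theta ε ≤ y⁻¹ := by
    rw [h.theta_eq]
    have := h.exp_le 1 (z := y ^ 8) (by
      push_cast; linarith [le_self_pow₀ hy1 (show 8 ≠ 0 by norm_num)])
    simpa using this
  have hθ' : theta ε ≤ 1 := hθ1.trans (inv_le_one_of_one_le₀ hy1)
  have hK := h.K_le
  have hT := h.T_le
  have hε : 0 < ε := by rw [h.eps_eq]; positivity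
  have hσ := h.stepErr_le hp1 hp hM'
  have hσ0 := stepErr_nonneg hp1 ε ⌈L⌉₊ M'
  have hν := h.niceErr_le hq hM
  have hν1 : niceErr (K ε) q M ≤ (y ^ 100)⁻¹ := hν.trans (mul_le_of_le_one_right (by positivity) hθ')
  have hν0 := niceErr_nonneg (K ε) q M
  have hm := h.ceil_log.2
  have hk := (h.ceil_pow 36).1
  have hd := (h.ceil_pow 18)
  have t1 : T ε * (2 * (1 - p)) ^ ⌈L⌉₊ ≤ y⁻¹ := by
    calc _ ≤ 80 * y ^ 36 * (y ^ 96)⁻¹ := mul_le_mul hT (h.pow_flip_le hp1 hp)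
          (pow_nonneg (by linarith) _) (by positivity)
      _ ≤ y⁻¹ := h.mul_pow_le (by linarith) (by norm_num)
  -- Losses contribute about εT/d₀ and failures about εd₀, both up to a factor L. The choice d₀ =
  -- y^18, of the order of √T, balances them at y^{-6} L.
  have t2 : ⌈L⌉₊ * (8 * ε * (T ε / (⌈y ^ 18⌉₊ + 1) + 1 : ℕ)) ≤ y⁻¹ := by
    have hdiv : ((T ε / (⌈y ^ 18⌉₊ + 1) + 1 : ℕ) : ℝ) ≤ 81 * y ^ 18 := by
      push_cast
      have h1 : ((T ε / (⌈y ^ 18⌉₊ + 1) : ℕ) : ℝ) ≤ T ε / (⌈y ^ 18⌉₊ + 1 : ℕ) := Nat.cast_div_le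
      have h2 : (T ε : ℝ) / (⌈y ^ 18⌉₊ + 1 : ℕ) ≤ 80 * y ^ 18 := by
        rw [div_le_iff₀ (by positivity)]
        push_cast
        calc (T ε : ℝ) ≤ 80 * y ^ 18 * y ^ 18 := by linarith
          _ ≤ 80 * y ^ 18 * (⌈y ^ 18⌉₊ + 1) := by gcongr; linarith
      have h3 : 1 ≤ y ^ 18 := one_le_pow₀ hy1
      linarith
    calc _ ≤ 2 * L * (8 * ε * (81 * y ^ 18)) := by gcongr
      _ = 1296 * L * y ^ 18 * (y ^ 24)⁻¹ := by rw [h.eps_eq]; ring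
      _ ≤ y⁻¹ := h.mul_pow_le (by linarith) (by norm_num)
  have t3 : 2 * T ε * ⌈L⌉₊ * (2 * ⌈y ^ 18⌉₊ + 1) * ε / (⌈ε ^ (-(3 / 2) : ℝ)⌉₊ + 1) ≤ y⁻¹ := by
    rw [h.rpow_eq (3 / 2) 36 (by norm_num), div_le_iff₀ (by positivity)]
    have h3 : 1 ≤ y ^ 18 := one_le_pow₀ hy1
    calc _ ≤ 2 * (80 * y ^ 36) * (2 * L) * (5 * y ^ 18) * ε := by gcongr; linarith
      _ = 1600 * L * y ^ 18 * (y ^ 24)⁻¹ * y ^ 36 := by rw [h.eps_eq]; ring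
      _ ≤ y⁻¹ * (⌈y ^ 36⌉₊ + 1) := by
          refine mul_le_mul (h.mul_pow_le (by linarith) (by norm_num)) (by linarith)
            (by positivity) (by positivity)
  have t4 : T ε * niceErr (K ε) q M ≤ y⁻¹ := by
    calc _ ≤ 80 * y ^ 36 * (y ^ 100)⁻¹ := by gcongr
      _ ≤ y⁻¹ := h.mul_pow_le (by linarith) (by norm_num)
  have t5 : T ε * (K ε * 12 * stepErr p ε ⌈L⌉₊ M') ≤ y⁻¹ := by
    calc _ ≤ 80 * y ^ 36 * (20 * y ^ 36 * 12 * (2 * (y ^ 96)⁻¹)) := by gcongr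
      _ = 38400 * y ^ 72 * (y ^ 96)⁻¹ := by ring
      _ ≤ y⁻¹ := h.mul_pow_le (by linarith) (by norm_num)
  have t6 : niceErr (K ε) q M ≤ y⁻¹ := by
    refine hν1.trans (inv_anti₀ hy0 (le_self_pow₀ hy1 (by norm_num)))
  have t7 : K ε * 16 * stepErr p ε ⌈L⌉₊ M' ≤ y⁻¹ := by
    calc _ ≤ 20 * y ^ 36 * 16 * (2 * (y ^ 96)⁻¹) := by gcongr
      _ = 640 * y ^ 36 * (y ^ 96)⁻¹ := by ring
      _ ≤ y⁻¹ := h.mul_pow_le (by linarith) (by norm_num)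
  have t8 : K ε * (2 * niceErr (K ε) q M) / theta ε ≤ y⁻¹ := by
    rw [div_le_iff₀ hθ]
    calc _ ≤ 20 * y ^ 36 * (2 * ((y ^ 100)⁻¹ * theta ε)) := by gcongr
      _ = 40 * y ^ 36 * (y ^ 100)⁻¹ * theta ε := by ring
      _ ≤ y⁻¹ * theta ε := by
          gcongr
          exact h.mul_pow_le (by linarith) (by norm_num)
  -- Three terms come from vanishing, three from the danger along the way, six from the danger at
  -- time T on the two sides, and one from `Q`: hence 13.
  unfold totalErr
  linarith [inv_pos.2 hy0]

/-- All small `ε` are covered by the parametrization. -/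
lemma exists_smallEps {δ : ℝ} (hδ : 0 < δ) :
    ∃ ε₀ > 0, ∀ ε, 0 < ε → ε < ε₀ → ∃ y L, SmallEps ε y L ∧ 13 * y⁻¹ ≤ δ := by
  have hlog : Tendsto (fun y : ℝ => 24 * Real.log y) atTop atTop :=
    Real.tendsto_log_atTop.const_mul_atTop (by norm_num)
  have hpow : ∀ᶠ y : ℝ in atTop, 10 ^ 7 * (24 * Real.log y) ^ 8 ≤ y := by
    have h := (Real.isLittleO_pow_log_id_atTop (n := 8)).bound
      (show (0 : ℝ) < 1 / (10 ^ 7 * 24 ^ 8) by norm_num)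
    filter_upwards [h, eventually_ge_atTop 1] with y hy hy1
    rw [Real.norm_of_nonneg (by positivity), id, Real.norm_of_nonneg (by linarith)] at hy
    rw [mul_pow]; linarith
  have hδ' : ∀ᶠ y : ℝ in atTop, 13 / δ ≤ y := eventually_ge_atTop _
  obtain ⟨y₀, hy₀⟩ := eventually_atTop.1
    ((hlog.eventually_ge_atTop 100).and (hpow.and (hδ'.and (eventually_gt_atTop 0))))
  have hy₀' := (hy₀ y₀ le_rfl).2.2.2
  refine ⟨(y₀ ^ 24)⁻¹, by positivity, fun ε hε hlt => ?_⟩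
  have hpow24 : (ε ^ (-(1 / 24) : ℝ)) ^ 24 = ε⁻¹ := by
    rw [← Real.rpow_natCast, ← Real.rpow_mul hε.le, ← Real.rpow_neg_one]; norm_num
  have hle : y₀ ≤ ε ^ (-(1 / 24) : ℝ) := by
    refine le_of_pow_le_pow_left₀ (n := 24) (by norm_num) (by positivity) ?_
    rw [hpow24]
    exact (le_inv_comm₀ hε (by positivity)).1 hlt.le
  obtain ⟨h1, h2, h3, h4⟩ := hy₀ _ hle
  refine ⟨ε ^ (-(1 / 24) : ℝ), _, ⟨?_, rfl, h1, h2⟩, ?_⟩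
  · rw [hpow24, inv_inv]
  · rw [div_le_iff₀ hδ] at h3
    rw [mul_inv_le_iff₀ h4]; linarith

variable {Ω : Type*} [MeasurableSpace Ω] {P : Measure Ω} {p : ℝ} {F : ℤ → ℕ → Ω → LocalRule}
  [IsProbabilityMeasure P]

lemma IsBasicCoupling.measureReal_not_isGood_le_of_smallEps (hF : IsBasicCoupling P p F)
    (hp : 1 / 2 ≤ p) (hp1 : p ≤ 1) (hflip : 2 * (1 - p) ≤ Real.exp (-4)) {ξ ζ : Config}
    {abc : Triple} (habc : qMax P F abc = eps P F) (h : SmallEps (eps P F) y L)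
    (h0 : ∀ ω, IsGood P F abc ξ ζ 0 0 ω) :
    P.real {ω | ¬ IsGood P F abc ξ ζ 1 1 ω} ≤ 13 * y⁻¹ := by
  have hy := h.big
  have hy0 : 0 < y := by linarith
  obtain ⟨M', b₁, b₂, hS, hM'⟩ := h.exists_scales
  obtain ⟨q, M, hq8, hqw, hM0, hM, hq, hM2⟩ := h.exists_nice_scales
  obtain ⟨b, hmb, hℓ₁, hb⟩ := h.exists_front_scales
  have hK : 0 < K (eps P F) := by
    rw [h.K_eq]; have := Nat.ceil_pos.2 (show 0 < y ^ 36 by positivity); omega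
  have hs : ⌈y ^ 27⌉₊ ≤ K (eps P F) := by
    rw [h.K_eq]
    have : ⌈y ^ 27⌉₊ ≤ ⌈y ^ 36⌉₊ :=
      Nat.ceil_le_ceil (pow_le_pow_right₀ (by linarith) (by norm_num))
    omega
  rw [← h.rpow_eq (3 / 2) 36 (by norm_num)] at hmb
  exact (hF.measureReal_not_isGood_le hp hp1 habc hK hs (h.pow_mixing_le hp hF.eps_le) hq8 hqw
    hM0 hM hS hmb hℓ₁ hb (Nat.ceil_pos.2 (by positivity)) h.four_mul_le h0).trans
    (h.totalErr_le hp1 hflip hq hM2 hM')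

end Limit

end FlipPreserve

/-- The limit `p → 1` is uniform: the threshold on `p` depends on the tolerance `δ` only, not on
the coupling, the triple `abc` realizing the maximum in `ε`, or the initial conditions. -/
theorem mainTheorem2 (δ : ℝ) (hδ : 0 < δ) :
    ∃ p₀ < (1 : ℝ), ∀ p : ℝ, p₀ < p → p < 1 →
      ∀ (Ω : Type*) [MeasurableSpace Ω] (P : Measure Ω) [IsProbabilityMeasure P]
        (F : ℤ → ℕ → Ω → FlipPreserve.LocalRule),
        FlipPreserve.IsBasicCoupling P p F →
        0 < FlipPreserve.eps P F →
        ∀ abc : FlipPreserve.Cell × FlipPreserve.Cell × FlipPreserve.Cell,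
          FlipPreserve.qMax P F abc = FlipPreserve.eps P F →
          ∀ ξ ζ : FlipPreserve.Config,
            (∀ ω, FlipPreserve.IsGood P F abc ξ ζ 0 0 ω) →
            1 - δ ≤ P.real {ω | FlipPreserve.IsGood P F abc ξ ζ 1 1 ω} := by
  obtain ⟨ε₀, hε₀, hsmall⟩ := FlipPreserve.exists_smallEps hδ
  have hexp := Real.exp_pos (-4)
  have hexp1 : Real.exp (-4) ≤ 1 := Real.exp_le_one_iff.2 (by norm_num)
  -- This threshold makes 2(1-p) smaller than both ε₀, which bounds ε, and e^{-4}, which bounds the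
  -- probability of a deviation per block.
  refine ⟨1 - min ε₀ (Real.exp (-4)) / 2, by linarith [lt_min hε₀ hexp], ?_⟩
  intro p hp₀ hp1 Ω _ P _ F hF hε abc habc ξ ζ h0
  have hmin₁ := min_le_left ε₀ (Real.exp (-4))
  have hmin₂ := min_le_right ε₀ (Real.exp (-4))
  obtain ⟨y, L, h, hy⟩ := hsmall _ hε (hF.eps_le.trans_lt (by linarith))
  have hbad := hF.measureReal_not_isGood_le_of_smallEps (by linarith) hp1.le (by linarith) habc h h0
  -- Subadditivity suffices here, and avoids proving that the event is measurable.
  have hone : 1 ≤ P.real {ω | FlipPreserve.IsGood P F abc ξ ζ 1 1 ω} +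
      P.real {ω | ¬ FlipPreserve.IsGood P F abc ξ ζ 1 1 ω} := by
    refine le_trans (le_of_eq ?_) (measureReal_union_le _ _)
    rw [show {ω | FlipPreserve.IsGood P F abc ξ ζ 1 1 ω} ∪
      {ω | ¬ FlipPreserve.IsGood P F abc ξ ζ 1 1 ω} = Set.univ from
      Set.eq_univ_of_forall fun ω => Classical.em _, probReal_univ]
  linarith
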